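/- **Setting.** Let $K$ be a separably closed field of characteristic $p>0$ with algebraic closure $\overline K$, let $C$ be a regular, geometrically integral curve over $K$ (separated, of finite type, of dimension one), and let $P\in C$. For $i\ge 0$ let $C^{(p^i)}$ be the base change of $C$ along the $i$-th iterate of the Frobenius of $K$, let $F^i\colon C\to C^{(p^i)}$ be the $i$-th iterate of the relative Frobenius morphism, let $C_i$ be the normalization of $C^{(p^i)}$ (so $C_0=C$), and let $P_i$ be the point of $C_i$ lying over $F^i(P)$ (so $P_0=P$). For a point $R$ of a geometrically integral curve $D$ over $K$ that is not its generic point, let $\overline K\mathcal O_{D,R}=\overline K\otimes_K\mathcal O_{D,R}$ be the local ring of $D\times_K\overline K$ at the unique point over $R$, let $\widetilde{\mathcal O}$ be its normalization in its field of fractions, which is a discrete valuation ring, and let $\nu$ be its valuation. * The *differential degree* is $d(D,R)=1+\dim_{\overline K}\operatorname{Coker}(\alpha)$, where $\alpha\colon \widetilde{\mathcal O}\otimes_{\overline K\mathcal O_{D,R}}\Omega_{\overline K\mathcal O_{D,R}/\overline K}\to\Omega_{\widetilde{\mathcal O}/\overline K}$ is the natural map of modules of Kähler differentials. * The *conductor*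 $c(D,R)$ is the conductor of the semigroup $\Gamma=\{\nu(x) : 0\ne x\in \overline K\mathcal O_{D,R}\}\subseteq\mathbb Z_{\ge 0}$, that is, the largest positive integer $c\in\Gamma$ with $c-1\notin\Gamma$, or $0$ if $\Gamma=\mathbb Z_{\ge0}$. **Theorem.** Suppose that $n$ is a positive integer such that $P_n$ is a rational point of $C_n$ (its residue field is $K$). Then $\Gamma$ at $P$ contains all sufficiently large integers, the cokernels defining $d(C_i,P_i)$ for $0\le i<n$ are finite-dimensional over $\overline K$, and $$c(C,P)=\sum_{0\le i<n}(p-1)\,\bigl(d(C_i,P_i)-1\bigr)\,p^{i}.$$ -/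

import Mathlib

open CategoryTheory CategoryTheory.Limits AlgebraicGeometry TensorProduct

universe u

noncomputable section

namespace FrobeniusTower

/-! ### Invariants of an algebra over an algebraically closed field -/

section Ring

variable (L A : Type u) [Field L] [CommRing A] [Algebra L A]

/-- The normalization of a domain `A` in its field of fractions. -/
abbrev Normalized : Type u := integralClosure A (FractionRing A)

/-- The natural map `α : B ⊗ Ω_{A/L} → Ω_{B/L}`, where `B` is the normalization of `A`. -/
abbrev alphaMap : Normalized A ⊗[A] Ω[A⁄L] →ₗ[Normalized A] Ω[Normalized A⁄L] :=
  KaehlerDifferential.mapBaseChange L A (Normalized A)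

/-- The cokernel of `α`. -/
abbrev AlphaCoker : Type u := Ω[Normalized A⁄L] ⧸ LinearMap.range (alphaMap L A)

/-- The set of the values, at the nonzero elements of `A`, of the discrete valuation whose
valuation ring is the normalization of `A` (`addVal` takes the value `⊤` exactly at `0`). -/
def valueSemigroup : Set ℕ :=
  {l | ∃ (_ : IsDomain (Normalized A)) (_ : IsDiscreteValuationRing (Normalized A)) (x : A),
      IsDiscreteValuationRing.addVal (Normalized A) (algebraMap A (Normalized A) x) = (l : ℕ∞)}

end Ring

/-- The conductor of a set `S` of natural numbers: the largest positive integer `c ∈ S` such that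
`c - 1` is a gap of `S`. If there is no such `c` (for instance `S = ℕ`), the value is `0`. -/
def setConductor (S : Set ℕ) : ℕ := sSup {c | 0 < c ∧ c ∈ S ∧ c - 1 ∉ S}

/-! ### Points of schemes over a field -/

section Points

variable {K : Type u} [Field K] {X : Scheme.{u}} (f : X ⟶ Spec (CommRingCat.of K))

/-- The map from `K` to the sections of a `K`-scheme over an open subset. -/
def toSections (U : X.Opens) : CommRingCat.of K ⟶ Γ(X, U) :=
  (Scheme.ΓSpecIso (CommRingCat.of K)).inv ≫ f.appTop ≫ X.presheaf.map (homOfLE le_top).op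

/-- The map from `K` to the local ring of a `K`-scheme at a point. -/
def toStalk (x : X) : CommRingCat.of K ⟶ X.presheaf.stalk x :=
  (Scheme.ΓSpecIso (CommRingCat.of K)).inv ≫ f.appTop ≫ X.presheaf.germ ⊤ x trivial

/-- A point of a `K`-scheme is rational if its residue field is `K`. -/
def IsRationalPoint (x : X) : Prop :=
  Function.Bijective (toStalk f x ≫ X.residue x).hom

/-- The local ring at a point of a `K`-scheme, as a `K`-algebra. -/
def LocalRing (_ : X ⟶ Spec (CommRingCat.of K)) (x : X) : Type u := X.presheaf.stalk x

instance (x : X) : CommRing (LocalRing f x) :=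
  inferInstanceAs (CommRing (X.presheaf.stalk x))

instance (x : X) : Algebra K (LocalRing f x) :=
  RingHom.toAlgebra (S := LocalRing f x) (toStalk f x).hom

/-- The ring `K̄ O = K̄ ⊗ O`, where `O` is the local ring at `x`. On a geometrically integral
`K`-scheme with `K` separably closed, this is the local ring of the base change to `K̄` at the
unique point over `x`. -/
abbrev GeomLocalRing (x : X) : Type u := AlgebraicClosure K ⊗[K] LocalRing f x

/-- The cokernel of `α : B ⊗ Ω_{K̄O/K̄} → Ω_{B/K̄}`, where `O` is the local ring at `x` and `B` is
the normalization of `K̄ O`. -/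
abbrev DifferentialCoker (x : X) : Type u :=
  AlphaCoker (AlgebraicClosure K) (GeomLocalRing f x)

/-- The differential degree `d(X, x) = 1 + dim Coker α`, the dimension being over `K̄`. -/
def differentialDegree (x : X) : ℕ :=
  1 + Module.finrank (AlgebraicClosure K) (DifferentialCoker f x)

/-- The semigroup of values of `K̄ O`, where `O` is the local ring at `x`. -/
def geomSemigroup (x : X) : Set ℕ := valueSemigroup (GeomLocalRing f x)

/-- The conductor `c(X, x)` of the semigroup of values of `K̄ O`. -/
def conductor (x : X) : ℕ := setConductor (geomSemigroup f x)

end Points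

/-! ### Frobenius -/

section Frobenius

variable {K : Type u} [Field K] (p : ℕ) [Fact p.Prime] [CharP K p]

/-- On a ring that receives a ring homomorphism from a field of characteristic `p`, the ring
endomorphism `x ↦ x ^ (p ^ n)`. -/
def powHom {R : CommRingCat.{u}} (φ : CommRingCat.of K ⟶ R) (n : ℕ) : R ⟶ R :=
  CommRingCat.ofHom
    { toFun := fun x => x ^ p ^ n
      map_one' := one_pow _
      map_mul' := fun x y => mul_pow x y _
      map_zero' := zero_pow (pow_ne_zero n (Fact.out : p.Prime).ne_zero)
      map_add' := fun x y => by
        rcases subsingleton_or_nontrivial R with h | h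
        · exact Subsingleton.elim _ _
        · have : CharP R p := charP_of_injective_ringHom φ.hom.injective p
          exact add_pow_char_pow x y p n }

lemma powHom_apply {R : CommRingCat.{u}} (φ : CommRingCat.of K ⟶ R) (n : ℕ) (x : R) :
    (powHom p φ n).hom x = x ^ p ^ n := rfl

variable {X : Scheme.{u}} (f : X ⟶ Spec (CommRingCat.of K))

/-- The map `s ↦ s ^ (p ^ n)` on the structure sheaf. -/
def frobeniusSheafMap (n : ℕ) : X.presheaf ⟶ X.presheaf where
  app := fun U => powHom p (toSections f U.unop) n
  naturality := fun U V i => by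
    ext s
    exact (map_pow (X.presheaf.map i).hom s (p ^ n)).symm

/-- The `n`-th iterate of the absolute Frobenius morphism of a `K`-scheme: the identity on points,
and `s ↦ s ^ (p ^ n)` on sections. -/
def absFrobenius (n : ℕ) : X ⟶ X where
  base := 𝟙 _
  c := frobeniusSheafMap p f n
  prop := fun x => by
    constructor
    intro a ha
    obtain ⟨U, hxU, s, rfl⟩ := X.presheaf.exists_germ_eq a
    have h1 := PresheafedSpace.stalkMap_germ_apply (X := X.toPresheafedSpace)
      (Y := X.toPresheafedSpace) ⟨𝟙 _, frobeniusSheafMap p f n⟩ U x hxU s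
    have h2 : X.presheaf.germ U x hxU (s ^ p ^ n) = (X.presheaf.germ U x hxU s) ^ p ^ n :=
      map_pow (X.presheaf.germ U x hxU).hom s (p ^ n)
    have h3 : IsUnit (X.presheaf.germ U x hxU (s ^ p ^ n)) := by
      refine Eq.mp ?_ ha
      exact congrArg IsUnit h1
    rw [h2] at h3
    exact (isUnit_pow_iff (pow_ne_zero n (Fact.out : p.Prime).ne_zero)).1 h3

lemma absFrobenius_comp (n : ℕ) :
    absFrobenius p f n ≫ f =
      f ≫ Spec.map (CommRingCat.ofHom (iterateFrobenius K p n)) := by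
  apply ext_of_isAffine
  have h1 : (absFrobenius p f n).appTop = powHom p (toSections f ⊤) n := rfl
  rw [Scheme.Hom.comp_appTop, Scheme.Hom.comp_appTop, h1]
  have h2 : (Spec.map (CommRingCat.ofHom (iterateFrobenius K p n))).appTop =
      (Scheme.ΓSpecIso (CommRingCat.of K)).hom ≫ CommRingCat.ofHom (iterateFrobenius K p n) ≫
        (Scheme.ΓSpecIso (CommRingCat.of K)).inv := by
    rw [← Scheme.ΓSpecIso_naturality_assoc, Iso.hom_inv_id, Category.comp_id]
  rw [h2, ← cancel_epi (Scheme.ΓSpecIso (CommRingCat.of K)).inv]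
  simp only [Category.assoc, Iso.inv_hom_id_assoc]
  ext x
  simp only [CommRingCat.hom_comp, RingHom.comp_apply, powHom_apply, CommRingCat.hom_ofHom,
    iterateFrobenius_def, map_pow]

/-- The Frobenius twist `X^(p^n)`: the base change of the `K`-scheme `X` along the `n`-th iterate
of the Frobenius of `K`. -/
abbrev twist (n : ℕ) : Scheme.{u} :=
  pullback f (Spec.map (CommRingCat.ofHom (iterateFrobenius K p n)))

/-- The structure morphism of the Frobenius twist. -/
abbrev twistHom (n : ℕ) : twist p f n ⟶ Spec (CommRingCat.of K) :=
  pullback.snd f (Spec.map (CommRingCat.ofHom (iterateFrobenius K p n)))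

/-- The `n`-th iterate of the relative Frobenius morphism, `X ⟶ X^(p^n)`. -/
def relFrobenius (n : ℕ) : X ⟶ twist p f n :=
  pullback.lift (absFrobenius p f n) f (absFrobenius_comp p f n)

end Frobenius

/-! ### Normalization -/

section Normalization

variable (X : Scheme.{u}) [IsIntegral X] [QuasiSeparatedSpace X]

/-- The inclusion of the generic point, `Spec K(X) ⟶ X`. -/
abbrev genericInclusion : Spec X.functionField ⟶ X := X.fromSpecStalk (genericPoint X)

/-- The normalization of an integral scheme (in its function field). -/
abbrev normalization : Scheme.{u} := (genericInclusion X).normalization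

/-- The normalization morphism. -/
abbrev normalizationHom : normalization X ⟶ X := (genericInclusion X).fromNormalization

end Normalization

/-! ### The Frobenius tower of a curve -/

section Tower

variable {K : Type u} [Field K] (p : ℕ) [Fact p.Prime] [CharP K p]
variable {C : Scheme.{u}} (f : C ⟶ Spec (CommRingCat.of K)) [GeometricallyIntegral f]

instance (n : ℕ) : IsIntegral (twist p f n) :=
  GeometricallyIntegral.geometrically_isIntegral _ _ _ (.of_hasPullback _ _)

variable [QuasiSeparated f]

instance (n : ℕ) : QuasiSeparatedSpace (twist p f n) :=
  quasiSeparatedSpace_of_quasiSeparated (twistHom p f n)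

/-- The curve `C_n`, the normalization of `C^(p^n)`. -/
abbrev towerCurve (n : ℕ) : Scheme.{u} := normalization (twist p f n)

/-- The morphism `C_n ⟶ C^(p^n)`. -/
abbrev towerToTwist (n : ℕ) : towerCurve p f n ⟶ twist p f n := normalizationHom (twist p f n)

/-- The structure morphism of `C_n`. -/
abbrev towerHom (n : ℕ) : towerCurve p f n ⟶ Spec (CommRingCat.of K) :=
  towerToTwist p f n ≫ twistHom p f n

end Tower

end FrobeniusTower

end


/-!
Write `A` for the local ring of `C` at `P`, `L` for the algebraic closure of `K`, and `M` for the
field of fractions of `L ⊗ A`. The local ring of `C_i` at `P_i` is isomorphic to the ring `A_i ⊆ A`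
of those elements that are fractions with numerator and denominator in the `K`-algebra generated by
the `p ^ i`-th powers. Since `L` is perfect, extracting `p ^ i`-th roots identifies `L ⊗ A_i` with a
subring `W_i` of `M`, and `W_0 ⊆ W_1 ⊆ ⋯ ⊆ W_n`. As `P_n` is rational, `W_n` is a discrete valuation
ring `B`, which is then the common normalization of the `W_i`.

Let `t` be a uniformizer of `B`. The powers `1, t, …, t ^ (p - 1)` form a basis of `B` over its
`p`-th powers, so that `d / dt` makes sense on `B`. For `i < n` there is `z ∈ W_i` such that `W_i`
consists of the sums `∑ j < p, w_j ^ p * z ^ j` with `w_j ∈ W_{i+1}`. Up to a unit, `dz / dt` is a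
power `t ^ k_i`; as the image of `Ω_{W_i}` in `Ω_B` is generated by `dz`, the cokernel of `α` at
level `i` has dimension `k_i`. With `𝒞` the Cartier operator of `B`, an element `x` of `B` lies in
`W_i` if and only if `𝒞 (z ^ j * x dz) ∈ W_{i+1} dz` for all `j < p`. Hence `t ^ m * B ⊆ W_i` if and
only if `𝒞 (t ^ (m + k_i) * B dt) ⊆ t ^ k_i * W_{i+1} dt`, so that the conductors `c_i` of `W_i` in
`B` satisfy `c_i = (p - 1) * k_i + p * c_{i+1}`, and `c_n = 0`. The isomorphism of `W_i` with
`L ⊗ A_i` raises the scalars of `L` to the power `p ^ i`, which changes no dimension because `L` is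
perfect.
-/

noncomputable section

namespace FrobeniusTower

section

open Polynomial

section Expansion

section Prime

variable {D : Type*} [CommRing D] [IsDomain D] {t : D} {p : ℕ}

lemma pow_succ_dvd_pow_of_not_dvd (ht : Prime t) (c : D) {n : ℕ} (hn : ¬ p ∣ n)
    (h : t ^ n ∣ c ^ p) : t ^ (n + 1) ∣ c ^ p := by
  rw [pow_dvd_iff_le_emultiplicity, emultiplicity_pow ht] at h ⊢
  rcases h.eq_or_lt with heq | hlt
  · have hfin : (p : ℕ∞) * emultiplicity t c ≠ ⊤ := heq ▸ ENat.natCast_ne_top n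
    rcases eq_or_ne (emultiplicity t c) ⊤ with htop | htop
    · rw [htop] at heq hfin
      rcases eq_or_ne p 0 with rfl | hp
      · simp_all
      · exact absurd (ENat.mul_top (by exact_mod_cast hp)) hfin
    · lift emultiplicity t c to ℕ using htop with m
      exact absurd ⟨m, by exact_mod_cast heq⟩ hn
  · exact_mod_cast Order.add_one_le_of_lt hlt

/-- The terms have distinct orders modulo `p`, so no cancellation can occur. -/
lemma pow_dvd_mul_pow_of_pow_dvd_sum (ht : Prime t) {a : ℕ → D}
    (ha : ∀ j < p, ∀ n, ¬ p ∣ n → t ^ n ∣ a j → t ^ (n + 1) ∣ a j) {m : ℕ}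
    (h : t ^ m ∣ ∑ j ∈ Finset.range p, a j * t ^ j) : ∀ j < p, t ^ m ∣ a j * t ^ j := by
  induction m with
  | zero => simp
  | succ m ih =>
    have hm := ih ((pow_dvd_pow t m.le_succ).trans h)
    have hincongruent : ∀ j < p, j ≠ m % p → t ^ (m + 1) ∣ a j * t ^ j := by
      intro j hj hjm
      rcases lt_or_ge m j with hlt | hge
      · exact Dvd.dvd.mul_left (pow_dvd_pow t hlt) _
      obtain ⟨n, rfl⟩ := Nat.exists_eq_add_of_le' hge
      have hn : ¬ p ∣ n := by
        rintro ⟨k, rfl⟩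
        exact hjm (by rw [Nat.mul_add_mod, Nat.mod_eq_of_lt hj])
      have hdvd := hm j hj
      rw [pow_add, mul_dvd_mul_iff_right (pow_ne_zero j ht.ne_zero)] at hdvd
      rw [add_right_comm, pow_add]
      exact mul_dvd_mul_right (ha j hj n hn hdvd) _
    intro j hj
    by_cases hjm : j = m % p
    · rw [← Finset.add_sum_erase _ _ (Finset.mem_range.2 hj)] at h
      refine (dvd_add_left (Finset.dvd_sum fun i hi => ?_)).1 h
      rw [Finset.mem_erase, Finset.mem_range] at hi
      exact hincongruent i hi.2 (hjm ▸ hi.1)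
    · exact hincongruent j hj hjm

lemma pow_mul_dvd_of_pow_mul_dvd_sum (ht : Prime t) {a : ℕ → D}
    (ha : ∀ j < p, ∀ n, ¬ p ∣ n → t ^ n ∣ a j → t ^ (n + 1) ∣ a j) {k : ℕ}
    (h : t ^ (p * k) ∣ ∑ j ∈ Finset.range p, a j * t ^ j) : ∀ j < p, t ^ (p * k) ∣ a j := by
  intro j hj
  have hlow : t ^ (p * k - j) ∣ a j := by
    rcases le_total (p * k) j with hle | hle
    · simp [Nat.sub_eq_zero_of_le hle]
    · have hdvd := pow_dvd_mul_pow_of_pow_dvd_sum ht ha h j hj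
      rwa [← Nat.sub_add_cancel hle, pow_add,
        mul_dvd_mul_iff_right (pow_ne_zero j ht.ne_zero)] at hdvd
  suffices ∀ n, p * k - j ≤ n → n ≤ p * k → t ^ n ∣ a j from this _ (Nat.sub_le _ _) le_rfl
  intro n hn
  induction n, hn using Nat.le_induction with
  | base => exact fun _ => hlow
  | succ n hn ih =>
    intro hle
    refine ha j hj n ?_ (ih (by omega))
    rintro ⟨l, rfl⟩
    have hlk : l < k := Nat.lt_of_mul_lt_mul_left (a := p) (by omega)
    have := Nat.mul_le_mul_left p (Nat.succ_le_of_lt hlk)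
    rw [Nat.mul_succ] at this
    omega

lemma eq_zero_of_sum_pow_mul_pow_eq_zero [IsDiscreteValuationRing D] (hp : 0 < p)
    (ht : Irreducible t) {c : ℕ → D}
    (h : ∑ j ∈ Finset.range p, c j ^ p * t ^ j = 0) {j : ℕ} (hj : j < p) :
    c j = 0 := by
  by_contra h0
  obtain ⟨n, u, hu⟩ := IsDiscreteValuationRing.eq_unit_mul_pow_irreducible h0 ht
  have hdvd := pow_mul_dvd_of_pow_mul_dvd_sum ht.prime (a := fun j => c j ^ p) (k := n + 1)
    (fun j _ _ hn => pow_succ_dvd_pow_of_not_dvd ht.prime (c j) hn) (h ▸ dvd_zero _) j hj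
  rw [hu, mul_pow, ← Units.val_pow_eq_pow_val, Units.dvd_mul_left, ← pow_mul,
    pow_dvd_pow_iff ht.ne_zero ht.not_isUnit, mul_comm n, Nat.mul_le_mul_left_iff hp] at hdvd
  exact hdvd.not_gt n.lt_succ_self

end Prime

section FrobEval

lemma natDegree_modByMonic_X_pow_sub_C_lt {B : Type*} [CommRing B] [Nontrivial B] {p : ℕ}
    (hp : p ≠ 0) (t : B) (R : B[X]) : (R %ₘ (X ^ p - C t)).natDegree < p := by
  have hne : X ^ p - C t ≠ 1 := fun h => by simpa [hp] using congrArg natDegree h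
  simpa using natDegree_modByMonic_lt R (monic_X_pow_sub_C t hp) hne

variable {B : Type*} [CommRing B] (p : ℕ) [Fact p.Prime] [CharP B p] (t : B)

/-- The evaluation `∑ c j X ^ j ↦ ∑ c j ^ p t ^ j` of polynomials, with coefficients twisted by the
Frobenius. -/
abbrev frobEval : B[X] →+* B := eval₂RingHom (frobenius B p) t

variable {p t}

lemma frobEval_C (b : B) : frobEval p t (C b) = b ^ p := by simp [frobEval, frobenius_def]

lemma frobEval_X : frobEval p t X = t := by simp [frobEval]

lemma frobEval_X_pow_sub_C : frobEval p t (X ^ p - C t) = 0 := by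
  rw [map_sub, map_pow, frobEval_C, frobEval_X, sub_self]

lemma frobEval_derivative_X_pow_sub_C_mul (S : B[X]) :
    frobEval p t (derivative ((X ^ p - C t) * S)) = 0 := by
  rw [derivative_mul, map_add, map_mul, map_mul, frobEval_X_pow_sub_C, zero_mul, add_zero,
    derivative_sub, derivative_C, sub_zero, derivative_X_pow, CharP.cast_eq_zero, C_0, zero_mul,
    map_zero, zero_mul]

lemma frobEval_eq_sum {R : B[X]} {n : ℕ} (hR : R.natDegree < n) :
    frobEval p t R = ∑ j ∈ Finset.range n, R.coeff j ^ p * t ^ j :=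
  eval₂_eq_sum_range' _ hR t

lemma frobEval_modByMonic (R : B[X]) : frobEval p t (R %ₘ (X ^ p - C t)) = frobEval p t R := by
  conv_rhs => rw [← modByMonic_add_div R (X ^ p - C t)]
  rw [map_add, map_mul, frobEval_X_pow_sub_C, zero_mul, add_zero]

lemma exists_eq_sum_of_frobEval_surjective [Nontrivial B]
    (hs : Function.Surjective (frobEval p t)) (b : B) :
    ∃ c : ℕ → B, b = ∑ j ∈ Finset.range p, c j ^ p * t ^ j := by
  obtain ⟨R, rfl⟩ := hs b
  exact ⟨(R %ₘ (X ^ p - C t)).coeff, by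
    rw [← frobEval_eq_sum
      (natDegree_modByMonic_X_pow_sub_C_lt (Fact.out : p.Prime).ne_zero t R), frobEval_modByMonic]⟩

variable [IsDomain B] [IsDiscreteValuationRing B]

lemma X_pow_sub_C_dvd_of_frobEval_eq_zero (ht : Irreducible t) {R : B[X]}
    (h : frobEval p t R = 0) : X ^ p - C t ∣ R := by
  have hp := (Fact.out : p.Prime).ne_zero
  rw [← modByMonic_eq_zero_iff_dvd (monic_X_pow_sub_C t hp)]
  have hdeg := natDegree_modByMonic_X_pow_sub_C_lt hp t R
  rw [← frobEval_modByMonic, frobEval_eq_sum hdeg] at h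
  ext j
  rcases lt_or_ge j p with hj | hj
  · simpa using eq_zero_of_sum_pow_mul_pow_eq_zero (Fact.out : p.Prime).pos ht h hj
  · simpa using coeff_eq_zero_of_natDegree_lt (hdeg.trans_le hj)

end FrobEval

end Expansion

section Cartier

lemma coeff_pow_sub_one_mul_derivative {R : Type*} [CommRing R] (f : R[X]) {n : ℕ} (hn : 0 < n)
    (m : ℕ) : (f ^ (n - 1) * derivative f).coeff (m * n + (n - 1)) =
      (m + 1 : ℕ) * (f ^ n).coeff ((m + 1) * n) := by
  -- Both sides are universal polynomials with integer coefficients, so we may divide by `n`.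
  let φ : MvPolynomial R ℤ →+* R := MvPolynomial.eval₂Hom (Int.castRingHom R) id
  obtain ⟨g, rfl⟩ := map_surjective φ (fun b => ⟨MvPolynomial.X b, by simp [φ]⟩) f
  have hindex : m * n + (n - 1) + 1 = (m + 1) * n := by
    rw [add_mul, add_assoc, Nat.sub_add_cancel hn, one_mul]
  have hcoeff : (derivative (g ^ n)).coeff (m * n + (n - 1)) =
      n * ((g ^ (n - 1) * derivative g).coeff (m * n + (n - 1))) := by
    rw [derivative_pow, mul_assoc, coeff_C_mul]
  have hlift : (g ^ (n - 1) * derivative g).coeff (m * n + (n - 1)) =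
      (m + 1 : ℕ) * (g ^ n).coeff ((m + 1) * n) := by
    apply mul_left_cancel₀ (Nat.cast_ne_zero.2 hn.ne' : (n : MvPolynomial R ℤ) ≠ 0)
    rw [← hcoeff, coeff_derivative, hindex, ← Nat.cast_succ, Nat.succ_eq_add_one, hindex,
      Nat.cast_mul]
    ring
  simpa only [← coeff_map, Polynomial.map_mul, Polynomial.map_pow, derivative_map, map_mul,
    map_natCast] using congrArg φ hlift

/-- The Cartier operator `∑ a k X ^ k ↦ ∑ a (m p + p - 1) X ^ m` on polynomials, without the
extraction of `p`-th roots of the coefficients. -/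
def cartierPoly {B : Type*} [CommRing B] (p : ℕ) [NeZero p] : B[X] →ₗ[B] B[X] where
  toFun R := divX (contract p (X * R))
  map_add' R S := by rw [mul_add, contract_add (NeZero.ne p), divX_add]
  map_smul' a R := by
    ext m
    simp [coeff_contract (NeZero.ne p)]

variable {B : Type*} [CommRing B] {p : ℕ}

lemma coeff_cartierPoly [NeZero p] (R : B[X]) (m : ℕ) :
    (cartierPoly p R).coeff m = R.coeff (m * p + (p - 1)) := by
  have hindex : (m + 1) * p = m * p + (p - 1) + 1 := by
    rw [add_mul, one_mul, add_assoc, Nat.sub_add_cancel NeZero.one_le]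
  rw [cartierPoly, LinearMap.coe_mk, AddHom.coe_mk, coeff_divX, coeff_contract (NeZero.ne p),
    hindex, coeff_X_mul]

lemma cartierPoly_X_pow_mul [NeZero p] (R : B[X]) :
    cartierPoly p (X ^ p * R) = X * cartierPoly p R := by
  ext m
  rw [coeff_cartierPoly]
  cases m with
  | zero =>
    rw [coeff_X_mul_zero, zero_mul, zero_add, coeff_X_pow_mul', if_neg]
    exact (Nat.sub_lt (Nat.pos_of_neZero p) one_pos).not_ge
  | succ m => rw [coeff_X_mul, coeff_cartierPoly, add_mul, one_mul, add_right_comm, coeff_X_pow_mul]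

variable [hp : Fact p.Prime] [CharP B p]

lemma cartierPoly_derivative (R : B[X]) : cartierPoly p (derivative R) = 0 := by
  ext m
  have hcast : ((m * p + (p - 1) : ℕ) : B) + 1 = 0 := by
    rw [← Nat.cast_succ, Nat.succ_eq_add_one, add_assoc, Nat.sub_add_cancel hp.out.one_le]
    simp
  rw [coeff_cartierPoly, coeff_derivative, hcast, mul_zero, coeff_zero]

lemma cartierPoly_pow_mul_derivative (R : B[X]) :
    cartierPoly p (R ^ (p - 1) * derivative R) = (derivative R).map (frobenius B p) := by
  ext m
  rw [coeff_cartierPoly, coeff_pow_sub_one_mul_derivative R hp.out.pos, coeff_map, coeff_derivative,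
    ← map_frobenius_expand, coeff_map, coeff_expand_mul hp.out.pos, ← Nat.cast_succ, map_mul,
    map_natCast, mul_comm]

end Cartier

end

section

open Polynomial

/-- `t` is a `p`-basis of `B`: every element of `B` is uniquely of the form
`∑ j < p, c j ^ p * t ^ j`. Uniqueness is expressed through the kernel of `frobEval`. -/
structure IsPBasis {B : Type*} [CommRing B] (p : ℕ) [Fact p.Prime] [CharP B p] (t : B) :
    Prop where
  surjective : Function.Surjective (frobEval p t)
  dvd_of_frobEval_eq_zero {R : B[X]} : frobEval p t R = 0 → X ^ p - C t ∣ R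

lemma isPBasis_of_irreducible {B : Type*} [CommRing B] [IsDomain B] [IsDiscreteValuationRing B]
    {p : ℕ} [Fact p.Prime] [CharP B p] {t : B} (ht : Irreducible t)
    (hs : Function.Surjective (frobEval p t)) : IsPBasis p t :=
  ⟨hs, X_pow_sub_C_dvd_of_frobEval_eq_zero ht⟩

namespace IsPBasis

variable {B : Type*} [CommRing B] {p : ℕ} [hp : Fact p.Prime] [CharP B p] {t : B}
  (ht : IsPBasis p t)

section Lift

variable {G : Type*} [AddCommGroup G] (F : B[X] →+ G) (hF : ∀ S, F ((X ^ p - C t) * S) = 0)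

/-- An additive map on `B[X]` that kills the multiples of `X ^ p - C t` descends along
`frobEval`. -/
def lift : B →+ G :=
  AddMonoidHom.liftOfSurjective (frobEval p t).toAddMonoidHom ht.surjective ⟨F, fun R hR => by
    obtain ⟨S, rfl⟩ := ht.dvd_of_frobEval_eq_zero hR
    exact hF S⟩

lemma lift_frobEval (R : B[X]) : ht.lift F hF (frobEval p t R) = F R :=
  AddMonoidHom.liftOfRightInverse_comp_apply _ _ _ _ R

end Lift

/-- The Cartier operator, `∑ c j ^ p * t ^ j ↦ c (p - 1)`. It describes the usual operator on
differentials through `b ↦ b dt`. -/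
def cartier : B →+ B :=
  ht.lift ((evalRingHom t).toAddMonoidHom.comp (cartierPoly p).toAddMonoidHom) fun S => by
    change eval t (cartierPoly p ((X ^ p - C t) * S)) = 0
    rw [sub_mul, map_sub, cartierPoly_X_pow_mul, ← smul_eq_C_mul, map_smul, eval_sub, eval_mul,
      eval_X, eval_smul, smul_eq_mul, sub_self]

lemma cartier_frobEval (R : B[X]) : ht.cartier (frobEval p t R) = eval t (cartierPoly p R) :=
  ht.lift_frobEval _ _ R

lemma cartier_pow_mul (b x : B) : ht.cartier (b ^ p * x) = b * ht.cartier x := by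
  obtain ⟨R, rfl⟩ := ht.surjective x
  rw [← frobEval_C (t := t), ← map_mul, cartier_frobEval, cartier_frobEval, ← smul_eq_C_mul,
    map_smul, eval_smul, smul_eq_mul]

/-- The derivation `d/dt`. -/
def deriv : Derivation ℤ B B :=
  let d : B →+ B := ht.lift ((frobEval p t).toAddMonoidHom.comp derivative.toAddMonoidHom)
    frobEval_derivative_X_pow_sub_C_mul
  have hd (R : B[X]) : d (frobEval p t R) = frobEval p t (derivative R) := ht.lift_frobEval _ _ R
  Derivation.mk' d.toIntLinearMap fun x y => by
    obtain ⟨R, rfl⟩ := ht.surjective x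
    obtain ⟨S, rfl⟩ := ht.surjective y
    rw [AddMonoidHom.coe_toIntLinearMap, ← map_mul, hd, hd, hd, derivative_mul, map_add, map_mul,
      map_mul, smul_eq_mul, smul_eq_mul]
    ring

lemma deriv_frobEval (R : B[X]) : ht.deriv (frobEval p t R) = frobEval p t (derivative R) :=
  ht.lift_frobEval ((frobEval p t).toAddMonoidHom.comp derivative.toAddMonoidHom)
    frobEval_derivative_X_pow_sub_C_mul R

lemma deriv_self : ht.deriv t = 1 := by
  simpa [frobEval_X] using ht.deriv_frobEval X

lemma deriv_pow_char_mul (c x : B) : ht.deriv (c ^ p * x) = c ^ p * ht.deriv x := by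
  rw [Derivation.leibniz, Derivation.leibniz_pow, ← Nat.cast_smul_eq_nsmul B, CharP.cast_eq_zero,
    zero_smul, smul_zero, add_zero, smul_eq_mul]

lemma cartier_deriv (x : B) : ht.cartier (ht.deriv x) = 0 := by
  obtain ⟨R, rfl⟩ := ht.surjective x
  rw [deriv_frobEval, cartier_frobEval, cartierPoly_derivative, eval_zero]

/-- The Cartier operator fixes the logarithmic differential `dz / z`. -/
lemma cartier_pow_sub_one_mul_deriv (z : B) :
    ht.cartier (z ^ (p - 1) * ht.deriv z) = ht.deriv z := by
  obtain ⟨R, rfl⟩ := ht.surjective z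
  rw [deriv_frobEval, ← map_pow, ← map_mul, cartier_frobEval, cartierPoly_pow_mul_derivative,
    Polynomial.eval_map, coe_eval₂RingHom]

lemma cartier_pow_mul_deriv_of_lt (z : B) {m : ℕ} (hm : m < p - 1) :
    ht.cartier (z ^ m * ht.deriv z) = 0 := by
  have hunit : IsUnit ((m + 1 : ℕ) : B) := by
    rw [CharP.isUnit_natCast_iff (R := B) hp.out]
    exact Nat.not_dvd_of_pos_of_lt m.succ_pos (by omega)
  have hexact := ht.cartier_deriv (z ^ (m + 1))
  rwa [Derivation.leibniz_pow, Nat.add_sub_cancel, smul_eq_mul, map_nsmul,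
    ← Nat.cast_smul_eq_nsmul B, smul_eq_mul, hunit.mul_right_eq_zero] at hexact

lemma cartier_pow_mul_deriv_mul_pow (z : B) {k j : ℕ} (hk : k < p) (hj : j < p) :
    ht.cartier (z ^ k * ht.deriv z * z ^ (p - 1 - j)) = if k = j then ht.deriv z else 0 := by
  rw [mul_right_comm, ← pow_add]
  split_ifs with hkj
  · rw [show k + (p - 1 - j) = p - 1 by omega, cartier_pow_sub_one_mul_deriv]
  rcases lt_or_gt_of_ne hkj with hlt | hgt
  · exact ht.cartier_pow_mul_deriv_of_lt z (by omega)
  · rw [show k + (p - 1 - j) = p + (k - j - 1) by omega, pow_add, mul_assoc, cartier_pow_mul,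
      ht.cartier_pow_mul_deriv_of_lt z (by omega), mul_zero]

/-- The powers of `z` are dual to each other under `(x, y) ↦ κ(x y dz)`, so the coefficients of an
expansion in powers of `z` can be read off by the Cartier operator `κ`. -/
lemma cartier_sum_pow_mul (z : B) (w : ℕ → B) {j : ℕ} (hj : j < p) :
    ht.cartier ((∑ k ∈ Finset.range p, w k ^ p * z ^ k) * ht.deriv z * z ^ (p - 1 - j)) =
      ht.deriv z * w j := by
  have hterm : ∀ k ∈ Finset.range p,
      ht.cartier (w k ^ p * z ^ k * ht.deriv z * z ^ (p - 1 - j)) =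
        if k = j then ht.deriv z * w j else 0 := by
    intro k hk
    rw [mul_assoc, mul_assoc, cartier_pow_mul, ← mul_assoc,
      ht.cartier_pow_mul_deriv_mul_pow z (Finset.mem_range.1 hk) hj]
    split_ifs with hkj
    · rw [hkj, mul_comm]
    · rw [mul_zero]
  rw [Finset.sum_mul, Finset.sum_mul, map_sum, Finset.sum_congr rfl hterm, Finset.sum_ite_eq',
    if_pos (Finset.mem_range.2 hj)]

lemma deriv_dvd_deriv_sum_pow_mul (z : B) (w : ℕ → B) :
    ht.deriv z ∣ ht.deriv (∑ k ∈ Finset.range p, w k ^ p * z ^ k) := by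
  rw [map_sum]
  refine Finset.dvd_sum fun k _ => ?_
  rw [deriv_pow_char_mul, Derivation.leibniz_pow, smul_eq_mul, nsmul_eq_mul]
  exact Dvd.intro_left (w k ^ p * (k * z ^ (k - 1))) (by ring)

lemma cartier_uniformizer_pow : ht.cartier (t ^ (p - 1)) = 1 := by
  simpa only [deriv_self, mul_one] using ht.cartier_pow_sub_one_mul_deriv t

lemma exists_cartier_pow_mul_eq_iff (m : ℕ) (x : B) :
    (∃ y, ht.cartier (t ^ m * y) = x) ↔ t ^ (m / p) ∣ x := by
  have hsplit : t ^ m = (t ^ (m / p)) ^ p * t ^ (m % p) := by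
    rw [← pow_mul, ← pow_add, Nat.div_add_mod']
  constructor
  · rintro ⟨y, rfl⟩
    rw [hsplit, mul_assoc, cartier_pow_mul]
    exact dvd_mul_right _ _
  · rintro ⟨c, rfl⟩
    refine ⟨c ^ p * t ^ (p - 1 - m % p), ?_⟩
    have hmod := Nat.mod_lt m hp.out.pos
    have hpow : t ^ m * (c ^ p * t ^ (p - 1 - m % p)) = (t ^ (m / p) * c) ^ p * t ^ (p - 1) := by
      rw [hsplit, ← Nat.add_sub_of_le (Nat.le_sub_one_of_lt hmod), Nat.add_sub_cancel_left,
        pow_add, mul_pow]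
      ring
    rw [hpow, cartier_pow_mul, cartier_uniformizer_pow, mul_one]

end IsPBasis

end

/-- The elements `∑ j < p, w j ^ p * z ^ j` with coefficients `w j` in `W`. -/
def pSpan {B : Type*} [CommRing B] (p : ℕ) (z : B) (W : Set B) : Set B :=
  {x | ∃ w : ℕ → B, (∀ j, w j ∈ W) ∧ x = ∑ j ∈ Finset.range p, w j ^ p * z ^ j}

namespace IsPBasis

variable {B : Type*} [CommRing B] {p : ℕ} [hp : Fact p.Prime] [CharP B p] {t : B}
  (ht : IsPBasis p t) {z : B} {W : Set B}

lemma deriv_dvd_deriv_of_mem_pSpan {x : B} (hx : x ∈ pSpan p z W) : ht.deriv z ∣ ht.deriv x := by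
  obtain ⟨w, -, rfl⟩ := hx
  exact ht.deriv_dvd_deriv_sum_pow_mul z w

include ht in
lemma ne_zero [Nontrivial B] : t ≠ 0 := by
  rintro rfl
  simpa using ht.deriv_self

variable [IsDomain B] {N : ℕ} (hN : ∀ y, t ^ N * y ∈ pSpan p z W)
include hN

lemma deriv_ne_zero : ht.deriv z ≠ 0 := by
  intro hz
  obtain ⟨n, hNn, hn⟩ : ∃ n, N ≤ n ∧ ¬ p ∣ n := by
    refine ⟨p * N + 1, (Nat.le_mul_of_pos_left N hp.out.pos).trans (Nat.le_succ _), fun hdvd => ?_⟩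
    exact hp.out.one_lt.ne' (Nat.dvd_one.1 ((Nat.dvd_add_right (Nat.dvd_mul_right p N)).1 hdvd))
  have hdvd := ht.deriv_dvd_deriv_of_mem_pSpan (hN (t ^ (n - N)))
  rw [← pow_add, Nat.add_sub_cancel' hNn, hz, zero_dvd_iff, Derivation.leibniz_pow, deriv_self,
    smul_eq_mul, mul_one, nsmul_eq_mul, mul_eq_zero, CharP.cast_eq_zero_iff B p] at hdvd
  exact hdvd.elim hn (pow_ne_zero _ ht.ne_zero)

lemma deriv_pow_char_mul_eq (x : B) : ht.deriv z ^ p * x =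
    ∑ j ∈ Finset.range p, ht.cartier (x * ht.deriv z * z ^ (p - 1 - j)) ^ p * z ^ j := by
  obtain ⟨w, -, hw⟩ : (t ^ N) ^ p * x ∈ pSpan p z W := by
    rw [← mul_pow_sub_one hp.out.ne_zero, mul_assoc]
    exact hN _
  apply mul_left_cancel₀ (pow_ne_zero p (pow_ne_zero N ht.ne_zero))
  rw [mul_left_comm, hw, Finset.mul_sum, Finset.mul_sum]
  refine Finset.sum_congr rfl fun j hj => ?_
  have hcoeff := ht.cartier_sum_pow_mul z w (Finset.mem_range.1 hj)
  rw [← hw, mul_assoc, mul_assoc, cartier_pow_mul, ← mul_assoc] at hcoeff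
  rw [← mul_assoc, ← mul_assoc, ← mul_pow, ← mul_pow, hcoeff]

lemma mem_pSpan_iff_cartier (x : B) :
    x ∈ pSpan p z W ↔
      ∀ j < p, ∃ w ∈ W, ht.cartier (x * ht.deriv z * z ^ j) = ht.deriv z * w := by
  have hpos := hp.out.pos
  constructor
  · rintro ⟨w, hw, rfl⟩ j hj
    refine ⟨w (p - 1 - j), hw _, ?_⟩
    rw [← ht.cartier_sum_pow_mul z w (by omega), show p - 1 - (p - 1 - j) = j by omega]
  · intro h
    choose w hw hcartier using fun j => h (p - 1 - j) (by omega)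
    refine ⟨w, hw, mul_left_cancel₀ (pow_ne_zero p (ht.deriv_ne_zero hN)) ?_⟩
    rw [ht.deriv_pow_char_mul_eq hN, Finset.mul_sum]
    refine Finset.sum_congr rfl fun j _ => ?_
    rw [hcartier, mul_pow, mul_assoc]

variable {e : ℕ} {v : Bˣ} (he : ht.deriv z = v * t ^ e)
include he

lemma pow_mul_mem_pSpan_iff_cartier (n : ℕ) :
    (∀ y, t ^ n * y ∈ pSpan p z W) ↔
      ∀ y, ∃ w ∈ W, ht.cartier (t ^ (n + e) * y) = ht.deriv z * w := by
  simp only [ht.mem_pSpan_iff_cartier hN]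
  constructor
  · intro h y
    obtain ⟨w, hw, hcartier⟩ := h (↑v⁻¹ * y) 0 hp.out.pos
    refine ⟨w, hw, ?_⟩
    have hy : t ^ n * (↑v⁻¹ * y) * (v * t ^ e) = (↑v⁻¹ * v) * (t ^ (n + e) * y) := by ring
    rw [← hcartier, pow_zero, mul_one, he, hy, Units.inv_mul, one_mul]
  · intro h y j _
    obtain ⟨w, hw, hcartier⟩ := h (v * y * z ^ j)
    refine ⟨w, hw, ?_⟩
    have hy : t ^ n * y * ht.deriv z * z ^ j = t ^ (n + e) * (v * y * z ^ j) := by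
      rw [he]
      ring
    rw [hy, hcartier]

variable (htu : ¬ IsUnit t)
include htu

/-- The Cartier operator maps `t ^ (n + e) B` onto `t ^ ((n + e) / p) B`. -/
lemma pow_mul_mem_pSpan_iff_pow_mul_mem (n : ℕ) :
    (∀ y, t ^ n * y ∈ pSpan p z W) ↔
      e ≤ (n + e) / p ∧ ∀ y, t ^ ((n + e) / p - e) * y ∈ W := by
  have himage : (∀ y, t ^ n * y ∈ pSpan p z W) ↔
      ∀ b, ∃ w ∈ W, t ^ ((n + e) / p) * b = v * t ^ e * w := by
    rw [ht.pow_mul_mem_pSpan_iff_cartier hN he, he]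
    constructor
    · intro h b
      obtain ⟨y, hy⟩ := (ht.exists_cartier_pow_mul_eq_iff (n + e) _).2 (dvd_mul_right _ b)
      exact hy ▸ h y
    · intro h y
      obtain ⟨b, hb⟩ := (ht.exists_cartier_pow_mul_eq_iff (n + e) _).1 ⟨y, rfl⟩
      exact hb ▸ h b
  have hsplit (he_le : e ≤ (n + e) / p) (b : B) :
      t ^ ((n + e) / p) * (v * b) = v * t ^ e * (t ^ ((n + e) / p - e) * b) := by
    conv_lhs => rw [← Nat.sub_add_cancel he_le, pow_add]
    ring
  rw [himage]
  constructor
  · intro h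
    have he_le : e ≤ (n + e) / p := by
      obtain ⟨w, -, hw⟩ := h 1
      rw [← pow_dvd_pow_iff ht.ne_zero htu, ← mul_one (t ^ (_ / _)), hw]
      exact Dvd.intro_left (↑v * w) (by ring)
    refine ⟨he_le, fun y => ?_⟩
    obtain ⟨w, hw, hyw⟩ := h (v * y)
    rw [hsplit he_le] at hyw
    rwa [mul_left_cancel₀ (mul_ne_zero v.ne_zero (pow_ne_zero e ht.ne_zero)) hyw]
  · rintro ⟨he_le, h⟩ b
    refine ⟨_, h (↑v⁻¹ * b), ?_⟩
    rw [← hsplit he_le, Units.mul_inv_cancel_left]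

lemma pow_mul_mem_pSpan_iff_le {c : ℕ} (hc : ∀ m, (∀ y, t ^ m * y ∈ W) ↔ c ≤ m) (n : ℕ) :
    (∀ y, t ^ n * y ∈ pSpan p z W) ↔ (p - 1) * e + p * c ≤ n := by
  have hsub : (e ≤ (n + e) / p ∧ c ≤ (n + e) / p - e) ↔ c + e ≤ (n + e) / p := by omega
  have hmul : (c + e) * p = (p - 1) * e + p * c + e := by
    conv_lhs => rw [← Nat.sub_add_cancel hp.out.one_le]
    conv_rhs => rw [← Nat.sub_add_cancel hp.out.one_le, Nat.add_sub_cancel]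
    ring
  rw [ht.pow_mul_mem_pSpan_iff_pow_mul_mem hN he htu, hc, hsub,
    Nat.le_div_iff_mul_le hp.out.pos, hmul, Nat.add_le_add_iff_right]

end IsPBasis

section Differentials

open KaehlerDifferential Polynomial

namespace IsPBasis

variable {B : Type*} [CommRing B] {p : ℕ} [Fact p.Prime] [CharP B p] {t : B} (ht : IsPBasis p t)
  (A : Type*) [CommRing A] [Algebra A B]

lemma derivation_eq_deriv_smul {M : Type*} [AddCommGroup M] [Module A M] [Module B M]
    (d : Derivation A B M) (b : B) : d b = ht.deriv b • d t := by
  have hd_pow (x : B) : d (x ^ p) = 0 := by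
    rw [Derivation.leibniz_pow, ← Nat.cast_smul_eq_nsmul B, CharP.cast_eq_zero, zero_smul]
  obtain ⟨R, rfl⟩ := ht.surjective b
  induction R using Polynomial.induction_on' with
  | add f g hf hg => simp only [map_add, hf, hg, add_smul]
  | monomial k a =>
    rw [← C_mul_X_pow_eq_monomial, map_mul, map_pow, frobEval_C, frobEval_X, deriv_pow_char_mul,
      Derivation.leibniz_pow, deriv_self, Derivation.leibniz, hd_pow, smul_zero, add_zero,
      Derivation.leibniz_pow, smul_eq_mul, mul_one, mul_smul, nsmul_eq_mul, mul_smul,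
      Nat.cast_smul_eq_nsmul]

/-- The ideal generated by the derivatives `da/dt` of the elements of `A`. -/
def derivIdeal : Ideal B := Ideal.span (Set.range fun a => ht.deriv (algebraMap A B a))

/-- The derivation `d/dt` becomes `A`-linear modulo `derivIdeal`. -/
def derivationQuot : Derivation A B (B ⧸ ht.derivIdeal A) :=
  Derivation.mk'
    { toFun b := Ideal.Quotient.mk _ (ht.deriv b)
      map_add' x y := by rw [map_add, map_add]
      map_smul' a x := by
        have hmem : x * ht.deriv (algebraMap A B a) ∈ ht.derivIdeal A :=
          Ideal.mul_mem_left _ _ (Ideal.subset_span ⟨a, rfl⟩)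
        rw [Algebra.smul_def, Derivation.leibniz, map_add, smul_eq_mul x,
          Ideal.Quotient.eq_zero_iff_mem.2 hmem, add_zero, smul_eq_mul, map_mul, Algebra.smul_def]
        rfl }
    fun x y => by
      change Ideal.Quotient.mk _ (ht.deriv (x * y)) = _
      rw [Derivation.leibniz, map_add]
      rfl

/-- The map `b ↦ b dt`. -/
def kaehlerInv : (B ⧸ ht.derivIdeal A) →ₗ[B] Ω[B⁄A] :=
  Submodule.liftQ _ (LinearMap.toSpanSingleton B Ω[B⁄A] (D A B t)) <| by
    rw [derivIdeal, Ideal.span, Submodule.span_le]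
    rintro _ ⟨a, rfl⟩
    rw [SetLike.mem_coe, LinearMap.mem_ker, LinearMap.toSpanSingleton_apply,
      ← ht.derivation_eq_deriv_smul, Derivation.map_algebraMap]

lemma kaehlerInv_mk (b : B) : ht.kaehlerInv A (Ideal.Quotient.mk _ b) = b • D A B t := rfl

/-- The isomorphism `Ω[B⁄A] ≃ B ⧸ derivIdeal` induced by `d/dt`. -/
def kaehlerEquiv : Ω[B⁄A] ≃ₗ[B] B ⧸ ht.derivIdeal A :=
  LinearEquiv.ofLinearMap (ht.derivationQuot A).liftKaehlerDifferential (ht.kaehlerInv A)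
    (by
      apply Submodule.linearMap_qext
      ext
      change (ht.derivationQuot A).liftKaehlerDifferential
        (ht.kaehlerInv A (Ideal.Quotient.mk _ 1)) = Ideal.Quotient.mk _ 1
      rw [kaehlerInv_mk, one_smul, Derivation.liftKaehlerDifferential_comp_D]
      exact congrArg (Ideal.Quotient.mk _) ht.deriv_self)
    (by
      apply Derivation.liftKaehlerDifferential_unique
      ext b
      change ht.kaehlerInv A ((ht.derivationQuot A).liftKaehlerDifferential (D A B b)) = D A B b
      rw [Derivation.liftKaehlerDifferential_comp_D]
      exact (ht.derivation_eq_deriv_smul A (D A B) b).symm)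

end IsPBasis

end Differentials

section Length

open Polynomial

variable {L B : Type*} [Field L] [CommRing B] [Algebra L B] {t : B}

lemma exists_pow_dvd_sub_aeval (hL : ∀ b : B, ∃ l : L, t ∣ b - algebraMap L B l) (e : ℕ) (b : B) :
    ∃ f : L[X], t ^ e ∣ b - aeval t f := by
  induction e generalizing b with
  | zero => exact ⟨0, by simp⟩
  | succ e ih =>
    obtain ⟨l, d, hd⟩ := hL b
    obtain ⟨f, c, hc⟩ := ih d
    refine ⟨C l + X * f, c, ?_⟩
    rw [map_add, map_mul, aeval_C, aeval_X, ← sub_sub, hd, ← mul_sub, hc, pow_succ']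
    ring

variable [IsDomain B] (ht₀ : t ≠ 0) (htu : ¬ IsUnit t)
include ht₀ htu

lemma pow_dvd_aeval_iff {e : ℕ} {f : L[X]} : t ^ e ∣ aeval t f ↔ X ^ e ∣ f := by
  refine ⟨fun h => ?_, fun h => by simpa using map_dvd (aeval t) h⟩
  induction e generalizing f with
  | zero => simp
  | succ e ih =>
    rw [← X_mul_divX_add f, map_add, map_mul, aeval_X, aeval_C] at h
    have hcoeff : f.coeff 0 = 0 := by
      by_contra hne
      refine htu (isUnit_of_dvd_unit ?_ ((IsUnit.mk0 _ hne).map (algebraMap L B)))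
      exact (dvd_add_right (dvd_mul_right t _)).1 ((dvd_pow_self t e.succ_ne_zero).trans h)
    rw [hcoeff, map_zero, add_zero, pow_succ', mul_dvd_mul_iff_left ht₀] at h
    rw [← X_mul_divX_add f, hcoeff, C_0, add_zero, pow_succ']
    exact mul_dvd_mul_left X (ih h)

variable (hL : ∀ b : B, ∃ l : L, t ∣ b - algebraMap L B l)
include hL

lemma nonempty_quotient_X_pow_equiv (e : ℕ) :
    Nonempty ((L[X] ⧸ Ideal.span {(X : L[X]) ^ e}) ≃ₗ[L] B ⧸ Ideal.span {t ^ e}) := by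
  let φ : L[X] →ₐ[L] B ⧸ Ideal.span {t ^ e} := (Ideal.Quotient.mkₐ L _).comp (aeval t)
  have hφ (f : L[X]) : φ f = Ideal.Quotient.mk _ (aeval t f) := rfl
  have hsurj : Function.Surjective φ := by
    intro x
    obtain ⟨b, rfl⟩ := Ideal.Quotient.mk_surjective x
    obtain ⟨f, hf⟩ := exists_pow_dvd_sub_aeval hL e b
    exact ⟨f, (Ideal.Quotient.eq.2 (Ideal.mem_span_singleton.2 hf)).symm⟩
  have hker : Ideal.span {X ^ e} = RingHom.ker φ := by
    ext f
    rw [RingHom.mem_ker, hφ, Ideal.Quotient.eq_zero_iff_mem, Ideal.mem_span_singleton,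
      Ideal.mem_span_singleton, pow_dvd_aeval_iff ht₀ htu]
  exact ⟨((Ideal.quotientEquivAlgOfEq L hker).trans
    (Ideal.quotientKerAlgEquivOfSurjective hsurj)).toLinearEquiv⟩

lemma finite_quotient_span_pow (e : ℕ) : Module.Finite L (B ⧸ Ideal.span {t ^ e}) := by
  obtain ⟨φ⟩ := nonempty_quotient_X_pow_equiv ht₀ htu hL e
  have := (monic_X_pow (R := L) e).finite_quotient
  exact Module.Finite.equiv φ

lemma finrank_quotient_span_pow (e : ℕ) : Module.finrank L (B ⧸ Ideal.span {t ^ e}) = e := by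
  obtain ⟨φ⟩ := nonempty_quotient_X_pow_equiv ht₀ htu hL e
  rw [← φ.finrank_eq, finrank_quotient_span_eq_natDegree, natDegree_X_pow]

end Length

section Monogenic

lemma rank_le_iff_exists_sum_eq_zero {D : Type*} [CommRing D] [Nontrivial D] {S : Subring D}
    {n : ℕ} :
    Module.rank S D ≤ n ↔ ∀ x : ℕ → D, ∃ a : ℕ → D, (∀ j, a j ∈ S) ∧ (∃ j < n + 1, a j ≠ 0) ∧
      ∑ j ∈ Finset.range (n + 1), a j * x j = 0 := by
  refine ⟨fun h x => ?_, fun h => rank_le fun s hs => ?_⟩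
  · have hdep : ¬ LinearIndependent S fun j : Fin (n + 1) => x j := fun hx => by
      have hle := hx.cardinal_lift_le_rank.trans (Cardinal.lift_le.2 h)
      simp only [Cardinal.mk_fin, Cardinal.lift_natCast, Nat.cast_le] at hle
      omega
    obtain ⟨g, hg, i, hi⟩ := Fintype.not_linearIndependent_iff.1 hdep
    refine ⟨fun j => if hj : j < n + 1 then g ⟨j, hj⟩ else 0, fun j => ?_, ⟨i, i.2, ?_⟩, ?_⟩
    · dsimp only
      split_ifs
      exacts [(g _).2, S.zero_mem]
    · simpa [i.is_le] using hi
    · rw [← hg, Finset.sum_range]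
      exact Finset.sum_congr rfl fun j _ => by simp only [Fin.is_lt, dif_pos, Subring.smul_def,
        smul_eq_mul]
  · by_contra! hcard
    obtain ⟨e⟩ : Nonempty (Fin (n + 1) ↪ s) := by
      simpa [Function.Embedding.nonempty_iff_card_le] using hcard
    obtain ⟨a, haS, ⟨i, hi, hai⟩, ha⟩ := h fun j => if hj : j < n + 1 then e ⟨j, hj⟩ else 0
    refine hai (congrArg Subtype.val ((Fintype.linearIndependent_iff.1 (hs.comp e e.injective)
      (fun j => ⟨a j, haS j⟩) ?_) ⟨i, hi⟩))
    rw [← ha, Finset.sum_range]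
    exact Finset.sum_congr rfl fun j _ => by simp only [Fin.is_lt, dif_pos, Subring.smul_def,
      smul_eq_mul, Function.comp_apply]

/-- A subring `S` of a ring `D` containing the quotient of two of its elements whenever it lies in
`D`. If `D` is a domain, this says that `S` is the intersection of `D` and the fraction field of
`S`. -/
def IsDivisionClosed {D : Type*} [CommRing D] (S : Subring D) : Prop :=
  ∀ ⦃y : D⦄, y ∈ S → y ≠ 0 → ∀ ⦃w : D⦄, y * w ∈ S → w ∈ S

/-- The powers `1, z, …, z ^ (n - 1)` are linearly independent over a subring `S` modulo `d`, in the
sense that a linear combination divisible by `d` has all its coefficients divisible by `d`. -/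
def PowIndependentMod {D : Type*} [CommRing D] (S : Subring D) (z : D) (n : ℕ) (d : D) : Prop :=
  ∀ a : ℕ → D, (∀ j, a j ∈ S) → d ∣ ∑ j ∈ Finset.range n, a j * z ^ j → ∀ j < n, d ∣ a j

variable {D : Type*} [CommRing D] {S : Subring D}

lemma IsDivisionClosed.exists_eq_mul (hS : IsDivisionClosed S) {n : ℕ} {d : D} (hd : d ∈ S)
    (hd0 : d ≠ 0) {a : ℕ → D} (ha : ∀ j, a j ∈ S) (hda : ∀ j < n, d ∣ a j) :
    ∃ b : ℕ → D, (∀ j, b j ∈ S) ∧ ∀ j < n, a j = d * b j := by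
  have h : ∀ j, ∃ b ∈ S, j < n → a j = d * b := fun j => by
    by_cases hj : j < n
    · obtain ⟨b, hb⟩ := hda j hj
      exact ⟨b, hS hd hd0 (hb ▸ ha j), fun _ => hb⟩
    · exact ⟨0, S.zero_mem, fun h => absurd h hj⟩
  choose b hbS hb using h
  exact ⟨b, hbS, hb⟩

lemma IsDivisionClosed.isUnit [Nontrivial D] (hS : IsDivisionClosed S) {x : S}
    (hx : IsUnit (x : D)) : IsUnit x := by
  obtain ⟨y, hy⟩ := hx.exists_right_inv
  have hyS : y ∈ S := hS x.2 hx.ne_zero (hy ▸ S.one_mem)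
  exact .of_mul_eq_one ⟨y, hyS⟩ (Subtype.ext hy)

lemma IsDivisionClosed.dvd_iff (hS : IsDivisionClosed S) {x y : S} : x ∣ y ↔ (x : D) ∣ y := by
  refine ⟨map_dvd S.subtype, fun ⟨w, hw⟩ => ?_⟩
  by_cases hx : (x : D) = 0
  · exact ⟨0, Subtype.ext (by rw [hw, hx]; simp)⟩
  · exact ⟨⟨w, hS x.2 hx (hw ▸ y.2)⟩, Subtype.ext hw⟩

lemma exists_pow_dvd_sub {s : D} (hs : s ∈ S) (h : ∀ x : D, ∃ a ∈ S, s ∣ x - a) (m : ℕ) (x : D) :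
    ∃ a ∈ S, s ^ m ∣ x - a := by
  induction m with
  | zero => exact ⟨0, S.zero_mem, by simp⟩
  | succ m ih =>
    obtain ⟨a, ha, b, hb⟩ := ih
    obtain ⟨c, hc, hbc⟩ := h b
    refine ⟨a + s ^ m * c, S.add_mem ha (S.mul_mem (S.pow_mem hs m) hc), ?_⟩
    rw [← sub_sub, hb, ← mul_sub, pow_succ]
    exact mul_dvd_mul_left _ hbc

variable [IsDomain D]

lemma IsDivisionClosed.isDiscreteValuationRing [IsDiscreteValuationRing D]
    (hS : IsDivisionClosed S) {s : D} (hsS : s ∈ S) (hs0 : s ≠ 0) (hs : ¬ IsUnit s) :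
    IsDiscreteValuationRing S := by
  have : ValuationRing S := ValuationRing.iff_dvd_total.2 ⟨fun x y => by
    simpa only [hS.dvd_iff] using ValuationRing.dvd_total (x : D) y⟩
  have : WfDvdMonoid S := ⟨Subrelation.wf (fun {x y} hxy => ?_)
    (InvImage.wf S.subtype (IsWellFounded.wf (α := D) (r := DvdNotUnit)))⟩
  · have : IsPrincipalIdealRing S := ((IsBezout.TFAE (R := S)).out 3 1).1 this
    have hnot : ¬ IsField S := fun hfield => hs <| by
      let _ := hfield.toField
      exact (IsUnit.mk0 (⟨s, hsS⟩ : S) fun h => hs0 (congrArg Subtype.val h)).map S.subtype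
    exact { not_a_field' := IsLocalRing.isField_iff_maximalIdeal_eq.not.1 hnot }
  · obtain ⟨hx, c, hc, rfl⟩ := hxy
    exact ⟨fun h => hx (Subtype.ext h), c, fun h => hc (hS.isUnit h), rfl⟩

/-- Expressing `a n * x` through the powers of `z` and dividing by `a n`: this is possible since
`a n` divides the other coefficients by independence modulo `a n`. -/
lemma exists_eq_sum_of_rank_le (hS : IsDivisionClosed S) {z : D} {n : ℕ}
    (hind : ∀ d ∈ S, d ≠ 0 → PowIndependentMod S z n d)
    (hsep : ∀ a : D, a ≠ 0 → ∃ d ∈ S, d ≠ 0 ∧ ¬ d ∣ a)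
    (hrank : Module.rank S D ≤ n) (x : D) :
    ∃ a : ℕ → D, (∀ j, a j ∈ S) ∧ x = ∑ j ∈ Finset.range n, a j * z ^ j := by
  obtain ⟨a, haS, ⟨i, hi, hai⟩, ha⟩ := rank_le_iff_exists_sum_eq_zero.1 hrank
    fun j => if j < n then z ^ j else x
  rw [Finset.sum_range_succ, if_neg (lt_irrefl n), Finset.sum_congr rfl
    (g := fun j => a j * z ^ j) (fun j hj => by rw [if_pos (Finset.mem_range.1 hj)])] at ha
  have han : a n ≠ 0 := by
    intro han
    have hin : i < n := (Nat.lt_succ_iff_lt_or_eq.1 hi).resolve_right fun h => hai (h ▸ han)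
    obtain ⟨d, hd, hd0, hda⟩ := hsep _ hai
    rw [han, zero_mul, add_zero] at ha
    exact hda (hind d hd hd0 a haS (ha ▸ dvd_zero d) i hin)
  obtain ⟨b, hbS, hb⟩ := hS.exists_eq_mul (haS n) han haS (hind (a n) (haS n) han a haS
    ⟨-x, by rw [eq_neg_of_add_eq_zero_left ha, mul_neg]⟩)
  refine ⟨fun j => - b j, fun j => S.neg_mem (hbS j), mul_left_cancel₀ han ?_⟩
  rw [eq_neg_of_add_eq_zero_right ha, ← Finset.sum_neg_distrib, Finset.mul_sum]
  refine Finset.sum_congr rfl fun j hj => ?_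
  rw [hb j (Finset.mem_range.1 hj)]
  ring

lemma powIndependentMod_pow (hS : IsDivisionClosed S) {t : D} (ht : t ∈ S) (ht0 : t ≠ 0) {z : D}
    {n : ℕ} (hind : PowIndependentMod S z n t) (m : ℕ) : PowIndependentMod S z n (t ^ m) := by
  induction m with
  | zero => exact fun a _ _ j _ => by simp
  | succ m ih =>
    intro a ha h
    obtain ⟨b, hbS, hb⟩ := hS.exists_eq_mul ht ht0 ha
      (hind a ha ((dvd_pow_self t m.succ_ne_zero).trans h))
    rw [Finset.sum_congr rfl (g := fun j => t * (b j * z ^ j)) (fun j hj => by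
      rw [hb j (Finset.mem_range.1 hj), mul_assoc]), ← Finset.mul_sum, pow_succ',
      mul_dvd_mul_iff_left ht0] at h
    intro j hj
    rw [hb j hj, pow_succ']
    exact mul_dvd_mul_left _ (ih b hbS h j hj)

section DVR

variable [IsDiscreteValuationRing D] {p : ℕ}

lemma exists_mem_not_dvd (hp : p ≠ 0) (hpow : ∀ x : D, x ^ p ∈ S) {a : D} (ha : a ≠ 0) :
    ∃ d ∈ S, d ≠ 0 ∧ ¬ d ∣ a := by
  obtain ⟨t, ht⟩ := IsDiscreteValuationRing.exists_irreducible D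
  obtain ⟨n, u, rfl⟩ := IsDiscreteValuationRing.eq_unit_mul_pow_irreducible ha ht
  refine ⟨(t ^ (n + 1)) ^ p, hpow _, pow_ne_zero _ (pow_ne_zero _ ht.ne_zero), fun h => ?_⟩
  have hdvd : t ^ (n + 1) ∣ t ^ n := Units.dvd_mul_left.1 ((dvd_pow_self _ hp).trans h)
  rw [pow_dvd_pow_iff ht.ne_zero ht.not_isUnit] at hdvd
  omega

lemma powIndependentMod_uniformizer {t : D} (ht : Irreducible t)
    (hord : ∀ a ∈ S, ∀ n, ¬ p ∣ n → t ^ n ∣ a → t ^ (n + 1) ∣ a) {d : D} (hdS : d ∈ S)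
    (hd : d ≠ 0) : PowIndependentMod S t p d := by
  obtain ⟨n, u, rfl⟩ := IsDiscreteValuationRing.eq_unit_mul_pow_irreducible hd ht
  have hn : p ∣ n := by
    by_contra hn
    have hdvd := hord _ hdS n hn (dvd_mul_left _ _)
    rw [Units.dvd_mul_left, pow_dvd_pow_iff ht.ne_zero ht.not_isUnit] at hdvd
    omega
  obtain ⟨k, rfl⟩ := hn
  intro a ha h
  simp only [Units.mul_left_dvd] at h ⊢
  exact pow_mul_dvd_of_pow_mul_dvd_sum ht.prime (fun j _ => hord _ (ha j)) h

end DVR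

lemma eq_zero_of_sum_mul_pow_eq_zero {p : ℕ} [hp : Fact p.Prime] {k : Type*} [Field k] [CharP k p]
    (k₁ : Subfield k) {z : k} (hz : z ∉ k₁) (hzp : z ^ p ∈ k₁) {a : ℕ → k} (ha : ∀ j, a j ∈ k₁)
    (h : ∑ j ∈ Finset.range p, a j * z ^ j = 0) : ∀ j < p, a j = 0 := by
  open Polynomial in
  let zp : k₁ := ⟨z ^ p, hzp⟩
  have hirr : Irreducible (X ^ p - C zp) := by
    refine X_pow_sub_C_irreducible_of_prime hp.out fun b hb => hz ?_
    rw [← frobenius_inj k p (congrArg Subtype.val hb : (b : k) ^ p = z ^ p)]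
    exact b.2
  have hmin : X ^ p - C zp = minpoly k₁ z :=
    minpoly.eq_of_irreducible_of_monic hirr (by
        rw [map_sub, map_pow, aeval_X, aeval_C]
        exact sub_self _)
      (monic_X_pow_sub_C _ hp.out.ne_zero)
  have hdeg : (minpoly k₁ z).natDegree = p := hmin ▸ natDegree_X_pow_sub_C
  have hli := linearIndependent_pow (K := k₁) z
  rw [hdeg] at hli
  intro j hj
  refine congrArg Subtype.val (Fintype.linearIndependent_iff.1 hli
    (fun j => (⟨a j, ha j⟩ : k₁)) ?_ ⟨j, hj⟩)
  rw [← h, Finset.sum_range]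
  exact Finset.sum_congr rfl fun j _ => by simp [Subfield.smul_def]

/-- The residue field of a subring of a local ring `D` that is closed under division, as a subfield
of the residue field of `D`. -/
def IsDivisionClosed.residueSubfield [IsLocalRing D] (hS : IsDivisionClosed S) :
    Subfield (IsLocalRing.ResidueField D) where
  __ := S.map (IsLocalRing.residue D)
  inv_mem' := by
    rintro _ ⟨x, hx, rfl⟩
    by_cases hu : IsUnit x
    · obtain ⟨y, hy⟩ := hu.exists_right_inv
      refine ⟨y, hS hx hu.ne_zero (hy ▸ S.one_mem), eq_inv_of_mul_eq_one_right ?_⟩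
      rw [← map_mul, hy, map_one]
    · rw [(IsLocalRing.residue_eq_zero_iff x).2 hu, inv_zero]
      exact (S.map (IsLocalRing.residue D)).zero_mem

/-- If `S` has an element of order `m` prime to `p`, Bézout's identity `m * n = p * q + 1` makes
`u ^ n * t` a quotient of elements of `S`. -/
lemma exists_irreducible_mem {p : ℕ} [hp : Fact p.Prime] (hS : IsDivisionClosed S)
    (hpow : ∀ x : D, x ^ p ∈ S) {t : D} (ht : Irreducible t) {m : ℕ} (hm : ¬ p ∣ m) {u : Dˣ}
    (hu : u * t ^ m ∈ S) : ∃ s ∈ S, Irreducible s := by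
  have hcop : m.Coprime p := (hp.out.coprime_iff_not_dvd.2 hm).symm
  obtain ⟨n, -, hn⟩ := Nat.exists_mul_mod_eq_one_of_coprime hcop hp.out.one_lt
  obtain ⟨q, hmn⟩ : ∃ q, m * n = p * q + 1 := ⟨m * n / p, by rw [← hn, Nat.div_add_mod]⟩
  refine ⟨(u ^ n : Dˣ) * t, ?_, (irreducible_units_mul _).2 ht⟩
  refine hS (hpow (t ^ q)) (pow_ne_zero _ (pow_ne_zero _ ht.ne_zero)) ?_
  convert S.pow_mem hu n using 1
  rw [mul_pow, ← pow_mul t m, hmn, pow_add, Units.val_pow_eq_pow_val, ← pow_mul]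
  ring

section CharP

variable [IsDiscreteValuationRing D] {p : ℕ} [hp : Fact p.Prime]

lemma powIndependentMod_of_residue_not_mem [CharP D p] (hS : IsDivisionClosed S)
    (hpow : ∀ x : D, x ^ p ∈ S) {t : D} (ht : Irreducible t) {z : D}
    (hz : ∀ a ∈ S, ¬ t ∣ z - a) : PowIndependentMod S z p t := by
  have : CharP (IsLocalRing.ResidueField D) p := by
    rw [CharP.charP_iff_prime_eq_zero hp.out, ← map_natCast (IsLocalRing.residue D),
      CharP.cast_eq_zero, map_zero]
  have hres : ∀ x, IsLocalRing.residue D x = 0 ↔ t ∣ x := fun x => by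
    rw [IsLocalRing.residue_eq_zero_iff, ht.maximalIdeal_eq, Ideal.mem_span_singleton]
  intro a haS h j hj
  rw [← hres] at h ⊢
  refine eq_zero_of_sum_mul_pow_eq_zero (p := p) hS.residueSubfield
    (z := IsLocalRing.residue D z) ?_ ⟨z ^ p, hpow z, map_pow _ _ _⟩
    (a := fun j => IsLocalRing.residue D (a j)) (fun j => ⟨a j, haS j, rfl⟩) ?_ j hj
  · rintro ⟨x, hx, hxz⟩
    exact hz x hx ((hres _).1 (by rw [map_sub, hxz, sub_self]))
  · simpa only [map_sum, map_mul, map_pow] using h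

/-- The generator is a uniformizer of `D` if all orders of elements of `S` are multiples of `p`, and
a lift of a generator of the residue field extension if `S` contains a uniformizer `s`; in the
second case the residue field extension is nontrivial because `S` is not dense for the `s`-adic
topology. -/
theorem exists_monogenic_generator [CharP D p] (hS : IsDivisionClosed S)
    (hpow : ∀ x : D, x ^ p ∈ S) (hrank : Module.rank S D ≤ p)
    (hdense : ∀ s ∈ S, Irreducible s → ∃ m x, ∀ a ∈ S, ¬ s ^ m ∣ x - a) :
    ∃ z, ∀ x, ∃ a : ℕ → D, (∀ j, a j ∈ S) ∧ x = ∑ j ∈ Finset.range p, a j * z ^ j := by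
  suffices H : ∃ z, ∀ d ∈ S, d ≠ 0 → PowIndependentMod S z p d from
    H.imp fun z hz =>
      exists_eq_sum_of_rank_le hS hz (fun _ => exists_mem_not_dvd hp.out.ne_zero hpow) hrank
  obtain ⟨t, ht⟩ := IsDiscreteValuationRing.exists_irreducible D
  by_cases hord : ∀ m, ∀ u : Dˣ, u * t ^ m ∈ S → p ∣ m
  · refine ⟨t, fun d hd hd0 => powIndependentMod_uniformizer ht (fun a ha n hn hdvd => ?_) hd hd0⟩
    rcases eq_or_ne a 0 with rfl | ha0
    · exact dvd_zero _
    obtain ⟨m, u, rfl⟩ := IsDiscreteValuationRing.eq_unit_mul_pow_irreducible ha0 ht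
    rw [Units.dvd_mul_left, pow_dvd_pow_iff ht.ne_zero ht.not_isUnit] at hdvd ⊢
    exact hdvd.lt_of_ne fun h => hn (h ▸ hord m u ha)
  · push Not at hord
    obtain ⟨m, u, hu, hm⟩ := hord
    obtain ⟨s, hsS, hs⟩ := exists_irreducible_mem hS hpow ht hm hu
    obtain ⟨z, hz⟩ : ∃ z, ∀ a ∈ S, ¬ s ∣ z - a := by
      by_contra! hres
      obtain ⟨m, x, hx⟩ := hdense s hsS hs
      obtain ⟨a, ha, hdvd⟩ := exists_pow_dvd_sub hsS hres m x
      exact hx a ha hdvd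
    refine ⟨z, fun d _ hd0 => ?_⟩
    obtain ⟨m, u, rfl⟩ := IsDiscreteValuationRing.eq_unit_mul_pow_irreducible hd0 hs
    have hind := powIndependentMod_of_residue_not_mem hS hpow hs hz
    simpa only [PowIndependentMod, Units.mul_left_dvd] using
      powIndependentMod_pow hS hsS hs.ne_zero hind m

lemma isDivisionClosed_range_frobenius [CharP D p] : IsDivisionClosed (frobenius D p).range := by
  rintro _ ⟨y, rfl⟩ hy w ⟨x, hx⟩
  simp only [frobenius_def] at hy hx
  obtain ⟨v, rfl⟩ : y ∣ x := (IsIntegrallyClosed.pow_dvd_pow_iff hp.out.ne_zero).1 ⟨w, hx⟩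
  rw [mul_pow] at hx
  exact ⟨v, mul_left_cancel₀ hy hx⟩

theorem isPBasis_of_rank_le [CharP D p] {t : D} (ht : Irreducible t)
    (hrank : Module.rank (frobenius D p).range D ≤ p) : IsPBasis p t := by
  refine isPBasis_of_irreducible ht fun x => ?_
  have hpow : ∀ x : D, x ^ p ∈ (frobenius D p).range := fun x => ⟨x, rfl⟩
  have hind : ∀ d ∈ (frobenius D p).range, d ≠ 0 →
      PowIndependentMod (frobenius D p).range t p d := by
    refine fun d => powIndependentMod_uniformizer ht ?_
    rintro _ ⟨x, rfl⟩ n hn h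
    exact pow_succ_dvd_pow_of_not_dvd ht.prime x hn h
  obtain ⟨a, haS, rfl⟩ := exists_eq_sum_of_rank_le isDivisionClosed_range_frobenius hind
    (fun _ => exists_mem_not_dvd hp.out.ne_zero hpow) hrank x
  choose b hb using haS
  refine ⟨∑ j ∈ Finset.range p, Polynomial.monomial j (b j), ?_⟩
  simp only [map_sum, ← Polynomial.C_mul_X_pow_eq_monomial, map_mul, map_pow, frobEval_C,
    frobEval_X, ← hb, frobenius_def]

end CharP

end Monogenic

section PowSaturation

variable (K A : Type*) [Field K] [CommRing A] [Algebra K A]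

/-- The subalgebra generated by the `q`-th powers. -/
abbrev powAdjoin (q : ℕ) : Subalgebra K A := Algebra.adjoin K (Set.range fun a : A => a ^ q)

variable [IsDomain A]

/-- The elements of `A` that are fractions of elements of `powAdjoin K A q`. If `A` is the local
ring of a curve at a regular point and `q = p ^ i`, then this is the local ring of the normalization
of the `i`-th Frobenius twist of the curve. -/
def powSaturation (q : ℕ) : Subalgebra K A where
  carrier := {x | ∃ y ∈ powAdjoin K A q, y ≠ 0 ∧ x * y ∈ powAdjoin K A q}
  mul_mem' := by
    rintro a b ⟨y, hy, hy0, hay⟩ ⟨z, hz, hz0, hbz⟩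
    exact ⟨y * z, mul_mem hy hz, mul_ne_zero hy0 hz0, by
      rw [mul_mul_mul_comm]; exact mul_mem hay hbz⟩
  add_mem' := by
    rintro a b ⟨y, hy, hy0, hay⟩ ⟨z, hz, hz0, hbz⟩
    refine ⟨y * z, mul_mem hy hz, mul_ne_zero hy0 hz0, ?_⟩
    rw [show (a + b) * (y * z) = a * y * z + b * z * y by ring]
    exact add_mem (mul_mem hay hz) (mul_mem hbz hy)
  algebraMap_mem' k := ⟨1, one_mem _, one_ne_zero, mul_mem (algebraMap_mem _ k) (one_mem _)⟩

variable {K A}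

lemma powAdjoin_le_powSaturation (q : ℕ) : powAdjoin K A q ≤ powSaturation K A q :=
  fun x hx => ⟨1, one_mem _, one_ne_zero, by rwa [mul_one]⟩

lemma pow_mem_powSaturation (q : ℕ) (a : A) : a ^ q ∈ powSaturation K A q :=
  powAdjoin_le_powSaturation q (Algebra.subset_adjoin ⟨a, rfl⟩)

lemma isDivisionClosed_powSaturation (q : ℕ) :
    IsDivisionClosed (powSaturation K A q).toSubring := by
  rintro y ⟨b, hb, hb0, hyb⟩ hy0 w ⟨a, ha, ha0, hxa⟩
  refine ⟨y * b * a, mul_mem hyb ha, mul_ne_zero (mul_ne_zero hy0 hb0) ha0, ?_⟩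
  rw [show w * (y * b * a) = y * w * a * b by ring]
  exact mul_mem hxa hb

lemma powSaturation_one : powSaturation K A 1 = ⊤ :=
  eq_top_iff.2 fun x _ => by simpa using pow_mem_powSaturation (K := K) 1 x

lemma powSaturation_mul_le (q r : ℕ) : powSaturation K A (q * r) ≤ powSaturation K A q := by
  have h : powAdjoin K A (q * r) ≤ powAdjoin K A q := by
    refine Algebra.adjoin_le ?_
    rintro _ ⟨a, rfl⟩
    exact Algebra.subset_adjoin ⟨a ^ r, by simp only [← pow_mul, mul_comm]⟩
  rintro x ⟨y, hy, hy0, hxy⟩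
  exact ⟨y, h hy, hy0, h hxy⟩

lemma pow_mem_powSaturation_mul (p : ℕ) [Fact p.Prime] [CharP A p] {q : ℕ} (s : ℕ) {x : A}
    (hx : x ∈ powSaturation K A q) : x ^ p ^ s ∈ powSaturation K A (q * p ^ s) := by
  have h : ∀ y ∈ powAdjoin K A q, y ^ p ^ s ∈ powAdjoin K A (q * p ^ s) := by
    intro y hy
    induction hy using Algebra.adjoin_induction with
    | mem x hx =>
      obtain ⟨a, rfl⟩ := hx
      exact Algebra.subset_adjoin ⟨a, pow_mul a q _⟩
    | algebraMap r => rw [← map_pow]; exact algebraMap_mem _ _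
    | add x y _ _ hx hy => rw [add_pow_char_pow]; exact add_mem hx hy
    | mul x y _ _ hx hy => rw [mul_pow]; exact mul_mem hx hy
  obtain ⟨y, hy, hy0, hxy⟩ := hx
  exact ⟨y ^ p ^ s, h y hy, pow_ne_zero _ hy0, by rw [← mul_pow]; exact h _ hxy⟩

end PowSaturation

section TensorRange

variable {K A : Type*} [Field K] [CommRing A] [Algebra K A] (L M : Type*) [Field L] [Algebra K L]
  [CommRing M] [Algebra (L ⊗[K] A) M]

/-- The map `L ⊗ S → M` induced by an algebra structure of `M` over `L ⊗ A`, for `S ⊆ A`. -/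
def tensorMap (S : Subalgebra K A) : L ⊗[K] S →+* M :=
  (algebraMap (L ⊗[K] A) M).comp
    (Algebra.TensorProduct.map (AlgHom.id K L) S.val : L ⊗[K] S →ₐ[K] L ⊗[K] A).toRingHom

lemma tensorMap_tmul (S : Subalgebra K A) (l : L) (a : S) :
    tensorMap L M S (l ⊗ₜ a) = algebraMap (L ⊗[K] A) M (l ⊗ₜ (a : A)) := rfl

/-- The image of `L ⊗ S` in an algebra `M` over `L ⊗ A`, for `S ⊆ A`. -/
def tensorRange (S : Subalgebra K A) : Subring M := (tensorMap L M S).range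

variable {L M}

lemma tmul_mem_tensorRange {S : Subalgebra K A} (l : L) {a : A} (ha : a ∈ S) :
    algebraMap (L ⊗[K] A) M (l ⊗ₜ a) ∈ tensorRange L M S := ⟨l ⊗ₜ ⟨a, ha⟩, rfl⟩

lemma tensorRange_le_iff {S : Subalgebra K A} {R : Subring M} :
    tensorRange L M S ≤ R ↔ ∀ l : L, ∀ a ∈ S, algebraMap (L ⊗[K] A) M (l ⊗ₜ a) ∈ R := by
  refine ⟨fun h l a ha => h (tmul_mem_tensorRange l ha), ?_⟩
  rintro h _ ⟨u, rfl⟩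
  induction u with
  | zero => rw [map_zero]; exact R.zero_mem
  | add x y hx hy => rw [map_add]; exact R.add_mem hx hy
  | tmul l a => exact h l a a.2

lemma tensorRange_mono {S T : Subalgebra K A} (h : S ≤ T) :
    tensorRange L M S ≤ tensorRange L M T :=
  tensorRange_le_iff.2 fun l _ ha => tmul_mem_tensorRange l (h ha)

lemma tensorRange_top :
    tensorRange L M (⊤ : Subalgebra K A) = (algebraMap (L ⊗[K] A) M).range := by
  refine le_antisymm (tensorRange_le_iff.2 fun l a _ => ⟨l ⊗ₜ a, rfl⟩) ?_
  rintro _ ⟨u, rfl⟩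
  induction u with
  | zero => rw [map_zero]; exact zero_mem _
  | add x y hx hy => rw [map_add]; exact add_mem hx hy
  | tmul l a => exact tmul_mem_tensorRange l trivial

variable [IsDomain A] (p : ℕ) [hp : Fact p.Prime] [CharP M p]

variable (K A L M) in
/-- The `p ^ i`-th roots in `M` of the elements of `L ⊗ powSaturation K A (p ^ i)`. If `L` is
perfect, then its `p ^ i`-th power map identifies this ring with
`L ⊗ powSaturation K A (p ^ i)`. -/
def rootTower (i : ℕ) : Subring M :=
  (tensorRange L M (powSaturation K A (p ^ i))).comap (iterateFrobenius M p i)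

variable {p}

lemma mem_rootTower {i : ℕ} {x : M} :
    x ∈ rootTower K A L M p i ↔ x ^ p ^ i ∈ tensorRange L M (powSaturation K A (p ^ i)) :=
  Iff.rfl

lemma rootTower_zero : rootTower K A L M p 0 = (algebraMap (L ⊗[K] A) M).range := by
  ext x
  rw [mem_rootTower, pow_zero, pow_one, powSaturation_one, tensorRange_top]

lemma pow_mem_rootTower {i : ℕ} {x : M} (hx : x ∈ rootTower K A L M p (i + 1)) :
    x ^ p ∈ rootTower K A L M p i := by
  rw [mem_rootTower, ← pow_mul, ← pow_succ']
  exact tensorRange_mono (powSaturation_mul_le _ _) hx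

variable [CharP A p]

lemma pow_mem_tensorRange_mul {q : ℕ} (s : ℕ) {x : M}
    (hx : x ∈ tensorRange L M (powSaturation K A q)) :
    x ^ p ^ s ∈ tensorRange L M (powSaturation K A (q * p ^ s)) := by
  suffices tensorRange L M (powSaturation K A q) ≤
      (tensorRange L M (powSaturation K A (q * p ^ s))).comap (iterateFrobenius M p s) from this hx
  refine tensorRange_le_iff.2 fun l a ha => ?_
  rw [Subring.mem_comap, iterateFrobenius_def, ← map_pow, Algebra.TensorProduct.tmul_pow]
  exact tmul_mem_tensorRange _ (pow_mem_powSaturation_mul p s ha)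

lemma rootTower_le_succ (i : ℕ) : rootTower K A L M p i ≤ rootTower K A L M p (i + 1) := by
  intro x hx
  rw [mem_rootTower, pow_succ, pow_mul]
  rw [mem_rootTower] at hx
  simpa only [pow_one] using pow_mem_tensorRange_mul (p := p) 1 hx

lemma rootTower_mono {i j : ℕ} (h : i ≤ j) : rootTower K A L M p i ≤ rootTower K A L M p j :=
  monotone_nat_of_le_succ (f := fun i => rootTower K A L M p i) rootTower_le_succ h

lemma algebraMap_mem_rootTower (i : ℕ) (u : L ⊗[K] A) :
    algebraMap (L ⊗[K] A) M u ∈ rootTower K A L M p i :=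
  rootTower_mono i.zero_le (by rw [rootTower_zero]; exact ⟨u, rfl⟩)

end TensorRange

section Roots

variable {K A L M : Type*} [Field K] [CommRing A] [Algebra K A] [Field L] [Algebra K L]
  [Field M] [Algebra (L ⊗[K] A) M] {p : ℕ} [hp : Fact p.Prime] [CharP M p]
  [CharP L p] [PerfectRing L p]

lemma tmul_one_mem_fieldRange_iterateFrobenius (i : ℕ) (l : L) :
    algebraMap (L ⊗[K] A) M (l ⊗ₜ 1) ∈ (iterateFrobenius M p i).fieldRange := by
  obtain ⟨r, rfl⟩ := (bijective_iterateFrobenius L p i).surjective l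
  exact ⟨algebraMap (L ⊗[K] A) M (r ⊗ₜ 1), by
    rw [iterateFrobenius_def, iterateFrobenius_def, ← map_pow, Algebra.TensorProduct.tmul_pow,
      one_pow]⟩

lemma one_tmul_mem_fieldRange_iterateFrobenius {i : ℕ} {x : A} (hx : x ∈ powAdjoin K A (p ^ i)) :
    algebraMap (L ⊗[K] A) M (1 ⊗ₜ x) ∈ (iterateFrobenius M p i).fieldRange := by
  induction hx using Algebra.adjoin_induction with
  | mem x hx =>
    obtain ⟨a, rfl⟩ := hx
    exact ⟨algebraMap (L ⊗[K] A) M (1 ⊗ₜ a), by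
      rw [iterateFrobenius_def, ← map_pow, Algebra.TensorProduct.tmul_pow, one_pow]⟩
  | algebraMap r =>
    rw [← Algebra.TensorProduct.tmul_one_eq_one_tmul]
    exact tmul_one_mem_fieldRange_iterateFrobenius i _
  | add x y _ _ hx hy => rw [TensorProduct.tmul_add, map_add]; exact add_mem hx hy
  | mul x y _ _ hx hy =>
    rw [← one_mul (1 : L), ← Algebra.TensorProduct.tmul_mul_tmul, map_mul]
    exact mul_mem hx hy

variable [IsDomain A] [IsFractionRing (L ⊗[K] A) M]

lemma exists_pow_eq_of_mem_tensorRange {i : ℕ} {x : M}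
    (hx : x ∈ tensorRange L M (powSaturation K A (p ^ i))) :
    ∃ m ∈ rootTower K A L M p i, m ^ p ^ i = x := by
  suffices tensorRange L M (powSaturation K A (p ^ i)) ≤
      (iterateFrobenius M p i).fieldRange.toSubring by
    obtain ⟨m, rfl⟩ := this hx
    exact ⟨m, hx, rfl⟩
  refine tensorRange_le_iff.2 fun l a ⟨y, hy, hy0, hay⟩ => ?_
  have hy0' : algebraMap (L ⊗[K] A) M (1 ⊗ₜ y) ≠ 0 :=
    (map_ne_zero_iff _ (IsFractionRing.injective (L ⊗[K] A) M)).2 <|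
      (map_ne_zero_iff (Algebra.TensorProduct.includeRight : A →ₐ[K] L ⊗[K] A)
        (Algebra.TensorProduct.includeRight_injective (algebraMap K L).injective)).2 hy0
  have hla : algebraMap (L ⊗[K] A) M (l ⊗ₜ a) = algebraMap (L ⊗[K] A) M (l ⊗ₜ 1) *
      algebraMap (L ⊗[K] A) M (1 ⊗ₜ (a * y)) / algebraMap (L ⊗[K] A) M (1 ⊗ₜ y) := by
    rw [eq_div_iff hy0', ← map_mul, ← map_mul, Algebra.TensorProduct.tmul_mul_tmul,
      Algebra.TensorProduct.tmul_mul_tmul, one_mul, mul_one]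
  change _ ∈ (iterateFrobenius M p i).fieldRange
  rw [hla]
  exact div_mem (mul_mem (tmul_one_mem_fieldRange_iterateFrobenius i l)
    (one_tmul_mem_fieldRange_iterateFrobenius hay)) (one_tmul_mem_fieldRange_iterateFrobenius hy)

end Roots

section DualContract

variable {K L S : Type*} [Field K] [Field L] [Algebra K L]

/-- The contraction `l ⊗ s ↦ φ l • s`. -/
def dualContract [AddCommGroup S] [Module K S] (φ : Module.Dual K L) : L ⊗[K] S →ₗ[K] S :=
  (TensorProduct.lid K S).toLinearMap ∘ₗ φ.rTensor S

@[simp]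
lemma dualContract_tmul [AddCommGroup S] [Module K S] (φ : Module.Dual K L) (l : L) (s : S) :
    dualContract φ (l ⊗ₜ[K] s) = φ l • s := by
  simp [dualContract]

lemma exists_dualContract_ne_zero [AddCommGroup S] [Module K S] {u : L ⊗[K] S} (hu : u ≠ 0) :
    ∃ φ : Module.Dual K L, dualContract φ u ≠ 0 := by
  classical
  by_contra! h
  refine hu ((TensorProduct.equivFinsuppOfBasisLeft (N := S)
    (Module.Basis.ofVectorSpace K L)).injective (Finsupp.ext fun k => ?_))
  rw [TensorProduct.equivFinsuppOfBasisLeft_apply, map_zero]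
  exact h _

variable [CommRing S] [Algebra K S]

lemma dualContract_mul (φ : Module.Dual K L) (u : L ⊗[K] S) (s : S) :
    dualContract φ (u * 1 ⊗ₜ s) = dualContract φ u * s := by
  induction u with
  | zero => simp only [zero_mul, map_zero]
  | add x y hx hy => rw [add_mul, map_add, map_add, add_mul, hx, hy]
  | tmul l a =>
    rw [Algebra.TensorProduct.tmul_mul_tmul, mul_one, dualContract_tmul, dualContract_tmul,
      smul_mul_assoc]

lemma dualContract_map (T : Subalgebra K S) (φ : Module.Dual K L) (u : L ⊗[K] T) :
    dualContract φ (Algebra.TensorProduct.map (AlgHom.id K L) T.val u) = dualContract φ u := by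
  induction u with
  | zero => simp only [map_zero, ZeroMemClass.coe_zero]
  | add x y hx hy => rw [map_add, map_add, map_add, hx, hy, Subalgebra.coe_add]
  | tmul l a =>
    rw [Algebra.TensorProduct.map_tmul, dualContract_tmul, dualContract_tmul]
    rfl

lemma isUnit_one_tmul_iff {s : S} : IsUnit ((1 : L) ⊗ₜ[K] s) ↔ IsUnit s := by
  refine ⟨fun h => ?_, fun h =>
    h.map (Algebra.TensorProduct.includeRight : S →ₐ[K] L ⊗[K] S)⟩
  have := isUnit_of_map_unit (algebraMap S (S ⊗[K] L)) s
  exact this (h.map (Algebra.TensorProduct.comm K L S))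

lemma map_val_injective (T : Subalgebra K S) :
    Function.Injective (Algebra.TensorProduct.map (AlgHom.id K L) T.val) :=
  Module.Flat.lTensor_preserves_injective_linearMap T.val.toLinearMap Subtype.val_injective

end DualContract

section TensorDVR

variable {K L S : Type*} [Field K] [Field L] [Algebra K L] [CommRing S] [Algebra K S] {s : S}

lemma exists_one_tmul_dvd_sub (hres : ∀ a : S, ∃ k : K, s ∣ a - algebraMap K S k)
    (u : L ⊗[K] S) : ∃ l : L, 1 ⊗ₜ s ∣ u - l ⊗ₜ[K] 1 := by
  induction u with
  | zero => exact ⟨0, by rw [TensorProduct.zero_tmul, sub_zero]; exact dvd_zero _⟩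
  | add x y hx hy =>
    obtain ⟨l, hl⟩ := hx
    obtain ⟨m, hm⟩ := hy
    exact ⟨l + m, by rw [TensorProduct.add_tmul, add_sub_add_comm]; exact dvd_add hl hm⟩
  | tmul l a =>
    obtain ⟨k, b, hb⟩ := hres a
    refine ⟨k • l, l ⊗ₜ b, ?_⟩
    rw [Algebra.TensorProduct.tmul_mul_tmul, one_mul, ← hb, TensorProduct.tmul_sub,
      TensorProduct.smul_tmul, Algebra.algebraMap_eq_smul_one]

variable [IsDomain S] [IsDiscreteValuationRing S]

lemma finiteMultiplicity_one_tmul (hs : ¬IsUnit s) {u : L ⊗[K] S} (hu : u ≠ 0) :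
    FiniteMultiplicity (1 ⊗ₜ s) u := by
  obtain ⟨φ, hφ⟩ := exists_dualContract_ne_zero hu
  obtain ⟨n, hn⟩ := FiniteMultiplicity.of_not_isUnit hs hφ
  refine ⟨n, fun ⟨y, hy⟩ => hn ⟨dualContract φ y, ?_⟩⟩
  rw [hy, Algebra.TensorProduct.tmul_pow, one_pow, mul_comm, dualContract_mul, mul_comm]

variable [Algebra.IsAlgebraic K L] (hs : Irreducible s)
  (hres : ∀ a : S, ∃ k : K, s ∣ a - algebraMap K S k)
include hs

/- `L ⊗ S` is integral over `S`, so its maximal ideals lie over the one generated by `s`. -/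
lemma one_tmul_mem_of_isMaximal (I : Ideal (L ⊗[K] S)) [I.IsMaximal] : 1 ⊗ₜ s ∈ I := by
  let e := Algebra.TensorProduct.comm K S L
  have hI : (I.comap e).IsMaximal := Ideal.comap_isMaximal_of_equiv e
  have hmax := IsLocalRing.eq_maximalIdeal
    (Ideal.isMaximal_comap_of_isIntegral_of_isMaximal (R := S) (I.comap e))
  have hmem : s ∈ (I.comap e).comap (algebraMap S (S ⊗[K] L)) := by
    rw [hmax, IsLocalRing.mem_maximalIdeal]
    exact hs.not_isUnit
  exact hmem

include hres

lemma isUnit_iff_not_one_tmul_dvd {u : L ⊗[K] S} : IsUnit u ↔ ¬1 ⊗ₜ s ∣ u := by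
  refine ⟨fun hu hdvd => hs.not_isUnit (isUnit_one_tmul_iff.1 (isUnit_of_dvd_unit hdvd hu)),
    fun hdvd => ?_⟩
  by_contra hu
  obtain ⟨I, hI, huI⟩ := exists_max_ideal_of_mem_nonunits hu
  obtain ⟨l, v, hv⟩ := exists_one_tmul_dvd_sub (L := L) hres u
  have hl : l ⊗ₜ[K] (1 : S) ∈ I := by
    rw [← sub_sub_cancel u (l ⊗ₜ 1), hv]
    exact I.sub_mem huI (I.mul_mem_right _ (one_tmul_mem_of_isMaximal hs I))
  have hl0 : l = 0 := by
    by_contra hl0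
    exact hI.ne_top (I.eq_top_of_isUnit_mem hl
      ((IsUnit.mk0 l hl0).map (Algebra.TensorProduct.includeLeft : L →ₐ[K] L ⊗[K] S)))
  rw [hl0, TensorProduct.zero_tmul, sub_zero] at hv
  exact hdvd ⟨v, hv⟩

variable [IsDomain (L ⊗[K] S)]

lemma irreducible_one_tmul : Irreducible ((1 : L) ⊗ₜ[K] s) := by
  have hs0 : (1 : L) ⊗ₜ[K] s ≠ 0 :=
    (map_ne_zero_iff (Algebra.TensorProduct.includeRight : S →ₐ[K] L ⊗[K] S)
      (Algebra.TensorProduct.includeRight_injective (algebraMap K L).injective)).2 hs.ne_zero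
  refine ⟨fun h => hs.not_isUnit (isUnit_one_tmul_iff.1 h), fun a b hab => ?_⟩
  by_contra! h
  rw [isUnit_iff_not_one_tmul_dvd hs hres, isUnit_iff_not_one_tmul_dvd hs hres, not_not,
    not_not] at h
  refine hs.not_isUnit (isUnit_one_tmul_iff (K := K) (L := L).1 (isUnit_of_dvd_one ?_))
  rw [← mul_dvd_mul_iff_left hs0, mul_one]
  exact (mul_dvd_mul h.1 h.2).trans (dvd_of_eq hab.symm)

lemma isDiscreteValuationRing_tensor : IsDiscreteValuationRing (L ⊗[K] S) := by
  refine IsDiscreteValuationRing.ofHasUnitMulPowIrreducibleFactorization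
    ⟨1 ⊗ₜ s, irreducible_one_tmul hs hres, fun {u} hu => ?_⟩
  obtain ⟨w, hw, hdvd⟩ :=
    (finiteMultiplicity_one_tmul (L := L) hs.not_isUnit hu).exists_eq_pow_mul_and_not_dvd
  have hunit := (isUnit_iff_not_one_tmul_dvd hs hres).2 hdvd
  exact ⟨_, hunit.unit, hw.symm⟩

end TensorDVR

section RootTowerEquiv

variable {K A L M : Type*} [Field K] [CommRing A] [Algebra K A] [Field L] [Algebra K L] [Field M]
  [Algebra (L ⊗[K] A) M] [IsFractionRing (L ⊗[K] A) M] {p : ℕ}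

lemma tensorMap_injective (S : Subalgebra K A) : Function.Injective (tensorMap L M S) :=
  (IsFractionRing.injective (L ⊗[K] A) M).comp (map_val_injective S)

variable (M) in
/-- The isomorphism of `L ⊗ S` with its image in a fraction field of `L ⊗ A`. -/
def tensorRangeEquiv (S : Subalgebra K A) : L ⊗[K] S ≃+* tensorRange L M S :=
  RingEquiv.ofBijective (tensorMap L M S).rangeRestrict
    ⟨fun _ _ h => tensorMap_injective S (congrArg Subtype.val h),
      RingHom.rangeRestrict_surjective _⟩

variable [IsDomain A] [hp : Fact p.Prime] [CharP M p] [CharP L p] [PerfectRing L p]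

variable (K A L M p) in
/-- The isomorphism `rootTower K A L M p i ≃ L ⊗ powSaturation K A (p ^ i)` given by the
`p ^ i`-th power map. -/
def rootTowerEquiv (i : ℕ) : rootTower K A L M p i ≃+* L ⊗[K] powSaturation K A (p ^ i) :=
  (RingEquiv.ofBijective ((iterateFrobenius M p i).restrict (rootTower K A L M p i)
      (tensorRange L M (powSaturation K A (p ^ i))) fun _ hx => hx)
    ⟨fun _ _ h => Subtype.ext ((iterateFrobenius M p i).injective (congrArg Subtype.val h)),
      fun x => by
        obtain ⟨m, hm, hmx⟩ := exists_pow_eq_of_mem_tensorRange x.2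
        exact ⟨⟨m, hm⟩, Subtype.ext hmx⟩⟩).trans (tensorRangeEquiv M _).symm

lemma tensorMap_rootTowerEquiv {i : ℕ} (x : rootTower K A L M p i) :
    tensorMap L M (powSaturation K A (p ^ i)) (rootTowerEquiv K A L M p i x) = (x : M) ^ p ^ i :=
  congrArg Subtype.val
    (RingEquiv.apply_symm_apply (tensorRangeEquiv M (powSaturation K A (p ^ i))) _)

lemma rootTowerEquiv_eq_iff {i : ℕ} {x : rootTower K A L M p i}
    {u : L ⊗[K] powSaturation K A (p ^ i)} :
    rootTowerEquiv K A L M p i x = u ↔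
      (x : M) ^ p ^ i = tensorMap L M (powSaturation K A (p ^ i)) u := by
  rw [← (tensorMap_injective (M := M) (powSaturation K A (p ^ i))).eq_iff,
    tensorMap_rootTowerEquiv]

lemma isUnit_of_isUnit_rootTower [CharP A p] {n i : ℕ} (hin : i ≤ n) {s : A}
    (hs : s ∈ powSaturation K A (p ^ i)) {b : rootTower K A L M p n}
    (hb : (b : M) ^ p ^ i = algebraMap (L ⊗[K] A) M (1 ⊗ₜ s)) (hu : IsUnit b) : IsUnit s := by
  have hsn : s ^ p ^ (n - i) ∈ powSaturation K A (p ^ n) := by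
    have h := pow_mem_powSaturation_mul p (n - i) hs
    rwa [← pow_add, Nat.add_sub_cancel' hin] at h
  have hequiv : rootTowerEquiv K A L M p n b = 1 ⊗ₜ ⟨_, hsn⟩ := by
    rw [rootTowerEquiv_eq_iff, tensorMap_tmul, ← one_pow (M := L) (p ^ (n - i)),
      ← Algebra.TensorProduct.tmul_pow, map_pow, ← hb, ← pow_mul, ← pow_add,
      Nat.add_sub_cancel' hin]
  have hunit := hu.map (rootTowerEquiv K A L M p n)
  rw [hequiv, isUnit_one_tmul_iff] at hunit
  exact (isUnit_pow_iff (pow_ne_zero _ hp.out.ne_zero)).1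
    (hunit.map (powSaturation K A (p ^ n)).val)

end RootTowerEquiv

section TopLevel

variable {K A L M : Type*} [Field K] [CommRing A] [IsDomain A] [IsDiscreteValuationRing A]
  [Algebra K A] [Field L] [Algebra K L] [Field M] [Algebra (L ⊗[K] A) M]
  [IsFractionRing (L ⊗[K] A) M] {p : ℕ} [hp : Fact p.Prime] [CharP M p] [CharP L p]
  [PerfectRing L p]

instance isDiscreteValuationRing_powSaturation (i : ℕ) :
    IsDiscreteValuationRing (powSaturation K A (p ^ i)) :=
  have ⟨t, ht⟩ := IsDiscreteValuationRing.exists_irreducible A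
  (isDivisionClosed_powSaturation (p ^ i)).isDiscreteValuationRing
    (pow_mem_powSaturation (p ^ i) t) (pow_ne_zero _ ht.ne_zero)
    fun h => ht.not_isUnit ((isUnit_pow_iff (pow_ne_zero i hp.out.ne_zero)).1 h)

variable {n : ℕ} (hres : ∀ a ∈ powSaturation K A (p ^ n), ∃ k : K, ¬IsUnit (a - algebraMap K A k))
include hres

lemma exists_dvd_sub_algebraMap {s : powSaturation K A (p ^ n)} (hs : Irreducible s)
    (a : powSaturation K A (p ^ n)) : ∃ k : K, s ∣ a - algebraMap K _ k := by
  obtain ⟨k, hk⟩ := hres a a.2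
  refine ⟨k, ?_⟩
  rw [← Ideal.mem_span_singleton, ← hs.maximalIdeal_eq, IsLocalRing.mem_maximalIdeal]
  exact fun h => hk (h.map (powSaturation K A (p ^ n)).val)

variable [Algebra.IsAlgebraic K L]

lemma isDiscreteValuationRing_rootTower : IsDiscreteValuationRing (rootTower K A L M p n) := by
  obtain ⟨s, hs⟩ := IsDiscreteValuationRing.exists_irreducible (powSaturation K A (p ^ n))
  have := (rootTowerEquiv K A L M p n).symm.injective.isDomain
  have := isDiscreteValuationRing_tensor (L := L) hs (exists_dvd_sub_algebraMap hres hs)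
  exact IsDiscreteValuationRing.RingEquivClass.isDiscreteValuationRing
    (rootTowerEquiv K A L M p n).symm

lemma exists_dvd_sub_tmul_one [CharP A p] {t : rootTower K A L M p n} (ht : Irreducible t)
    (b : rootTower K A L M p n) :
    ∃ l : L, t ∣ b - ⟨algebraMap (L ⊗[K] A) M (l ⊗ₜ 1), algebraMap_mem_rootTower n _⟩ := by
  obtain ⟨s, hs⟩ := IsDiscreteValuationRing.exists_irreducible (powSaturation K A (p ^ n))
  have hdvd := exists_dvd_sub_algebraMap hres hs
  have := (rootTowerEquiv K A L M p n).symm.injective.isDomain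
  have := isDiscreteValuationRing_tensor (L := L) hs hdvd
  obtain ⟨l, hl⟩ := exists_one_tmul_dvd_sub hdvd (rootTowerEquiv K A L M p n b)
  obtain ⟨r, rfl⟩ := (bijective_iterateFrobenius L p n).surjective l
  refine ⟨r, (map_dvd_iff (rootTowerEquiv K A L M p n)).1 ?_⟩
  have hr : rootTowerEquiv K A L M p n ⟨algebraMap (L ⊗[K] A) M (r ⊗ₜ 1),
      algebraMap_mem_rootTower n _⟩ = iterateFrobenius L p n r ⊗ₜ 1 := by
    rw [rootTowerEquiv_eq_iff, tensorMap_tmul, OneMemClass.coe_one, iterateFrobenius_def,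
      ← map_pow, Algebra.TensorProduct.tmul_pow, one_pow]
  rw [map_sub, hr]
  exact (IsDiscreteValuationRing.associated_of_irreducible _
    ((MulEquiv.irreducible_iff (rootTowerEquiv K A L M p n)).2 ht)
    (irreducible_one_tmul hs hdvd)).dvd.trans hl

end TopLevel

section Conductor

lemma exists_mul_mem_range_of_isIntegral {R M : Type*} [CommRing R] [IsDomain R] [Field M]
    [Algebra R M] [IsFractionRing R M] {t : M} (ht : IsIntegral R t) :
    ∃ d : R, d ≠ 0 ∧ ∀ x ∈ Algebra.adjoin R {t},
      algebraMap R M d * x ∈ (algebraMap R M).range := by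
  obtain ⟨d, hd, h⟩ :=
    FractionalIdeal.isFractional_of_fg (S := nonZeroDivisors R) ht.fg_adjoin_singleton
  exact ⟨d, nonZeroDivisors.ne_zero hd, fun x hx => Algebra.smul_def d x ▸ h x hx⟩

lemma IsPBasis.eq_top_of_pow_mem {B : Type*} [CommRing B] [Nontrivial B] {p : ℕ}
    [hp : Fact p.Prime] [CharP B p] {t : B} (ht : IsPBasis p t) {R : Subring B} (htR : t ∈ R)
    (m : ℕ) (hR : ∀ x : B, x ^ p ^ m ∈ R) : R = ⊤ := by
  induction m with
  | zero => exact eq_top_iff.2 fun x _ => by simpa using hR x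
  | succ m ih =>
    refine ih fun x => ?_
    obtain ⟨c, rfl⟩ := exists_eq_sum_of_frobEval_surjective ht.surjective x
    rw [sum_pow_char_pow]
    refine R.sum_mem fun j _ => ?_
    rw [mul_pow, ← pow_mul, ← pow_succ']
    exact R.mul_mem (hR _) (R.pow_mem (R.pow_mem htR _) _)

variable {K A L M : Type*} [Field K] [CommRing A] [IsDomain A] [Algebra K A] [Field L]
  [Algebra K L] [Field M] [Algebra (L ⊗[K] A) M] {p : ℕ} [hp : Fact p.Prime] [CharP M p]
  {n : ℕ}

lemma pow_mem_range_of_mem_rootTower {x : M} (hx : x ∈ rootTower K A L M p n) :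
    x ^ p ^ n ∈ (algebraMap (L ⊗[K] A) M).range := by
  rw [← tensorRange_top]
  exact tensorRange_mono le_top hx

lemma exists_pow_mul_mem_rootTower_zero [CharP A p] [IsDomain (L ⊗[K] A)]
    [IsFractionRing (L ⊗[K] A) M] [IsDiscreteValuationRing (rootTower K A L M p n)]
    {t : rootTower K A L M p n} (hirr : Irreducible t) (ht : IsPBasis p t) :
    ∃ N : ℕ, ∀ y : rootTower K A L M p n, ((t ^ N * y : rootTower K A L M p n) : M) ∈
      rootTower K A L M p 0 := by
  obtain ⟨u, hu⟩ := pow_mem_range_of_mem_rootTower t.2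
  have hint : IsIntegral (L ⊗[K] A) (t : M) :=
    .of_pow (pow_pos hp.out.pos n) (hu ▸ isIntegral_algebraMap)
  have htop : (Algebra.adjoin (L ⊗[K] A) {(t : M)}).toSubring.comap
      (rootTower K A L M p n).subtype = ⊤ := by
    refine ht.eq_top_of_pow_mem (Algebra.self_mem_adjoin_singleton _ _) n fun x => ?_
    obtain ⟨v, hv⟩ := pow_mem_range_of_mem_rootTower x.2
    change (x : M) ^ p ^ n ∈ Algebra.adjoin (L ⊗[K] A) {(t : M)}
    exact hv ▸ Subalgebra.algebraMap_mem _ v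
  obtain ⟨d, hd0, hd⟩ := exists_mul_mem_range_of_isIntegral hint
  let d' : rootTower K A L M p n := ⟨algebraMap (L ⊗[K] A) M d, algebraMap_mem_rootTower n d⟩
  have hd'0 : d' ≠ 0 := fun h => hd0 (IsFractionRing.injective (L ⊗[K] A) M
    ((congrArg Subtype.val h).trans (map_zero _).symm))
  obtain ⟨N, hN⟩ := IsDiscreteValuationRing.associated_pow_irreducible hd'0 hirr
  obtain ⟨w, hw⟩ := hN.dvd
  refine ⟨N, fun y => ?_⟩
  rw [hw, mul_assoc, rootTower_zero]
  exact hd _ (htop ▸ Subring.mem_top (w * y) : w * y ∈ _)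

end Conductor

section Rank

lemma exists_sum_algebraMap_pow_mul_eq_zero {B M : Type*} [CommRing B] [Nontrivial B] [Field M]
    [Algebra B M] [IsFractionRing B M] {p : ℕ} [hp : Fact p.Prime] [CharP M p]
    (hrank : Module.rank (frobenius M p).range M ≤ p) (x : ℕ → M) :
    ∃ c : ℕ → B, (∃ j < p + 1, c j ≠ 0) ∧
      ∑ j ∈ Finset.range (p + 1), algebraMap B M (c j) ^ p * x j = 0 := by
  obtain ⟨b, hb, ⟨i, hi, hbi⟩, hsum⟩ := rank_le_iff_exists_sum_eq_zero.1 hrank x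
  choose a hab using hb
  simp only [frobenius_def] at hab
  obtain ⟨d, hd⟩ := IsLocalization.exist_integer_multiples (nonZeroDivisors B)
    (Finset.range (p + 1)) a
  choose! c hc using fun j (hj : j ∈ Finset.range (p + 1)) => hd j hj
  simp only [Algebra.smul_def] at hc
  refine ⟨c, ⟨i, hi, fun h => ?_⟩, ?_⟩
  · have hcd := hc i (Finset.mem_range.2 hi)
    rw [h, map_zero, zero_eq_mul] at hcd
    refine hcd.elim (IsFractionRing.to_map_ne_zero_of_mem_nonZeroDivisors d.2) fun ha => hbi ?_
    rw [← hab, ha, zero_pow hp.out.ne_zero]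
  · rw [← mul_zero (algebraMap B M d ^ p), ← hsum, Finset.mul_sum]
    refine Finset.sum_congr rfl fun j hj => ?_
    rw [hc j hj, mul_pow, hab, mul_assoc]

variable {K A L M : Type*} [Field K] [CommRing A] [Algebra K A] [Field L] [Algebra K L] [Field M]
  [Algebra (L ⊗[K] A) M] [IsFractionRing (L ⊗[K] A) M]

lemma sum_dualContract_mul_eq_zero {S : Subalgebra K A} {e : ℕ → L ⊗[K] S} {x : ℕ → A}
    {s : Finset ℕ} (h : ∑ j ∈ s, tensorMap L M S (e j) * algebraMap (L ⊗[K] A) M (1 ⊗ₜ x j) = 0)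
    (φ : Module.Dual K L) : ∑ j ∈ s, ((dualContract φ (e j) : S) : A) * x j = 0 := by
  have hsum : ∑ j ∈ s, Algebra.TensorProduct.map (AlgHom.id K L) S.val (e j) * 1 ⊗ₜ x j = 0 := by
    refine IsFractionRing.injective (L ⊗[K] A) M ?_
    rw [map_sum, map_zero, ← h]
    exact Finset.sum_congr rfl fun j _ => map_mul _ _ _
  rw [← map_zero (dualContract φ), ← hsum, map_sum]
  exact Finset.sum_congr rfl fun j _ => by rw [dualContract_mul, dualContract_map]

variable [IsDomain A] {p : ℕ}

lemma powSaturation_succ_le (i : ℕ) :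
    powSaturation K A (p ^ (i + 1)) ≤ powSaturation K A (p ^ i) := by
  rw [pow_succ]
  exact powSaturation_mul_le _ _

variable [hp : Fact p.Prime] [CharP A p] [CharP M p]

lemma isPBasis_rootTower {n : ℕ} [IsDiscreteValuationRing (rootTower K A L M p n)]
    {t : rootTower K A L M p n} (ht : Irreducible t)
    (hrank : Module.rank (frobenius M p).range M ≤ p) : IsPBasis p t := by
  refine isPBasis_of_rank_le ht (rank_le_iff_exists_sum_eq_zero.2 fun x => ?_)
  obtain ⟨c, ⟨j, hj, hcj⟩, hsum⟩ :=
    exists_sum_algebraMap_pow_mul_eq_zero (B := L ⊗[K] A) hrank fun j => x j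
  let b (j : ℕ) : rootTower K A L M p n := ⟨_, algebraMap_mem_rootTower n (c j)⟩
  refine ⟨fun j => b j ^ p, fun j => ⟨b j, rfl⟩, ⟨j, hj, pow_ne_zero _ fun hb => hcj ?_⟩,
    Subtype.ext ?_⟩
  · exact IsFractionRing.injective (L ⊗[K] A) M
      ((congrArg Subtype.val hb).trans (map_zero _).symm)
  · rw [AddSubmonoidClass.coe_finsetSum]
    exact hsum

variable (K A p) in
/-- `powSaturation K A (p ^ (i + 1))`, as a subring of `powSaturation K A (p ^ i)`. -/
def powSaturationSucc (i : ℕ) : Subring (powSaturation K A (p ^ i)) :=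
  (powSaturation K A (p ^ (i + 1))).toSubring.comap (powSaturation K A (p ^ i)).val.toRingHom

variable [CharP L p] [PerfectRing L p]

variable (L) in
include L in
lemma rank_powSaturationSucc_le (hrank : Module.rank (frobenius M p).range M ≤ p) (i : ℕ) :
    Module.rank (powSaturationSucc K A p i) (powSaturation K A (p ^ i)) ≤ p := by
  refine rank_le_iff_exists_sum_eq_zero.2 fun x => ?_
  choose m _ hmx using fun j => exists_pow_eq_of_mem_tensorRange (M := M)
    (tmul_mem_tensorRange (1 : L) (x j).2)
  obtain ⟨c, ⟨j₀, hj₀, hcj₀⟩, hsum⟩ :=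
    exists_sum_algebraMap_pow_mul_eq_zero (B := L ⊗[K] A) hrank m
  choose e he using fun j => algebraMap_mem_rootTower (M := M) (p := p) (i + 1) (c j)
  have hej₀ : e j₀ ≠ 0 := fun h => by
    have hcj := he j₀
    rw [h, map_zero, eq_comm, map_eq_zero] at hcj
    exact hcj₀ ((map_eq_zero_iff _ (IsFractionRing.injective (L ⊗[K] A) M)).1 hcj)
  obtain ⟨φ, hφ⟩ := exists_dualContract_ne_zero hej₀
  have hpow : ∑ j ∈ Finset.range (p + 1), tensorMap L M (powSaturation K A (p ^ (i + 1))) (e j) *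
      algebraMap (L ⊗[K] A) M (1 ⊗ₜ x j) = 0 := by
    rw [← map_zero (iterateFrobenius M p i), ← hsum, map_sum]
    refine Finset.sum_congr rfl fun j _ => ?_
    rw [he, map_mul, iterateFrobenius_def, iterateFrobenius_def, iterateFrobenius_def, hmx,
      ← pow_mul, pow_succ']
  let d (j : ℕ) : powSaturation K A (p ^ (i + 1)) := dualContract φ (e j)
  refine ⟨fun j => ⟨d j, powSaturation_succ_le i (d j).2⟩, fun j => (d j).2,
    ⟨j₀, hj₀, fun h => hφ (Subtype.ext ?_)⟩, Subtype.ext ?_⟩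
  · have hd := congrArg (powSaturation K A (p ^ i)).val h
    rw [map_zero] at hd
    exact hd.trans (map_zero (powSaturation K A (p ^ (i + 1))).val).symm
  · rw [AddSubmonoidClass.coe_finsetSum]
    exact sum_dualContract_mul_eq_zero hpow φ

end Rank

section TowerStep

section Tensor

variable {K A L M : Type*} [Field K] [CommRing A] [Algebra K A] [Field L] [Algebra K L] [Field M]
  [Algebra (L ⊗[K] A) M] {S T : Subalgebra K A}

lemma exists_eq_add_mul_of_mem_tensorRange {s : A}
    (h : ∀ x ∈ S, ∃ a ∈ T, ∃ c ∈ S, x = a + s * c) {y : M} (hy : y ∈ tensorRange L M S) :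
    ∃ a ∈ tensorRange L M T, ∃ c ∈ tensorRange L M S,
      y = a + algebraMap (L ⊗[K] A) M (1 ⊗ₜ s) * c := by
  obtain ⟨u, rfl⟩ := hy
  induction u with
  | zero => exact ⟨0, zero_mem _, 0, zero_mem _, by simp only [map_zero, mul_zero, add_zero]⟩
  | add x y hx hy =>
    obtain ⟨a, ha, c, hc, hx⟩ := hx
    obtain ⟨a', ha', c', hc', hy⟩ := hy
    exact ⟨a + a', add_mem ha ha', c + c', add_mem hc hc', by rw [map_add, hx, hy]; ring⟩
  | tmul l x =>
    obtain ⟨a, ha, c, hc, hx⟩ := h x x.2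
    refine ⟨_, tmul_mem_tensorRange l ha, _, tmul_mem_tensorRange l hc, ?_⟩
    rw [tensorMap_tmul, hx, ← map_mul, Algebra.TensorProduct.tmul_mul_tmul, ← map_add, one_mul,
      TensorProduct.tmul_add]

lemma exists_eq_sum_of_mem_tensorRange {z : A} {n : ℕ}
    (h : ∀ x ∈ S, ∃ a : ℕ → A, (∀ j, a j ∈ T) ∧ x = ∑ j ∈ Finset.range n, a j * z ^ j) {y : M}
    (hy : y ∈ tensorRange L M S) :
    ∃ a : ℕ → M, (∀ j, a j ∈ tensorRange L M T) ∧
      y = ∑ j ∈ Finset.range n, a j * algebraMap (L ⊗[K] A) M (1 ⊗ₜ z) ^ j := by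
  obtain ⟨u, rfl⟩ := hy
  induction u with
  | zero => exact ⟨0, fun _ => zero_mem _, by simp only [map_zero, Pi.zero_apply, zero_mul,
      Finset.sum_const_zero]⟩
  | add x y hx hy =>
    obtain ⟨a, ha, hx⟩ := hx
    obtain ⟨a', ha', hy⟩ := hy
    exact ⟨a + a', fun j => add_mem (ha j) (ha' j), by
      simp only [map_add, hx, hy, Pi.add_apply, add_mul, Finset.sum_add_distrib]⟩
  | tmul l x =>
    obtain ⟨a, ha, hx⟩ := h x x.2
    refine ⟨fun j => algebraMap (L ⊗[K] A) M (l ⊗ₜ a j), fun j => tmul_mem_tensorRange l (ha j), ?_⟩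
    simp only [tensorMap_tmul, hx, TensorProduct.tmul_sum, map_sum, ← map_pow, ← map_mul,
      Algebra.TensorProduct.tmul_pow, Algebra.TensorProduct.tmul_mul_tmul, one_pow, mul_one]

end Tensor

lemma not_pow_succ_dvd_pow_sub_pow {D : Type*} [CommRing D] [IsDomain D] {t : D} (ht : Prime t)
    {p N : ℕ} (hN : ¬ p ∣ N) (a : D) : ¬ t ^ (N + 1) ∣ t ^ N - a ^ p := by
  intro h
  have ha : t ^ N ∣ a ^ p := (dvd_sub_right dvd_rfl).1 ((pow_dvd_pow t N.le_succ).trans h)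
  have hN' : t ^ (N + 1) ∣ t ^ N :=
    (dvd_sub_left (pow_succ_dvd_pow_of_not_dvd ht a hN ha)).1 h
  exact absurd ((pow_dvd_pow_iff ht.ne_zero ht.not_isUnit).1 hN') (Nat.not_succ_le_self N)

variable {K A L M : Type*} [Field K] [CommRing A] [IsDomain A] [Algebra K A] [Field L]
  [Algebra K L] [Field M] [Algebra (L ⊗[K] A) M] [IsFractionRing (L ⊗[K] A) M] {p : ℕ}
  [hp : Fact p.Prime] [CharP A p] [CharP M p] [CharP L p] [PerfectRing L p] {n i : ℕ}
  (hi : i < n)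
include hi

lemma exists_eq_pow_add_mul_of_dense {s : A} {m : ℕ} (hs : s ∈ powSaturation K A (p ^ (i + 1)))
    (hdense : ∀ x ∈ powSaturation K A (p ^ i), ∃ a ∈ powSaturation K A (p ^ (i + 1)),
      ∃ c ∈ powSaturation K A (p ^ i), x = a + s ^ m * c) :
    ∃ b : rootTower K A L M p n, (b : M) ^ p ^ (i + 1) = algebraMap (L ⊗[K] A) M (1 ⊗ₜ s) ∧
      ∀ x : rootTower K A L M p n, (x : M) ∈ rootTower K A L M p i →
        ∃ a c : rootTower K A L M p n, x = a ^ p + (b ^ p) ^ m * c := by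
  obtain ⟨b, hb, hbs⟩ := exists_pow_eq_of_mem_tensorRange (tmul_mem_tensorRange (M := M) (1 : L) hs)
  refine ⟨⟨b, rootTower_mono hi hb⟩, hbs, fun x hx => ?_⟩
  obtain ⟨_, ha', _, hc', hxac⟩ := exists_eq_add_mul_of_mem_tensorRange hdense (mem_rootTower.1 hx)
  obtain ⟨a, ha, rfl⟩ := exists_pow_eq_of_mem_tensorRange ha'
  obtain ⟨c, hc, rfl⟩ := exists_pow_eq_of_mem_tensorRange hc'
  refine ⟨⟨a, rootTower_mono hi ha⟩, ⟨c, rootTower_mono hi.le hc⟩,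
    Subtype.ext ((iterateFrobenius M p i).injective ?_)⟩
  change (x : M) ^ p ^ i = (a ^ p + (b ^ p) ^ m * c) ^ p ^ i
  have hs : algebraMap (L ⊗[K] A) M (1 ⊗ₜ (s ^ m)) = (b ^ p ^ (i + 1)) ^ m := by
    rw [hbs, ← map_pow, Algebra.TensorProduct.tmul_pow, one_pow]
  rw [hxac, hs, add_pow_char_pow]
  ring

variable [IsDiscreteValuationRing (rootTower K A L M p n)] {t : rootTower K A L M p n}
  (hirr : Irreducible t) (ht : IsPBasis p t)
include hirr ht

lemma exists_forall_powSaturation_ne_add_mul {s : A} (hs : s ∈ powSaturation K A (p ^ (i + 1)))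
    (hsu : ¬ IsUnit s) :
    ∃ m, ∃ x ∈ powSaturation K A (p ^ i), ∀ a ∈ powSaturation K A (p ^ (i + 1)),
      ∀ c ∈ powSaturation K A (p ^ i), x ≠ a + s ^ m * c := by
  by_contra! hdense
  have : IsDomain (L ⊗[K] A) := (IsFractionRing.injective (L ⊗[K] A) M).isDomain
  obtain ⟨N₀, hN₀⟩ := exists_pow_mul_mem_rootTower_zero hirr ht
  obtain ⟨N, hN, hpN⟩ : ∃ N, N₀ ≤ N ∧ ¬ p ∣ N :=
    ⟨N₀ * p + 1, Nat.le_succ_of_le (Nat.le_mul_of_pos_right _ hp.out.pos), fun h =>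
      hp.out.one_lt.ne' (Nat.dvd_one.1 ((Nat.dvd_add_right (dvd_mul_left p N₀)).1 h))⟩
  have htN : ((t ^ N : rootTower K A L M p n) : M) ∈ rootTower K A L M p i := by
    rw [← Nat.add_sub_cancel' hN, pow_add]
    exact rootTower_mono i.zero_le (hN₀ _)
  obtain ⟨b, hbs, hb⟩ := exists_eq_pow_add_mul_of_dense (L := L) (M := M) hi hs (hdense (N + 1))
  obtain ⟨a, c, hac⟩ := hb _ htN
  have htb : t ∣ b := by
    rw [← Ideal.mem_span_singleton, ← hirr.maximalIdeal_eq, IsLocalRing.mem_maximalIdeal]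
    exact fun hbu => hsu (isUnit_of_isUnit_rootTower hi hs hbs hbu)
  refine not_pow_succ_dvd_pow_sub_pow hirr.prime hpN a ?_
  rw [hac, add_sub_cancel_left]
  exact (pow_dvd_pow_of_dvd (htb.trans (dvd_pow_self b hp.out.ne_zero)) _).mul_right c

variable [IsDiscreteValuationRing A] (hrank : Module.rank (frobenius M p).range M ≤ p)
include hrank

lemma exists_powSaturation_generator :
    ∃ z ∈ powSaturation K A (p ^ i), ∀ x ∈ powSaturation K A (p ^ i), ∃ a : ℕ → A,
      (∀ j, a j ∈ powSaturation K A (p ^ (i + 1))) ∧ x = ∑ j ∈ Finset.range p, a j * z ^ j := by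
  let S := powSaturation K A (p ^ i)
  have : CharP S p := (S.val.toRingHom.charP_iff Subtype.val_injective p).2 inferInstance
  have hS : IsDivisionClosed (powSaturationSucc K A p i) := fun y hy hy0 w hw =>
    isDivisionClosed_powSaturation (p ^ (i + 1)) hy (fun h => hy0 (Subtype.ext h)) hw
  have hpow (x : S) : x ^ p ∈ powSaturationSucc K A p i := by
    have hx := pow_mem_powSaturation_mul p 1 x.2
    rwa [← pow_add, pow_one] at hx
  obtain ⟨z, hz⟩ := exists_monogenic_generator hS hpow (rank_powSaturationSucc_le L hrank i)
    fun s hs hsirr => by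
      obtain ⟨m, x, hx, h⟩ := exists_forall_powSaturation_ne_add_mul hi hirr ht hs fun hu =>
        hsirr.not_isUnit ((isDivisionClosed_powSaturation (p ^ i)).isUnit hu)
      exact ⟨m, ⟨x, hx⟩, fun a ha ⟨c, hc⟩ =>
        h a ha c c.2 (sub_eq_iff_eq_add'.1 (congrArg Subtype.val hc))⟩
  refine ⟨z, z.2, fun x hx => ?_⟩
  obtain ⟨a, haS, ha⟩ := hz ⟨x, hx⟩
  refine ⟨fun j => a j, haS, ?_⟩
  simpa only [AddSubmonoidClass.coe_finsetSum, MulMemClass.coe_mul, SubmonoidClass.coe_pow]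
    using congrArg Subtype.val ha

lemma exists_rootTower_eq_pSpan :
    ∃ z : rootTower K A L M p n, (z : M) ∈ rootTower K A L M p i ∧
      {b : rootTower K A L M p n | (b : M) ∈ rootTower K A L M p i} =
        pSpan p z {b : rootTower K A L M p n | (b : M) ∈ rootTower K A L M p (i + 1)} := by
  obtain ⟨ζ, hζ, hgen⟩ := exists_powSaturation_generator hi hirr ht hrank
  obtain ⟨z, hz, hzζ⟩ := exists_pow_eq_of_mem_tensorRange (tmul_mem_tensorRange (M := M) (1 : L) hζ)
  refine ⟨⟨z, rootTower_mono hi.le hz⟩, hz, Set.Subset.antisymm (fun x hx => ?_) ?_⟩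
  · obtain ⟨e, he, hxe⟩ := exists_eq_sum_of_mem_tensorRange hgen (mem_rootTower.1 hx)
    choose w hw hwe using fun j => exists_pow_eq_of_mem_tensorRange (he j)
    refine ⟨fun j => ⟨w j, rootTower_mono hi (hw j)⟩, hw,
      Subtype.ext ((iterateFrobenius M p i).injective ?_)⟩
    rw [AddSubmonoidClass.coe_finsetSum, iterateFrobenius_def, hxe, map_sum]
    refine Finset.sum_congr rfl fun j _ => ?_
    change _ = (w j ^ p * z ^ j) ^ p ^ i
    rw [← hwe, ← hzζ]
    ring
  · rintro _ ⟨w, hw, rfl⟩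
    rw [Set.mem_ofPred_eq, AddSubmonoidClass.coe_finsetSum]
    exact sum_mem fun j _ => mul_mem (pow_mem_rootTower (hw j)) (pow_mem hz j)

end TowerStep

section ConductorTower

variable {B : Type*} [CommRing B] [IsDomain B] [IsDiscreteValuationRing B] {p : ℕ}
  [hp : Fact p.Prime] [CharP B p] {t : B}

/-- In a tower of subsets in which each one is the `p`-span over the next of the powers of a single
element `z`, each step contributes the order of vanishing of `dz / dt` to the conductor. -/
theorem IsPBasis.exists_conductor_tower (ht : IsPBasis p t) (hirr : Irreducible t) {N n : ℕ}
    {W : ℕ → Set B} (hW : ∀ i < n, ∃ z ∈ W i, W i = pSpan p z (W (i + 1))) (hmono : Monotone W)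
    (htop : W n = Set.univ) (hN : ∀ y, t ^ N * y ∈ W 0) : ∃ k : ℕ → ℕ,
      (∀ i < n, ∃ z ∈ W i, ∃ v : Bˣ, ht.deriv z = v * t ^ k i ∧
        ∀ x ∈ W i, ht.deriv z ∣ ht.deriv x) ∧
      ∀ m, (∀ y, t ^ m * y ∈ W 0) ↔ ∑ i ∈ Finset.range n, (p - 1) * k i * p ^ i ≤ m := by
  induction n generalizing W with
  | zero => exact ⟨0, by simp, by simp [htop]⟩
  | succ n ih =>
    obtain ⟨z, hz, hW₀⟩ := hW 0 n.succ_pos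
    obtain ⟨e, v, hv⟩ := IsDiscreteValuationRing.eq_unit_mul_pow_irreducible
      (ht.deriv_ne_zero fun y => hW₀ ▸ hN y) hirr
    obtain ⟨k, hk, hcond⟩ := ih (W := fun i => W (i + 1))
      (fun i hi => hW (i + 1) (Nat.succ_lt_succ hi)) (fun _ _ h => hmono (Nat.succ_le_succ h))
      htop fun y => hmono (Nat.zero_le 1) (hN y)
    refine ⟨fun | 0 => e | i + 1 => k i, ?_, fun m => ?_⟩
    · rintro (_ | i) hi
      · exact ⟨z, hz, v, hv, fun x hx => ht.deriv_dvd_deriv_of_mem_pSpan (hW₀ ▸ hx)⟩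
      · exact hk i (Nat.lt_of_succ_lt_succ hi)
    · have hsum : ∑ i ∈ Finset.range n, (p - 1) * k i * p ^ (i + 1) =
          p * ∑ i ∈ Finset.range n, (p - 1) * k i * p ^ i := by
        rw [Finset.mul_sum]
        exact Finset.sum_congr rfl fun i _ => by ring
      rw [Finset.sum_range_succ', hsum, pow_zero, mul_one, add_comm, hW₀]
      exact ht.pow_mul_mem_pSpan_iff_le (fun y => hW₀ ▸ hN y) hv hirr.not_isUnit hcond m

end ConductorTower

section Normalized

lemma exists_normalized_ringEquiv {A B : Type*} [CommRing A] [CommRing B] [IsDomain B]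
    [IsIntegrallyClosed B] {g : A →+* B} (hg : Function.Injective g) (hint : g.IsIntegral) {c : B}
    (hc₀ : c ≠ 0) (hc : ∀ b, c * b ∈ g.range) :
    ∃ e : B ≃+* Normalized A, ∀ a, e (g a) = algebraMap A (Normalized A) a := by
  algebraize [g, (algebraMap B (FractionRing B)).comp g]
  let M := FractionRing B
  have : IsScalarTower A B M := .of_algebraMap_eq' rfl
  have hcM : algebraMap B M c ≠ 0 := (IsFractionRing.injective B M).ne_iff' (map_zero _) |>.2 hc₀
  have : FaithfulSMul A M := (faithfulSMul_iff_algebraMap_injective A M).2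
    ((IsFractionRing.injective B M).comp hg)
  have : IsFractionRing A M := IsFractionRing.of_field A M fun m => by
    obtain ⟨x, y, -, rfl⟩ := IsFractionRing.div_surjective (A := B) m
    obtain ⟨a, ha⟩ := hc x
    obtain ⟨b, hb⟩ := hc y
    refine ⟨a, b, ?_⟩
    rw [IsScalarTower.algebraMap_apply A B M, IsScalarTower.algebraMap_apply A B M]
    change _ = algebraMap B M (g a) / algebraMap B M (g b)
    rw [ha, hb, map_mul, map_mul, mul_div_mul_left _ _ hcM]
  have : Algebra.IsIntegral A B := ⟨hint⟩
  have : IsIntegralClosure B A M := .of_isIntegrallyClosed B A M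
  let e : B ≃ₐ[A] Normalized A := (IsIntegralClosure.equiv A B M (integralClosure A M)).trans
    (FractionRing.algEquiv A M).symm.mapIntegralClosure
  exact ⟨e, e.commutes⟩

variable {A B : Type*} [CommRing A] [CommRing B] [IsDomain B]
  [IsDiscreteValuationRing B] {g : A →+* B} {e : B ≃+* Normalized A}
  (he : ∀ a, e (g a) = algebraMap A (Normalized A) a) {t : B} (ht : Irreducible t)
include he ht

lemma mem_valueSemigroup_iff [IsDomain A] (l : ℕ) :
    l ∈ valueSemigroup A ↔ ∃ x : A, ∃ v : Bˣ, g x = v * t ^ l := by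
  have hdvr : IsDiscreteValuationRing (Normalized A) :=
    IsDiscreteValuationRing.RingEquivClass.isDiscreteValuationRing e
  have het : Irreducible (e t) := (MulEquiv.irreducible_iff e).2 ht
  constructor
  · rintro ⟨_, _, x, hx⟩
    have hx₀ : algebraMap A (Normalized A) x ≠ 0 := by
      intro h
      rw [h, IsDiscreteValuationRing.addVal_zero] at hx
      exact ENat.natCast_ne_top l hx.symm
    obtain ⟨n, v, hv⟩ := IsDiscreteValuationRing.eq_unit_mul_pow_irreducible hx₀ het
    rw [IsDiscreteValuationRing.addVal_def _ v het n hv, Nat.cast_inj] at hx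
    subst hx
    refine ⟨x, Units.map (e.symm : Normalized A →* B) v, e.injective ?_⟩
    rw [he, hv, map_mul, map_pow]
    exact congrArg (· * e t ^ n) (e.apply_symm_apply _).symm
  · rintro ⟨x, v, hv⟩
    refine ⟨inferInstance, hdvr, x, ?_⟩
    refine IsDiscreteValuationRing.addVal_def _ (Units.map (e : B →* Normalized A) v) het l ?_
    rw [← he, hv, map_mul, map_pow]
    rfl

variable {c : ℕ} (hc : ∀ m, (∀ y, t ^ m * y ∈ g.range) ↔ c ≤ m)
include hc

lemma mem_valueSemigroup_of_le [IsDomain A] {l : ℕ} (hl : c ≤ l) : l ∈ valueSemigroup A := by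
  obtain ⟨x, hx⟩ := (hc l).2 hl 1
  exact (mem_valueSemigroup_iff he ht l).2 ⟨x, 1, by rw [hx, mul_one, Units.val_one, one_mul]⟩

variable {L : Type*} [Field L] [Algebra L A] (hL : ∀ b, ∃ l : L, t ∣ b - g (algebraMap L A l))
include hL

/-- An element of value `c - 1` in the range of `g` would put all of `t ^ (c - 1) * B` there,
one residue class at a time. -/
lemma sub_one_notMem_valueSemigroup [IsDomain A] (hc₀ : 0 < c) : c - 1 ∉ valueSemigroup A := by
  intro hmem
  obtain ⟨x, v, hv⟩ := (mem_valueSemigroup_iff he ht _).1 hmem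
  suffices hle : c ≤ c - 1 by omega
  refine (hc _).1 fun y => ?_
  obtain ⟨l, d, hd⟩ := hL (↑v⁻¹ * y)
  have hy : y = v * g (algebraMap L A l) + v * (t * d) := by
    rw [← mul_add, ← hd, add_sub_cancel, Units.mul_inv_cancel_left]
  have hsplit : t ^ (c - 1) * y = g (x * algebraMap L A l) + t ^ c * (v * d) := by
    rw [hy, map_mul, hv, ← Nat.sub_add_cancel hc₀, Nat.add_sub_cancel, pow_succ]
    ring
  rw [hsplit]
  exact add_mem ⟨_, rfl⟩ ((hc c).2 le_rfl _)

lemma setConductor_valueSemigroup [IsDomain A] : setConductor (valueSemigroup A) = c := by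
  have hle : ∀ b ∈ {b | 0 < b ∧ b ∈ valueSemigroup A ∧ b - 1 ∉ valueSemigroup A}, b ≤ c := by
    rintro b ⟨hb, -, hgap⟩
    by_contra! hlt
    exact hgap (mem_valueSemigroup_of_le he ht hc (by omega))
  rcases c.eq_zero_or_pos with rfl | hc₀
  · exact (congrArg sSup (Set.eq_empty_of_forall_notMem fun b hb =>
      hb.1.ne' (Nat.le_zero.1 (hle b hb)))).trans csSup_empty
  · exact IsGreatest.csSup_eq ⟨⟨hc₀, mem_valueSemigroup_of_le he ht hc le_rfl,
      sub_one_notMem_valueSemigroup he ht hc hL hc₀⟩, hle⟩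

end Normalized

section Coker

/-- The cokernel of `N ⊗ Ω[A⁄L] → Ω[N⁄L]` is `Ω[N⁄A]`. -/
def mapBaseChangeCokerEquiv (L A N : Type*) [CommRing L] [CommRing A] [CommRing N]
    [Algebra L A] [Algebra L N] [Algebra A N] [IsScalarTower L A N] :
    (Ω[N⁄L] ⧸ LinearMap.range (KaehlerDifferential.mapBaseChange L A N)) ≃ₗ[N] Ω[N⁄A] :=
  (KaehlerDifferential.exact_mapBaseChange_map L A N).linearEquivOfSurjective
    (KaehlerDifferential.map_surjective L A N)

lemma nonempty_kaehlerDifferential_equiv {A B N : Type*} [CommRing A] [CommRing B] [CommRing N]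
    [Algebra A B] [Algebra A N] (e : B ≃ₐ[A] N) : Nonempty (Ω[N⁄A] ≃ₗ[A] Ω[B⁄A]) := by
  let := e.toRingHom.toAlgebra
  have : IsScalarTower A B N := .of_algebraMap_eq fun a => (e.commutes a).symm
  have hbij : Function.Bijective (KaehlerDifferential.map A A B N) := by
    refine ⟨?_, KaehlerDifferential.map_surjective_of_surjective A A B N e.surjective⟩
    rw [← LinearMap.ker_eq_bot, KaehlerDifferential.ker_map_of_surjective A B N e.surjective,
      LinearMap.ker_eq_bot.2, Submodule.map_bot]
    exact (Finsupp.mapRange_injective _ (map_zero e) e.injective).comp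
      (Finsupp.mapDomain_injective e.injective)
  exact ⟨(LinearEquiv.ofBijective _ hbij).symm.restrictScalars A⟩

lemma finrank_alphaCoker {L A B : Type u} [Field L] [CommRing A] [Algebra L A]
    [CommRing B] [IsDomain B] {g : A →+* B} {e : B ≃+* Normalized A}
    (he : ∀ a, e (g a) = algebraMap A (Normalized A) a) {p : ℕ} [hp : Fact p.Prime] [CharP B p]
    {t : B} (ht : IsPBasis p t) (htu : ¬IsUnit t) (hL : ∀ b, ∃ l : L, t ∣ b - g (algebraMap L A l))
    {z : B} (hz : z ∈ g.range) (hdvd : ∀ x ∈ g.range, ht.deriv z ∣ ht.deriv x) {k : ℕ} {v : Bˣ}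
    (hk : ht.deriv z = v * t ^ k) :
    Module.Finite L (AlphaCoker L A) ∧ Module.finrank L (AlphaCoker L A) = k := by
  algebraize [g, g.comp (algebraMap L A)]
  let e' : B ≃ₐ[A] Normalized A := AlgEquiv.ofRingEquiv he
  have hideal : ht.derivIdeal A = Ideal.span {t ^ k} := by
    rw [← Ideal.span_singleton_mul_left_unit v.isUnit, ← hk]
    refine le_antisymm (Ideal.span_le.2 ?_) (Ideal.span_le.2 ?_)
    · rintro _ ⟨a, rfl⟩
      exact Ideal.mem_span_singleton.2 (hdvd _ ⟨a, rfl⟩)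
    · obtain ⟨a, rfl⟩ := hz
      exact Set.singleton_subset_iff.2 (Ideal.subset_span ⟨a, rfl⟩)
  obtain ⟨φ⟩ := nonempty_kaehlerDifferential_equiv e'
  let ψ : AlphaCoker L A ≃ₗ[L] B ⧸ Ideal.span {t ^ k} :=
    ((mapBaseChangeCokerEquiv L A (Normalized A)).restrictScalars L).trans
      ((φ.restrictScalars L).trans (((ht.kaehlerEquiv A).restrictScalars L).trans
        ((Submodule.quotEquivOfEq _ _ hideal).restrictScalars L)))
  have := finite_quotient_span_pow ht.ne_zero htu hL k
  exact ⟨Module.Finite.equiv ψ.symm,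
    ψ.finrank_eq.trans (finrank_quotient_span_pow ht.ne_zero htu hL k)⟩

end Coker

section Inclusion

variable {M X : Type*} [CommRing M] [CommRing X] {S T : Subring M}

/-- An isomorphism with a subring `S` of `T`, seen as an embedding into `T`. -/
def toLargerSubring (h : S ≤ T) (e : X ≃+* S) : X →+* T :=
  (Subring.inclusion h).comp e.toRingHom

lemma toLargerSubring_injective (h : S ≤ T) (e : X ≃+* S) :
    Function.Injective (toLargerSubring h e) :=
  (Subring.inclusion_injective h).comp e.injective

lemma mem_range_toLargerSubring (h : S ≤ T) (e : X ≃+* S) {b : T} :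
    b ∈ (toLargerSubring h e).range ↔ (b : M) ∈ S := by
  constructor
  · rintro ⟨u, rfl⟩
    exact (e u).2
  · intro hb
    obtain ⟨u, hu⟩ := e.surjective ⟨b, hb⟩
    exact ⟨u, Subtype.ext (congrArg (Subtype.val : S → M) hu)⟩

lemma toLargerSubring_eq (h : S ≤ T) (e : X ≃+* S) {x : X} {m : M} {hm : m ∈ S}
    (hx : e x = ⟨m, hm⟩) : toLargerSubring h e x = ⟨m, h hm⟩ :=
  Subtype.ext (congrArg (Subtype.val : S → M) hx)

end Inclusion

section Level

variable {K A L : Type*} (M : Type*) [Field K] [CommRing A] [IsDomain A] [Algebra K A] {p : ℕ}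
  [hp : Fact p.Prime] [Field L] [Algebra K L] [Field M] [Algebra (L ⊗[K] A) M]
  [IsFractionRing (L ⊗[K] A) M] [CharP M p] [CharP L p] [PerfectRing L p] [CharP A p] {n i : ℕ}
  (hi : i ≤ n) {R : Type*} [CommRing R] [Algebra K R] (e : R ≃ₐ[K] powSaturation K A (p ^ i))

variable (L) in
/-- The isomorphism given by `p ^ i`-th roots of `L ⊗ R` with the `i`-th ring of the tower, for a
`K`-algebra `R` isomorphic to `powSaturation K A (p ^ i)`. -/
def levelEquiv : L ⊗[K] R ≃+* rootTower K A L M p i :=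
  (Algebra.TensorProduct.congr (AlgEquiv.refl (R := L)) e).toRingEquiv.trans
    (rootTowerEquiv K A L M p i).symm

lemma levelEquiv_pow_tmul_one (l : L) : levelEquiv L M e ((l ^ p ^ i) ⊗ₜ 1) =
    ⟨algebraMap (L ⊗[K] A) M (l ⊗ₜ 1), algebraMap_mem_rootTower i _⟩ := by
  have hone : Algebra.TensorProduct.congr (AlgEquiv.refl (R := L)) e ((l ^ p ^ i) ⊗ₜ[K] 1) =
      (l ^ p ^ i) ⊗ₜ 1 := by
    rw [Algebra.TensorProduct.congr_apply, Algebra.TensorProduct.map_tmul]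
    exact congrArg _ (map_one e)
  refine (congrArg (rootTowerEquiv K A L M p i).symm hone).trans ?_
  rw [RingEquiv.symm_apply_eq, eq_comm, rootTowerEquiv_eq_iff, tensorMap_tmul,
    OneMemClass.coe_one, ← map_pow, Algebra.TensorProduct.tmul_pow, one_pow]

variable (L) in
/-- The embedding of `L ⊗ R` into the top of the tower. -/
def levelHom : L ⊗[K] R →+* rootTower K A L M p n :=
  toLargerSubring (rootTower_mono hi) (levelEquiv L M e)

lemma levelHom_injective : Function.Injective (levelHom L M hi e) :=
  toLargerSubring_injective _ _

lemma mem_range_levelHom {b : rootTower K A L M p n} :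
    b ∈ (levelHom L M hi e).range ↔ (b : M) ∈ rootTower K A L M p i :=
  mem_range_toLargerSubring _ _

lemma levelHom_pow_tmul_one (l : L) : levelHom L M hi e ((l ^ p ^ i) ⊗ₜ 1) =
    ⟨algebraMap (L ⊗[K] A) M (l ⊗ₜ 1), algebraMap_mem_rootTower n _⟩ :=
  toLargerSubring_eq (rootTower_mono hi) _ (levelEquiv_pow_tmul_one M e l)

lemma isIntegral_levelHom : (levelHom L M hi e).IsIntegral := by
  intro b
  obtain ⟨u, hu⟩ := pow_mem_range_of_mem_rootTower b.2
  obtain ⟨a, ha⟩ : b ^ p ^ n ∈ (levelHom L M hi e).range := by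
    rw [mem_range_levelHom, SubmonoidClass.coe_pow, ← hu]
    exact algebraMap_mem_rootTower i u
  let := (levelHom L M hi e).toAlgebra
  exact IsIntegral.of_pow (R := L ⊗[K] R) (pow_pos hp.out.pos n) (ha ▸ isIntegral_algebraMap)

variable (L) in
lemma exists_normalized_levelHom [IsDomain (L ⊗[K] A)]
    [IsDiscreteValuationRing (rootTower K A L M p n)]
    {t : rootTower K A L M p n} (hirr : Irreducible t) (ht : IsPBasis p t) :
    ∃ E : rootTower K A L M p n ≃+* Normalized (L ⊗[K] R),
      ∀ u, E (levelHom L M hi e u) = algebraMap (L ⊗[K] R) _ u := by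
  obtain ⟨N, hN⟩ := exists_pow_mul_mem_rootTower_zero hirr ht
  exact exists_normalized_ringEquiv (levelHom_injective M hi e) (isIntegral_levelHom M hi e)
    (pow_ne_zero N hirr.ne_zero)
    fun y => (mem_range_levelHom M hi e).2 (rootTower_mono (Nat.zero_le i) (hN y))

variable [IsDiscreteValuationRing A] [Algebra.IsAlgebraic K L]

lemma exists_dvd_sub_levelHom
    (hres : ∀ a ∈ powSaturation K A (p ^ n), ∃ k : K, ¬IsUnit (a - algebraMap K A k))
    {t : rootTower K A L M p n} (ht : Irreducible t) (b : rootTower K A L M p n) :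
    ∃ l : L, t ∣ b - levelHom L M hi e (algebraMap L (L ⊗[K] R) l) := by
  obtain ⟨l, hl⟩ := exists_dvd_sub_tmul_one hres ht b
  refine ⟨l ^ p ^ i, ?_⟩
  rwa [Algebra.TensorProduct.algebraMap_apply, Algebra.algebraMap_self_apply,
    levelHom_pow_tmul_one]

end Level

theorem conductor_formula {p : ℕ} [hp : Fact p.Prime] {K A L : Type u} (M : Type u) [Field K]
    [CommRing A] [IsDomain A] [IsDiscreteValuationRing A] [Algebra K A] [Field L] [Algebra K L]
    [Algebra.IsAlgebraic K L]
    [IsDomain (L ⊗[K] A)] [Field M] [Algebra (L ⊗[K] A) M] [IsFractionRing (L ⊗[K] A) M]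
    [CharP A p] [CharP L p] [PerfectRing L p] [CharP M p]
    (hrank : Module.rank (frobenius M p).range M ≤ p) (n : ℕ)
    (hres : ∀ a ∈ powSaturation K A (p ^ n), ∃ k : K, ¬IsUnit (a - algebraMap K A k))
    {R : ℕ → Type u} [∀ i, CommRing (R i)] [∀ i, Algebra K (R i)]
    (e : ∀ i, R i ≃ₐ[K] powSaturation K A (p ^ i)) :
    (∃ c : ℕ, ∀ l, c ≤ l → l ∈ valueSemigroup (L ⊗[K] A)) ∧
    (∀ i < n, Module.Finite L (AlphaCoker L (L ⊗[K] R i))) ∧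
    setConductor (valueSemigroup (L ⊗[K] A)) = ∑ i ∈ Finset.range n,
      (p - 1) * Module.finrank L (AlphaCoker L (L ⊗[K] R i)) * p ^ i := by
  have hdvr : IsDiscreteValuationRing (rootTower K A L M p n) :=
    isDiscreteValuationRing_rootTower (L := L) hres
  obtain ⟨t, ht⟩ := IsDiscreteValuationRing.exists_irreducible (rootTower K A L M p n)
  have hbasis : IsPBasis p t := isPBasis_rootTower ht hrank
  obtain ⟨N, hN⟩ := exists_pow_mul_mem_rootTower_zero ht hbasis
  obtain ⟨k, hk, hcond⟩ := hbasis.exists_conductor_tower ht (N := N) (n := n)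
    (W := fun i => {b : rootTower K A L M p n | (b : M) ∈ rootTower K A L M p i})
    (fun i hi => exists_rootTower_eq_pSpan hi ht hbasis hrank)
    (fun i j hij b hb => rootTower_mono hij hb) (Set.eq_univ_of_forall fun b => b.2) hN
  have hcoker : ∀ i < n, Module.Finite L (AlphaCoker L (L ⊗[K] R i)) ∧
      Module.finrank L (AlphaCoker L (L ⊗[K] R i)) = k i := by
    intro i hi
    obtain ⟨E, hE⟩ := exists_normalized_levelHom L M hi.le (e i) ht hbasis
    obtain ⟨z, hz, v, hzv, hdvd⟩ := hk i hi
    exact finrank_alphaCoker hE hbasis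
      ht.not_isUnit (exists_dvd_sub_levelHom M hi.le (e i) hres ht)
      ((mem_range_levelHom M hi.le (e i)).2 hz)
      (fun x hx => hdvd x ((mem_range_levelHom M hi.le (e i)).1 hx)) hzv
  let e₀ : A ≃ₐ[K] powSaturation K A (p ^ 0) := Subalgebra.topEquiv.symm.trans
    (Subalgebra.equivOfEq _ _ (by rw [pow_zero, powSaturation_one]))
  obtain ⟨E, hE⟩ := exists_normalized_levelHom L M n.zero_le e₀ ht hbasis
  have hc (m : ℕ) : (∀ y, t ^ m * y ∈ (levelHom L M n.zero_le e₀).range) ↔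
      ∑ i ∈ Finset.range n, (p - 1) * k i * p ^ i ≤ m :=
    (forall_congr' fun y => mem_range_levelHom M n.zero_le e₀).trans (hcond m)
  refine ⟨⟨_, fun l => mem_valueSemigroup_of_le hE ht hc⟩, fun i hi => (hcoker i hi).1,
    (setConductor_valueSemigroup hE ht hc (exists_dvd_sub_levelHom M n.zero_le e₀ hres ht)).trans
      (Finset.sum_congr rfl fun i hi => ?_)⟩
  rw [(hcoker i (Finset.mem_range.1 hi)).2]

lemma krullDimLE_one_of_injective_isIntegral {R S : Type*} [CommRing R] [IsDomain R] [CommRing S]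
    [IsDomain S] [Ring.KrullDimLE 1 S] {g : R →+* S} (hg : Function.Injective g)
    (hint : g.IsIntegral) : Ring.KrullDimLE 1 R := by
  let := g.toAlgebra
  have : Algebra.IsIntegral R S := ⟨hint⟩
  rw [Ring.krullDimLE_one_iff_of_noZeroDivisors]
  intro I hI0 hI
  obtain ⟨Q, -, hQ, rfl⟩ := Ideal.exists_ideal_over_prime_of_isIntegral (S := S) I ⊥
    ((Ideal.comap_bot_of_injective (algebraMap R S) hg).le.trans bot_le)
  have := hQ.isMaximal_of_ne_bot fun h =>
    hI0 (h ▸ Ideal.comap_bot_of_injective (algebraMap R S) hg)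
  exact Ideal.isMaximal_comap_of_isIntegral_of_isMaximal Q

lemma exists_range_le_adjoin_singleton {K R : Type*} [CommRing K] [CommRing R] [Algebra K R]
    {s : ℕ} (hs : s ≤ 1) (g : MvPolynomial (Fin s) K →ₐ[K] R) :
    ∃ x : R, g.range ≤ Algebra.adjoin K {x} := by
  have : Subsingleton (Fin s) := Fin.subsingleton_iff_le_one.2 hs
  have hrange : g.range = Algebra.adjoin K (Set.range fun i => g (MvPolynomial.X i)) := by
    rw [← Algebra.map_top, ← MvPolynomial.adjoin_range_X, AlgHom.map_adjoin, ← Set.range_comp]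
    rfl
  obtain h | ⟨x, hx⟩ := (Set.subsingleton_range
    (fun i => g (MvPolynomial.X i) : Fin s → R)).eq_empty_or_singleton
  · exact ⟨0, hrange.trans_le (Algebra.adjoin_mono (h ▸ Set.empty_subset _))⟩
  · exact ⟨x, (hrange.trans (congrArg _ hx)).le⟩

lemma exists_isIntegral_adjoin_singleton (K R : Type*) [Field K] [CommRing R] [IsDomain R]
    [Algebra K R] [Algebra.FiniteType K R] [Ring.KrullDimLE 1 R] :
    ∃ x : R, Algebra.IsIntegral (Algebra.adjoin K {x}) R := by
  obtain ⟨s, g, hinj, hint⟩ := exists_integral_inj_algHom_of_fg K R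
  have hdim := krullDimLE_one_of_injective_isIntegral (g := g.toRingHom) hinj hint
  rw [Ring.krullDimLE_iff, MvPolynomial.ringKrullDim_of_isNoetherianRing,
    ringKrullDim_eq_zero_of_field, zero_add] at hdim
  obtain ⟨x, hx⟩ := exists_range_le_adjoin_singleton (by simpa using hdim) g
  refine ⟨x, ⟨fun r => ?_⟩⟩
  obtain ⟨q, hq, hr⟩ := hint r
  let h : MvPolynomial (Fin s) K →+* Algebra.adjoin K {x} :=
    (Subalgebra.inclusion hx).toRingHom.comp g.rangeRestrict.toRingHom
  exact ⟨q.map h, hq.map h, by rw [Polynomial.eval₂_map]; exact hr⟩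

section Rank

variable {L M : Type*} [Field L] [Field M] [Algebra L M] {p : ℕ} [hp : Fact p.Prime] [CharP M p]

lemma adjoin_fieldRange_frobenius_eq_top [CharP L p] [PerfectRing L p] (x : M)
    [Algebra.IsSeparable (IntermediateField.adjoin L {x}) M] :
    IntermediateField.adjoin (frobenius M p).fieldRange {x} = ⊤ := by
  let E := IntermediateField.adjoin (frobenius M p).fieldRange {x}
  have hpow (y : M) : y ^ p ∈ E :=
    IntermediateField.algebraMap_mem E (⟨_, y, rfl⟩ : (frobenius M p).fieldRange)
  have hle : (IntermediateField.adjoin L {x}).toSubfield ≤ E.toSubfield := by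
    refine IntermediateField.adjoin_le_subfield _ _ ?_ (IntermediateField.subset_adjoin _ _)
    rintro _ ⟨l, rfl⟩
    obtain ⟨k, rfl⟩ := surjective_frobenius L p l
    rw [frobenius_def, map_pow]
    exact hpow _
  let := (Subfield.inclusion hle).toAlgebra
  have : IsScalarTower (IntermediateField.adjoin L {x}) E M := IsScalarTower.of_algebraMap_eq' rfl
  have : Algebra.IsSeparable E M := Algebra.isSeparable_tower_top_of_isSeparable
    (IntermediateField.adjoin L {x}) E M
  have : ExpChar E p := ExpChar.prime hp.out
  have : IsPurelyInseparable E M := (isPurelyInseparable_iff_pow_mem E p).2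
    fun y => ⟨1, ⟨y ^ p, hpow y⟩, by rw [pow_one]; rfl⟩
  refine eq_top_iff.2 fun y _ => ?_
  obtain ⟨z, rfl⟩ := IsPurelyInseparable.surjective_algebraMap_of_isSeparable E M y
  exact z.2

lemma rank_fieldRange_frobenius_le [CharP L p] [PerfectRing L p] (x : M)
    [Algebra.IsSeparable (IntermediateField.adjoin L {x}) M] :
    Module.rank (frobenius M p).range M ≤ p := by
  let F := (frobenius M p).fieldRange
  let c : F := ⟨x ^ p, x, rfl⟩
  have hroot : Polynomial.aeval x (Polynomial.X ^ p - Polynomial.C c) = 0 := by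
    rw [map_sub, map_pow, Polynomial.aeval_X, Polynomial.aeval_C]
    exact sub_self _
  have hmonic := Polynomial.monic_X_pow_sub_C c hp.out.ne_zero
  have hx : IsIntegral F x := ⟨_, hmonic, hroot⟩
  have hdeg : (minpoly F x).natDegree ≤ p :=
    (Polynomial.natDegree_le_natDegree (minpoly.min F x hmonic hroot)).trans_eq
      Polynomial.natDegree_X_pow_sub_C
  have hrank := IntermediateField.rank_top' (F := F) (E := M)
  rw [← adjoin_fieldRange_frobenius_eq_top (L := L) x] at hrank
  have := IntermediateField.adjoin.finiteDimensional hx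
  have hle : Module.rank F M ≤ p := by
    rw [← hrank, ← Module.finrank_eq_rank, IntermediateField.adjoin.finrank hx]
    exact_mod_cast hdeg
  exact hle

end Rank

section SeparableGenerator

variable {L M : Type*} [Field L] [Field M] [Algebra L M]

lemma trdeg_le_one {x : M} [Algebra.IsAlgebraic (IntermediateField.adjoin L {x}) M] :
    Algebra.trdeg L M ≤ 1 := by
  have : Algebra.IsAlgebraic (Algebra.adjoin L {x}) M :=
    IntermediateField.isAlgebraic_adjoin_iff_top.1 ‹_›
  exact (Algebra.IsAlgebraic.trdeg_le_cardinalMk L {x}).trans_eq (Cardinal.mk_singleton x)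

lemma exists_isSeparable_adjoin_singleton [PerfectField L] [Algebra.EssFiniteType L M]
    (htr : Algebra.trdeg L M ≤ 1) :
    ∃ y : M, Algebra.IsSeparable (IntermediateField.adjoin L {y}) M := by
  obtain ⟨s, hs, hsep⟩ := exists_isTranscendenceBasis_and_isSeparable_of_perfectField L M
  have hcard : s.card ≤ 1 := by
    have := hs.cardinalMk_eq_trdeg.trans_le htr
    simpa using this
  rcases Finset.card_le_one_iff_subset_singleton.1 hcard with ⟨y, hy⟩
  rcases Finset.subset_singleton_iff.1 hy with rfl | rfl
  · rw [Finset.coe_empty, IntermediateField.adjoin_empty, ← IntermediateField.adjoin_zero] at hsep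
    exact ⟨0, hsep⟩
  · rw [Finset.coe_singleton] at hsep
    exact ⟨y, hsep⟩

end SeparableGenerator

section FunctionField

variable (K : Type*) {L M : Type*} {R : Type*} [Field K] [Field L] [Field M] [CommRing R]
  [Algebra K L] [Algebra K R] [Algebra K M] [Algebra L M] [Algebra R M] [IsScalarTower K L M]
  [IsScalarTower K R M] [Algebra.FiniteType K R]
include K

lemma fg_adjoin_range_algebraMap :
    (IntermediateField.adjoin L (Set.range (algebraMap R M))).FG := by
  classical
  obtain ⟨S, hS⟩ := Algebra.FiniteType.out (R := K) (A := R)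
  refine ⟨S.image (algebraMap R M), le_antisymm (IntermediateField.adjoin.mono _ _ _ ?_) ?_⟩
  · rw [Finset.coe_image]
    exact Set.image_subset_range _ _
  · rw [IntermediateField.adjoin_le_iff]
    rintro _ ⟨r, rfl⟩
    have hle : Algebra.adjoin K (S : Set R) ≤ ((IntermediateField.adjoin L
        ((S.image (algebraMap R M) : Finset M) : Set M)).restrictScalars K).toSubalgebra.comap
        (IsScalarTower.toAlgHom K R M) := Algebra.adjoin_le fun r hr =>
      IntermediateField.subset_adjoin _ _ (Finset.mem_coe.2 (Finset.mem_image_of_mem _ hr))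
    exact hle (hS ▸ Algebra.mem_top)

variable [IsDomain R] [Ring.KrullDimLE 1 R]

lemma exists_isAlgebraic_adjoin_singleton
    (hgen : IntermediateField.adjoin L (Set.range (algebraMap R M)) = ⊤) :
    ∃ x : M, Algebra.IsAlgebraic (IntermediateField.adjoin L {x}) M := by
  obtain ⟨z, hz⟩ := exists_isIntegral_adjoin_singleton K R
  let E := IntermediateField.adjoin L {algebraMap R M z}
  have hle : Algebra.adjoin K {z} ≤
      (E.restrictScalars K).toSubalgebra.comap (IsScalarTower.toAlgHom K R M) :=
    Algebra.adjoin_le (Set.singleton_subset_iff.2 (IntermediateField.mem_adjoin_simple_self L _))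
  let φ : Algebra.adjoin K {z} →+* E :=
    ((algebraMap R M).comp (Algebra.adjoin K {z}).val.toRingHom).codRestrict E fun r => hle r.2
  have hint : ∀ m ∈ Set.range (algebraMap R M), IsIntegral E m := by
    rintro _ ⟨r, rfl⟩
    exact (hz.isIntegral r).map_of_comp_eq φ (algebraMap R M) rfl
  have htop : IntermediateField.adjoin E (Set.range (algebraMap R M)) = ⊤ := by
    have hsub : IntermediateField.adjoin L (Set.range (algebraMap R M)) ≤
        (IntermediateField.adjoin E (Set.range (algebraMap R M))).restrictScalars L :=
      IntermediateField.adjoin_le_iff.2 (IntermediateField.subset_adjoin _ _)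
    exact eq_top_iff.2 fun m _ => hsub (hgen ▸ IntermediateField.mem_top)
  have halg := IntermediateField.isAlgebraic_adjoin hint
  rw [htop] at halg
  exact ⟨algebraMap R M z, IntermediateField.topEquiv.isAlgebraic⟩

lemma rank_frobenius_range_le [PerfectField L] (p : ℕ) [Fact p.Prime] [CharP L p] [CharP M p]
    (hgen : IntermediateField.adjoin L (Set.range (algebraMap R M)) = ⊤) :
    Module.rank (frobenius M p).range M ≤ p := by
  obtain ⟨x, hx⟩ := exists_isAlgebraic_adjoin_singleton K hgen
  have : Algebra.EssFiniteType L M :=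
    IntermediateField.fg_top_iff.1 (hgen ▸ fg_adjoin_range_algebraMap K)
  obtain ⟨y, hy⟩ := exists_isSeparable_adjoin_singleton (trdeg_le_one (L := L) (x := x))
  exact rank_fieldRange_frobenius_le (L := L) y

end FunctionField

section FractionalExtension

variable {N D A F : Type*} [CommRing N] [CommRing D] [Algebra N D]

lemma isFractionRing_of_exists_mul_eq [FaithfulSMul N D] [Field F] [Algebra D F]
    [Algebra N F] [IsScalarTower N D F] [IsFractionRing D F]
    (hfrac : ∀ d : D, ∃ x y : N, y ≠ 0 ∧ d * algebraMap N D y = algebraMap N D x) :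
    IsFractionRing N F := by
  have hinj : Function.Injective (algebraMap N F) := by
    rw [IsScalarTower.algebraMap_eq N D F]
    exact (IsFractionRing.injective D F).comp (FaithfulSMul.algebraMap_injective N D)
  have : FaithfulSMul N F := (faithfulSMul_iff_algebraMap_injective N F).2 hinj
  have hquot (d : D) :
      ∃ x y : N, y ≠ 0 ∧ algebraMap D F d = algebraMap N F x / algebraMap N F y := by
    obtain ⟨x, y, hy, h⟩ := hfrac d
    refine ⟨x, y, hy, ?_⟩
    rw [eq_div_iff ((map_ne_zero_iff _ hinj).2 hy), IsScalarTower.algebraMap_apply N D F y,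
      IsScalarTower.algebraMap_apply N D F x, ← h, map_mul]
  refine IsFractionRing.of_field N F fun z => ?_
  obtain ⟨a, b, -, rfl⟩ := IsFractionRing.div_surjective (A := D) z
  obtain ⟨x, y, -, ha⟩ := hquot a
  obtain ⟨x', y', -, hb⟩ := hquot b
  exact ⟨x * y', y * x', by rw [ha, hb, div_div_div_eq, map_mul, map_mul]⟩

lemma exists_injective_algHom_field [IsDomain D] [FaithfulSMul N D] [Field F] [Algebra N F]
    [FaithfulSMul N F]
    (hfrac : ∀ d : D, ∃ x y : N, y ≠ 0 ∧ d * algebraMap N D y = algebraMap N D x) :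
    ∃ θ : D →ₐ[N] F, Function.Injective θ := by
  have := isFractionRing_of_exists_mul_eq (F := FractionRing D) hfrac
  let θ : FractionRing D →ₐ[N] F :=
    IsFractionRing.liftAlgHom (g := Algebra.ofId N F) (FaithfulSMul.algebraMap_injective N F)
  exact ⟨θ.comp (IsScalarTower.toAlgHom N D (FractionRing D)),
    θ.toRingHom.injective.comp (IsFractionRing.injective D (FractionRing D))⟩

variable [CommRing A] [Algebra N A]

lemma mem_range_algebraMap_of_isIntegral [IsIntegrallyClosed A] {s : D} [Field F] [Algebra A F]
    [Algebra N F] [IsScalarTower N A F] [IsFractionRing A F] (θ : D →ₐ[N] F) (hs : IsIntegral N s) :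
    ∃ a, algebraMap A F a = θ s :=
  IsIntegrallyClosed.isIntegral_iff.1 ((hs.map θ).tower_top (A := A))

lemma isUnit_of_algebraMap_eq [IsLocalHom (algebraMap N D)] {q : ℕ} (hq : q ≠ 0)
    (hpow : ∀ a : A, a ^ q ∈ (algebraMap N A).range) [Field F] [Algebra A F] [Algebra N F]
    [IsScalarTower N A F] {θ : D →ₐ[N] F} (hθ : Function.Injective θ) {t : D} (ht : IsUnit t)
    {b : A} (hb : algebraMap A F b = θ t) : IsUnit b := by
  obtain ⟨m, hm⟩ := hpow b
  have hmt : algebraMap N D m = t ^ q := hθ (by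
    rw [AlgHom.commutes, IsScalarTower.algebraMap_apply N A F, hm, map_pow, hb, map_pow])
  have hmu : IsUnit m := isUnit_of_map_unit (algebraMap N D) m (hmt ▸ ht.pow q)
  exact (isUnit_pow_iff hq).1 (hm ▸ hmu.map (algebraMap N A))

lemma exists_injective_algHom_of_pow_mem_range [IsDomain A] [IsIntegrallyClosed A] [IsDomain D]
    [FaithfulSMul N D] [FaithfulSMul N A] [IsLocalHom (algebraMap N D)] {q : ℕ} (hq : q ≠ 0)
    (hpow : ∀ a : A, a ^ q ∈ (algebraMap N A).range)
    (hfrac : ∀ d : D, ∃ x y : N, y ≠ 0 ∧ d * algebraMap N D y = algebraMap N D x)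
    (hint : ∀ d : D, ∃ s t : D, IsIntegral N s ∧ IsIntegral N t ∧ IsUnit t ∧ d * t = s) :
    ∃ Φ : D →ₐ[N] A, Function.Injective Φ := by
  let ι := IsScalarTower.toAlgHom N A (FractionRing A)
  have hι : Function.Injective ι := IsFractionRing.injective A (FractionRing A)
  have : FaithfulSMul N (FractionRing A) := (faithfulSMul_iff_algebraMap_injective _ _).2 (by
    rw [IsScalarTower.algebraMap_eq N A (FractionRing A)]
    exact hι.comp (FaithfulSMul.algebraMap_injective N A))
  obtain ⟨θ, hθ⟩ := exists_injective_algHom_field (F := FractionRing A) hfrac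
  have hrange (d : D) : θ d ∈ ι.range := by
    obtain ⟨s, t, hs, ht, htu, h⟩ := hint d
    obtain ⟨a, ha⟩ := mem_range_algebraMap_of_isIntegral (A := A) θ hs
    obtain ⟨b, hb⟩ := mem_range_algebraMap_of_isIntegral (A := A) θ ht
    obtain ⟨c, hc⟩ := (isUnit_of_algebraMap_eq hq hpow hθ htu hb).exists_right_inv
    refine ⟨a * c, ?_⟩
    change algebraMap A _ (a * c) = θ d
    rw [map_mul, ha, ← h, map_mul, ← hb, mul_assoc, ← map_mul, hc, map_one, mul_one]
  exact ⟨(AlgEquiv.ofInjective ι hι).symm.toAlgHom.comp (θ.codRestrict ι.range hrange),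
    (AlgEquiv.ofInjective ι hι).symm.injective.comp fun x y h => hθ (congrArg Subtype.val h)⟩

end FractionalExtension

section PowSaturation

variable {K A N D : Type*} [Field K] [CommRing A] [Algebra K A] [CommRing N] [Algebra N A]
  [CommRing D] [Algebra N D] {q : ℕ}

lemma algHom_mem_powSaturation [IsDomain A] [FaithfulSMul N A]
    (hfrac : ∀ d : D, ∃ x y : N, y ≠ 0 ∧ d * algebraMap N D y = algebraMap N D x)
    (hmem : ∀ m : N, algebraMap N A m ∈ powSaturation K A q) (Φ : D →ₐ[N] A) (d : D) :
    Φ d ∈ powSaturation K A q := by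
  obtain ⟨x, y, hy, h⟩ := hfrac d
  have hy0 : algebraMap N A y ≠ 0 :=
    (map_ne_zero_iff _ (FaithfulSMul.algebraMap_injective N A)).2 hy
  refine isDivisionClosed_powSaturation q (hmem y) hy0 ?_
  rw [mul_comm, ← Φ.commutes, ← map_mul, h, Φ.commutes]
  exact hmem x

variable [Algebra K N] [IsScalarTower K N A]

lemma powAdjoin_le_range_toAlgHom (hpow : ∀ a : A, a ^ q ∈ (algebraMap N A).range) :
    powAdjoin K A q ≤ (IsScalarTower.toAlgHom K N A).range :=
  Algebra.adjoin_le (by rintro _ ⟨a, rfl⟩; exact hpow a)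

variable [IsDomain A] [FaithfulSMul N A] [IsDomain D] [IsIntegrallyClosed D]

lemma exists_algHom_eq_of_mem_powSaturation (hq : q ≠ 0)
    (hpow : ∀ a : A, a ^ q ∈ (algebraMap N A).range) (Φ : D →ₐ[N] A) {a : A}
    (ha : a ∈ powSaturation K A q) : ∃ d, Φ d = a := by
  obtain ⟨y, hy, hy0, hay⟩ := ha
  obtain ⟨m, rfl⟩ := powAdjoin_le_range_toAlgHom hpow hy
  obtain ⟨m', hm'⟩ := powAdjoin_le_range_toAlgHom hpow hay
  obtain ⟨m₀, hm₀⟩ := hpow a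
  replace hm' : algebraMap N A m' = a * algebraMap N A m := hm'
  have hpow' : m₀ * m ^ q = m' ^ q := FaithfulSMul.algebraMap_injective N A (by
    rw [map_mul, map_pow, map_pow, hm₀, hm', mul_pow])
  have hdvd : algebraMap N D m ^ q ∣ algebraMap N D m' ^ q :=
    ⟨algebraMap N D m₀, by rw [← map_pow, ← map_pow, ← hpow', map_mul, mul_comm]⟩
  obtain ⟨d, hd⟩ := (IsIntegrallyClosed.pow_dvd_pow_iff hq).1 hdvd
  refine ⟨d, mul_right_cancel₀ hy0 ?_⟩
  change Φ d * algebraMap N A m = a * algebraMap N A m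
  rw [← hm', ← Φ.commutes, ← map_mul, mul_comm, ← hd, Φ.commutes]

theorem nonempty_algEquiv_powSaturation [IsIntegrallyClosed A] [Algebra K D] [IsScalarTower K N D]
    [FaithfulSMul N D] [IsLocalHom (algebraMap N D)] (hq : q ≠ 0)
    (hpow : ∀ a : A, a ^ q ∈ (algebraMap N A).range)
    (hmem : ∀ m : N, algebraMap N A m ∈ powSaturation K A q)
    (hfrac : ∀ d : D, ∃ x y : N, y ≠ 0 ∧ d * algebraMap N D y = algebraMap N D x)
    (hint : ∀ d : D, ∃ s t : D, IsIntegral N s ∧ IsIntegral N t ∧ IsUnit t ∧ d * t = s) :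
    Nonempty (D ≃ₐ[K] powSaturation K A q) := by
  obtain ⟨Φ, hΦ⟩ := exists_injective_algHom_of_pow_mem_range hq hpow hfrac hint
  let Ψ := (Φ.restrictScalars K).codRestrict _ (algHom_mem_powSaturation hfrac hmem Φ)
  refine ⟨AlgEquiv.ofBijective Ψ ⟨fun x y h => hΦ (congrArg Subtype.val h), fun ⟨a, ha⟩ => ?_⟩⟩
  obtain ⟨d, hd⟩ := exists_algHom_eq_of_mem_powSaturation hq hpow Φ ha
  exact ⟨d, Subtype.ext hd⟩

end PowSaturation

section Stalk

variable {K : Type u} [Field K] {X Y : Scheme.{u}} (f : X ⟶ Spec (CommRingCat.of K))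

lemma toSections_germ {U : X.Opens} {x : X} (hx : x ∈ U) :
    toSections f U ≫ X.presheaf.germ U x hx = toStalk f x := by
  simp [toSections, toStalk]

lemma toStalk_stalkMap (h : Y ⟶ X) (y : Y) :
    toStalk f (h y) ≫ h.stalkMap y = toStalk (h ≫ f) y := by
  simp only [toStalk, Category.assoc, Scheme.Hom.comp_appTop]
  rw [Scheme.Hom.germ_stalkMap h ⊤ y trivial]
  rfl

lemma exists_germ_mul_eq_germ {U : X.Opens} (hU : IsAffineOpen U) {x : X} (hx : x ∈ U)
    (m : X.presheaf.stalk x) : ∃ s t : Γ(X, U), IsUnit (X.presheaf.germ U x hx t) ∧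
      m * X.presheaf.germ U x hx t = X.presheaf.germ U x hx s := by
  let := TopCat.Presheaf.algebra_section_stalk X.presheaf (⟨x, hx⟩ : U)
  have := hU.isLocalization_stalk ⟨x, hx⟩
  obtain ⟨⟨s, t⟩, h⟩ := IsLocalization.surj (hU.primeIdealOf ⟨x, hx⟩).asIdeal.primeCompl m
  exact ⟨s, t, IsLocalization.map_units (X.presheaf.stalk x) t, h⟩

end Stalk

section TensorProduct

variable {K L G A : Type*} [Field K] [CommRing L] [CommRing G] [CommRing A] [Algebra K L]
  [Algebra K G] [Algebra K A] {φ : G →ₐ[K] A}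

lemma exists_mul_tmul_eq_map (hA : ∀ a : A, ∃ s t : G, IsUnit (φ t) ∧ a * φ t = φ s)
    (z : L ⊗[K] A) :
    ∃ t : G, IsUnit (φ t) ∧
      ∃ w, z * 1 ⊗ₜ φ t = Algebra.TensorProduct.map (AlgHom.id L L) φ w := by
  induction z with
  | zero => exact ⟨1, by simp, 0, by simp⟩
  | tmul l a =>
    obtain ⟨s, t, ht, h⟩ := hA a
    exact ⟨t, ht, l ⊗ₜ s, by simp [h]⟩
  | add x y hx hy =>
    obtain ⟨t, ht, w, h⟩ := hx
    obtain ⟨t', ht', w', h'⟩ := hy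
    refine ⟨t * t', by simpa using ht.mul ht', w * 1 ⊗ₜ t' + w' * 1 ⊗ₜ t, ?_⟩
    have hsplit : (1 : L) ⊗ₜ[K] φ (t * t') = 1 ⊗ₜ φ t * 1 ⊗ₜ φ t' := by simp
    rw [hsplit, map_add, map_mul, map_mul, ← h, ← h', Algebra.TensorProduct.map_tmul,
      Algebra.TensorProduct.map_tmul, map_one]
    ring

lemma isDomain_tensor_of_forall_exists_mul_eq (hφ : Function.Injective φ)
    (hA : ∀ a : A, ∃ s t : G, IsUnit (φ t) ∧ a * φ t = φ s) [IsDomain (L ⊗[K] G)] :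
    IsDomain (L ⊗[K] A) := by
  have hinj : Function.Injective (Algebra.TensorProduct.map (AlgHom.id L L) φ) :=
    Module.Flat.lTensor_preserves_injective_linearMap (M := L) φ.toLinearMap hφ
  have hunit {t : G} (ht : IsUnit (φ t)) : IsUnit ((1 : L) ⊗ₜ[K] φ t) :=
    ht.map (Algebra.TensorProduct.includeRight : A →ₐ[K] L ⊗[K] A)
  have : Nontrivial (L ⊗[K] A) := hinj.nontrivial
  have : NoZeroDivisors (L ⊗[K] A) := by
    refine ⟨fun {x y} hxy => ?_⟩
    obtain ⟨t, ht, w, h⟩ := exists_mul_tmul_eq_map (L := L) hA x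
    obtain ⟨t', ht', w', h'⟩ := exists_mul_tmul_eq_map (L := L) hA y
    have hww' : w * w' = 0 := hinj (by
      rw [map_mul, ← h, ← h', map_zero, mul_mul_mul_comm, hxy, zero_mul])
    rcases mul_eq_zero.1 hww' with rfl | rfl
    · exact .inl ((hunit ht).mul_left_eq_zero.1 (h.trans (map_zero _)))
    · exact .inr ((hunit ht').mul_left_eq_zero.1 (h'.trans (map_zero _)))
  exact NoZeroDivisors.to_isDomain _

end TensorProduct

section BaseChange

variable {K L : Type u} [Field K] [Field L] {X : Scheme.{u}} (f : X ⟶ Spec (CommRingCat.of K))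

lemma isPushout_sections (φ : K →+* L) {U : X.Opens} (hU : IsAffineOpen U) :
    IsPushout (toSections f U) (CommRingCat.ofHom φ)
      ((pullback.fst f (Spec.map (CommRingCat.ofHom φ))).app U)
      (toSections (pullback.snd f (Spec.map (CommRingCat.ofHom φ)))
        (pullback.fst f (Spec.map (CommRingCat.ofHom φ)) ⁻¹ᵁ U)) := by
  have h := (isIso_pushoutSection_iff (IsPullback.of_hasPullback f
    (Spec.map (CommRingCat.ofHom φ))) (US := ⊤) (UT := ⊤) (UX := U) le_top le_top
      (UY := pullback.fst f (Spec.map (CommRingCat.ofHom φ)) ⁻¹ᵁ U) (by simp)).1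
    (isIso_pushoutSection_of_isAffineOpen _ _ _ _ (isAffineOpen_top _) (isAffineOpen_top _) hU)
  refine h.of_iso (Scheme.ΓSpecIso _) (Iso.refl _) (Scheme.ΓSpecIso _) (Iso.refl _) ?_ ?_ ?_ ?_
  · simp [toSections, Scheme.Hom.appLE]
  · refine Eq.trans ?_ (Scheme.ΓSpecIso_naturality (CommRingCat.ofHom φ))
    exact congrArg (· ≫ (Scheme.ΓSpecIso (CommRingCat.of L)).hom)
      (Scheme.Hom.appLE_eq_app (Spec.map (CommRingCat.ofHom φ)) (U := ⊤))
  · simp [Scheme.Hom.appLE]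
  · simp [toSections, Scheme.Hom.appLE]

variable [GeometricallyIntegral f]

include f in
lemma isIntegral_of_geometricallyIntegral : IsIntegral X := by
  have : Subsingleton (Spec (CommRingCat.of K)) := inferInstanceAs (Subsingleton (PrimeSpectrum K))
  exact GeometricallyIntegral.isIntegral_of_subsingleton f

variable [Algebra K L]

lemma isDomain_tensor_sections {U : X.Opens} (hU : IsAffineOpen U) [Nonempty U] :
    letI := (toSections f U).hom.toAlgebra
    IsDomain (L ⊗[K] Γ(X, U)) := by
  let := (toSections f U).hom.toAlgebra
  let g := Spec.map (CommRingCat.ofHom (algebraMap K L))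
  have : IsIntegral (pullback f g) :=
    GeometricallyIntegral.geometrically_isIntegral _ _ _ (.of_hasPullback _ _)
  have := isIntegral_of_geometricallyIntegral f
  let e := ((CommRingCat.isPushout_tensorProduct K L Γ(X, U)).isoIsPushout _ _
    (isPushout_sections f (algebraMap K L) hU).flip).commRingCatIsoToRingEquiv
  obtain ⟨x, hx⟩ := ‹Nonempty U›
  obtain ⟨y, rfl⟩ := (pullback.fst f g).surjective x
  have : Nonempty (pullback.fst f g ⁻¹ᵁ U) := ⟨⟨y, hx⟩⟩
  exact e.toMulEquiv.isDomain _

lemma isDomain_tensor_stalk (x : X) : IsDomain (L ⊗[K] LocalRing f x) := by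
  have := isIntegral_of_geometricallyIntegral f
  obtain ⟨U, hU, hx, -⟩ := exists_isAffineOpen_mem_and_subset (x := x) (U := ⊤) trivial
  have : Nonempty U := ⟨⟨x, hx⟩⟩
  let := (toSections f U).hom.toAlgebra
  have : IsDomain (L ⊗[K] Γ(X, U)) := isDomain_tensor_sections f hU
  let φ : Γ(X, U) →ₐ[K] LocalRing f x :=
    { (X.presheaf.germ U x hx).hom with
      commutes' := fun k => congrArg (fun g => g.hom k) (toSections_germ f hx) }
  exact isDomain_tensor_of_forall_exists_mul_eq (φ := φ) (germ_injective_of_isIntegral X x hx)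
    (exists_germ_mul_eq_germ hU hx)

end BaseChange

section NormalizationSections

variable (X : Scheme.{u}) [IsIntegral X]

lemma exists_iso_sections_genericInclusion (U : X.Opens) [hU : Nonempty U] :
    ∃ E : X.functionField ≅ Γ(Spec X.functionField, genericInclusion X ⁻¹ᵁ U),
      X.germToFunctionField U ≫ E.hom = (genericInclusion X).app U := by
  have hgen : genericPoint X ∈ U :=
    ((genericPoint_spec X).mem_open_set_iff U.isOpen).2 (by simpa using hU)
  have htop : genericInclusion X ⁻¹ᵁ U = ⊤ := by
    refine eq_top_iff.2 fun y _ => ?_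
    have h : genericInclusion X y ⤳ genericPoint X := by
      have : genericInclusion X y ∈ Set.range (genericInclusion X) := ⟨y, rfl⟩
      rwa [Scheme.range_fromSpecStalk] at this
    exact h.mem_open U.isOpen hgen
  refine ⟨(Scheme.ΓSpecIso _).symm ≪≫
    (Spec X.functionField).presheaf.mapIso (eqToIso htop).op, ?_⟩
  rw [Scheme.fromSpecStalk_app hgen]
  rfl

lemma isFractionRing_sections_genericInclusion {U : X.Opens} (hU : IsAffineOpen U) [Nonempty U] :
    letI := ((genericInclusion X).app U).hom.toAlgebra
    IsFractionRing Γ(X, U) Γ(Spec X.functionField, genericInclusion X ⁻¹ᵁ U) := by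
  let := ((genericInclusion X).app U).hom.toAlgebra
  obtain ⟨E, hE⟩ := exists_iso_sections_genericInclusion X U
  have := functionField_isFractionRing_of_isAffineOpen X U hU
  let e : X.functionField ≃ₐ[Γ(X, U)] Γ(Spec X.functionField, genericInclusion X ⁻¹ᵁ U) :=
    AlgEquiv.ofRingEquiv (f := E.commRingCatIsoToRingEquiv)
      fun s => congrArg (fun φ => φ.hom s) hE
  exact IsLocalization.isLocalization_of_algEquiv _ e

lemma nonempty_algEquiv_sections_normalization {U : X.Opens} (hU : IsAffineOpen U) [Nonempty U] :
    letI := ((normalizationHom X).app U).hom.toAlgebra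
    Nonempty (Γ(normalization X, normalizationHom X ⁻¹ᵁ U) ≃ₐ[Γ(X, U)] Normalized Γ(X, U)) := by
  let := ((normalizationHom X).app U).hom.toAlgebra
  let := ((genericInclusion X).app U).hom.toAlgebra
  have := isFractionRing_sections_genericInclusion X hU
  let N := (genericInclusion X).normalizationObjIso hU
  have hN (s : Γ(X, U)) : N.commRingCatIsoToRingEquiv (((normalizationHom X).app U).hom s) =
      algebraMap Γ(X, U) (integralClosure Γ(X, U) _) s := by
    rw [Scheme.Hom.fromNormalization_app _ hU]
    exact N.commRingCatIsoToRingEquiv.apply_symm_apply _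
  exact ⟨(AlgEquiv.ofRingEquiv (f := N.commRingCatIsoToRingEquiv) hN).trans
    (FractionRing.algEquiv Γ(X, U) _).symm.mapIntegralClosure⟩

end NormalizationSections

section Localization

variable {R B N D : Type*} [CommRing R] [CommRing B] [CommRing N] [CommRing D] [Algebra R B]
  [Algebra R N] [Algebra B D] [Algebra N D] [Algebra R D] [IsScalarTower R B D]
  [IsScalarTower R N D]

lemma faithfulSMul_of_forall_exists_mul_eq [FaithfulSMul R D]
    (hN : ∀ m : N, ∃ s t : R, IsUnit (algebraMap R N t) ∧ m * algebraMap R N t = algebraMap R N s) :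
    FaithfulSMul N D := by
  refine (faithfulSMul_iff_algebraMap_injective N D).2 ((injective_iff_map_eq_zero _).2 ?_)
  intro m hm
  obtain ⟨s, t, ht, h⟩ := hN m
  have hs : s = 0 := by
    apply FaithfulSMul.algebraMap_injective R D
    rw [IsScalarTower.algebraMap_apply R N D, ← h, map_mul, hm, zero_mul, map_zero]
  rw [hs, map_zero] at h
  exact ht.mul_left_eq_zero.1 h

variable (hD : ∀ d : D, ∃ b c : B, IsUnit (algebraMap B D c) ∧
  d * algebraMap B D c = algebraMap B D b)

include hD in
lemma exists_isIntegral_mul_eq [Algebra.IsIntegral R B] (d : D) :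
    ∃ s t : D, IsIntegral N s ∧ IsIntegral N t ∧ IsUnit t ∧ d * t = s := by
  obtain ⟨b, c, hc, h⟩ := hD d
  have hint (b : B) : IsIntegral N (algebraMap B D b) :=
    ((Algebra.IsIntegral.isIntegral (R := R) b).algebraMap).tower_top
  exact ⟨_, _, hint b, hint c, hc, h⟩

include hD in
lemma exists_mul_algebraMap_eq [IsDomain R] [IsDomain B] [Nontrivial D] [FaithfulSMul R B]
    [FaithfulSMul R N]
    (hB : ∀ b : B, ∃ x y : R, y ≠ 0 ∧ b * algebraMap R B y = algebraMap R B x) (d : D) :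
    ∃ x y : N, y ≠ 0 ∧ d * algebraMap N D y = algebraMap N D x := by
  obtain ⟨b, c, hc, h⟩ := hD d
  obtain ⟨x, y, hy, hb⟩ := hB b
  obtain ⟨x', y', hy', hc'⟩ := hB c
  have hc0 : c ≠ 0 := by
    rintro rfl
    exact hc.ne_zero (map_zero _)
  have hx' : x' ≠ 0 := by
    rintro rfl
    rw [map_zero] at hc'
    exact mul_ne_zero hc0
      ((map_ne_zero_iff _ (FaithfulSMul.algebraMap_injective R B)).2 hy') hc'
  refine ⟨algebraMap R N (x * y'), algebraMap R N (x' * y),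
    (map_ne_zero_iff _ (FaithfulSMul.algebraMap_injective R N)).2 (mul_ne_zero hx' hy), ?_⟩
  simp only [← IsScalarTower.algebraMap_apply R N D, IsScalarTower.algebraMap_apply R B D, map_mul,
    ← hb, ← hc', ← h]
  ring

end Localization

section NormalizationStalk

lemma exists_mul_algebraMap_normalized_eq {R : Type*} [CommRing R] [IsDomain R]
    (b : Normalized R) :
    ∃ x y : R, y ≠ 0 ∧ b * algebraMap R (Normalized R) y = algebraMap R (Normalized R) x := by
  obtain ⟨⟨x, y⟩, h⟩ := IsLocalization.surj (nonZeroDivisors R) (b : FractionRing R)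
  exact ⟨x, y, nonZeroDivisors.ne_zero y.2, Subtype.ext h⟩

variable {X : Scheme.{u}} [IsIntegral X]

lemma isIntegrallyClosed_stalk_normalization (Q : normalization X) :
    IsIntegrallyClosed ((normalization X).presheaf.stalk Q) := by
  obtain ⟨U, hU, hx, -⟩ := exists_isAffineOpen_mem_and_subset (x := normalizationHom X Q)
    (U := ⊤) trivial
  have : Nonempty U := ⟨⟨_, hx⟩⟩
  have hW : IsAffineOpen (normalizationHom X ⁻¹ᵁ U) := hU.preimage _
  have : Nonempty (normalizationHom X ⁻¹ᵁ U : (normalization X).Opens) := ⟨⟨Q, hx⟩⟩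
  let := ((normalizationHom X).app U).hom.toAlgebra
  obtain ⟨e⟩ := nonempty_algEquiv_sections_normalization X hU
  have : IsIntegrallyClosed (Normalized Γ(X, U)) :=
    integralClosure.isIntegrallyClosedOfFiniteExtension (FractionRing Γ(X, U))
  have := IsIntegrallyClosed.of_equiv e.symm.toRingEquiv
  let := TopCat.Presheaf.algebra_section_stalk (normalization X).presheaf
    (⟨Q, hx⟩ : (normalizationHom X ⁻¹ᵁ U : (normalization X).Opens))
  have := hW.isLocalization_stalk ⟨Q, hx⟩
  exact isIntegrallyClosed_of_isLocalization ((normalization X).presheaf.stalk Q)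
    (hW.primeIdealOf ⟨Q, hx⟩).asIdeal.primeCompl (Ideal.primeCompl_le_nonZeroDivisors _)

theorem normalization_stalkMap (Q : normalization X) :
    letI := ((normalizationHom X).stalkMap Q).hom.toAlgebra
    FaithfulSMul (X.presheaf.stalk (normalizationHom X Q)) ((normalization X).presheaf.stalk Q) ∧
    (∀ d : (normalization X).presheaf.stalk Q,
      ∃ x y : X.presheaf.stalk (normalizationHom X Q), y ≠ 0 ∧
        d * algebraMap _ _ y = algebraMap _ _ x) ∧
    ∀ d : (normalization X).presheaf.stalk Q, ∃ s t,
      IsIntegral (X.presheaf.stalk (normalizationHom X Q)) s ∧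
      IsIntegral (X.presheaf.stalk (normalizationHom X Q)) t ∧ IsUnit t ∧ d * t = s := by
  obtain ⟨U, hU, hx, -⟩ := exists_isAffineOpen_mem_and_subset (x := normalizationHom X Q)
    (U := ⊤) trivial
  have : Nonempty U := ⟨⟨_, hx⟩⟩
  have hQ : Q ∈ normalizationHom X ⁻¹ᵁ U := hx
  have : Nonempty (normalizationHom X ⁻¹ᵁ U : (normalization X).Opens) := ⟨⟨Q, hx⟩⟩
  let := ((normalizationHom X).app U).hom.toAlgebra
  let := ((normalizationHom X).stalkMap Q).hom.toAlgebra
  let := (X.presheaf.germ U _ hx).hom.toAlgebra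
  let := ((normalization X).presheaf.germ _ Q hQ).hom.toAlgebra
  let := (X.presheaf.germ U _ hx ≫ (normalizationHom X).stalkMap Q).hom.toAlgebra
  have : IsScalarTower Γ(X, U) (X.presheaf.stalk (normalizationHom X Q))
    ((normalization X).presheaf.stalk Q) := .of_algebraMap_eq fun _ => rfl
  have : IsScalarTower Γ(X, U) Γ(normalization X, normalizationHom X ⁻¹ᵁ U)
    ((normalization X).presheaf.stalk Q) := .of_algebraMap_eq fun s =>
      Scheme.Hom.germ_stalkMap_apply (normalizationHom X) U Q hx s
  have : FaithfulSMul Γ(X, U) (X.presheaf.stalk (normalizationHom X Q)) :=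
    (faithfulSMul_iff_algebraMap_injective _ _).2 (germ_injective_of_isIntegral X _ hx)
  have : FaithfulSMul Γ(normalization X, normalizationHom X ⁻¹ᵁ U)
    ((normalization X).presheaf.stalk Q) :=
    (faithfulSMul_iff_algebraMap_injective _ _).2 (germ_injective_of_isIntegral _ Q hQ)
  obtain ⟨e⟩ := nonempty_algEquiv_sections_normalization X hU
  have : Algebra.IsIntegral Γ(X, U) Γ(normalization X, normalizationHom X ⁻¹ᵁ U) :=
    .of_injective e.toAlgHom e.injective
  have : FaithfulSMul Γ(X, U) Γ(normalization X, normalizationHom X ⁻¹ᵁ U) :=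
    .of_injective e.symm.toLinearMap e.symm.injective
  have : FaithfulSMul Γ(X, U) ((normalization X).presheaf.stalk Q) :=
    .trans Γ(X, U) Γ(normalization X, normalizationHom X ⁻¹ᵁ U) _
  have hfrac (b : Γ(normalization X, normalizationHom X ⁻¹ᵁ U)) :
      ∃ x y : Γ(X, U), y ≠ 0 ∧ b * algebraMap Γ(X, U) _ y = algebraMap Γ(X, U) _ x := by
    obtain ⟨x, y, hy, h⟩ := exists_mul_algebraMap_normalized_eq (e b)
    exact ⟨x, y, hy, e.injective (by simpa using h)⟩
  have hgerm := exists_germ_mul_eq_germ (hU.preimage (normalizationHom X)) hQ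
  exact ⟨faithfulSMul_of_forall_exists_mul_eq (exists_germ_mul_eq_germ hU hx),
    exists_mul_algebraMap_eq hgerm hfrac, exists_isIntegral_mul_eq (R := Γ(X, U)) hgerm⟩

end NormalizationStalk

section AbsoluteFrobenius

variable {K : Type u} [Field K] (p : ℕ) [Fact p.Prime] [CharP K p] {X Y : Scheme.{u}}
  (f : X ⟶ Spec (CommRingCat.of K))

lemma absFrobenius_naturality (g : Y ⟶ Spec (CommRingCat.of K)) (n : ℕ) (h : Y ⟶ X) :
    absFrobenius p g n ≫ h = h ≫ absFrobenius p f n := by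
  refine Scheme.Hom.ext (by ext x; rfl) fun U => ?_
  ext s
  exact (congrArg (fun φ : Γ(Y, h ⁻¹ᵁ U) ⟶ Γ(Y, h ⁻¹ᵁ U) => φ.hom ((h.app U).hom s ^ p ^ n))
    (Y.presheaf.map_id (Opposite.op (h ⁻¹ᵁ U)))).trans (map_pow (h.app U).hom s (p ^ n)).symm

lemma absFrobenius_stalkMap (n : ℕ) (x : X) (a : X.presheaf.stalk x) :
    ((absFrobenius p f n).stalkMap x).hom a = (a ^ p ^ n : X.presheaf.stalk x) := by
  obtain ⟨U, hxU, s, rfl⟩ := X.presheaf.exists_germ_eq a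
  exact (Scheme.Hom.germ_stalkMap_apply (absFrobenius p f n) U x hxU s).trans
    (map_pow (X.presheaf.germ U x hxU).hom s (p ^ n))

end AbsoluteFrobenius

section RelativeFrobenius

variable {K : Type u} [Field K] (p : ℕ) [Fact p.Prime] [CharP K p] {X : Scheme.{u}}
  (f : X ⟶ Spec (CommRingCat.of K)) (n : ℕ)

/-- The projection of the Frobenius twist to the original scheme. -/
abbrev twistFst : twist p f n ⟶ X :=
  pullback.fst f (Spec.map (CommRingCat.ofHom (iterateFrobenius K p n)))

lemma relFrobenius_twistFst : relFrobenius p f n ≫ twistFst p f n = absFrobenius p f n :=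
  pullback.lift_fst _ _ _

lemma twistFst_relFrobenius :
    twistFst p f n ≫ relFrobenius p f n = absFrobenius p (twistHom p f n) n := by
  apply pullback.hom_ext
  · rw [Category.assoc, relFrobenius, pullback.lift_fst]
    exact (absFrobenius_naturality p f (twistHom p f n) n _).symm
  · rw [Category.assoc, relFrobenius, pullback.lift_snd, absFrobenius_comp]
    exact pullback.condition

lemma twistFst_relFrobenius_apply (x : X) : twistFst p f n (relFrobenius p f n x) = x := by
  rw [← Scheme.Hom.comp_apply, relFrobenius_twistFst]
  rfl

lemma toStalk_relFrobenius (x : X) :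
    toStalk (twistHom p f n) (relFrobenius p f n x) ≫ (relFrobenius p f n).stalkMap x =
      toStalk f x := by
  rw [toStalk_stalkMap]
  congr 1
  exact pullback.lift_snd _ _ _

lemma pow_mem_range_relFrobenius_stalkMap (x : X) (a : X.presheaf.stalk x) :
    (a ^ p ^ n : X.presheaf.stalk x) ∈ ((relFrobenius p f n).stalkMap x).hom.range := by
  have h := Scheme.Hom.stalkMap_congr_hom _ _ (relFrobenius_twistFst p f n).symm x
  rw [Scheme.Hom.stalkMap_comp] at h
  rw [← absFrobenius_stalkMap p f n x a, h]
  exact ⟨_, rfl⟩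

lemma relFrobenius_stalkMap_injective [IsReduced (twist p f n)] (x : X) :
    Function.Injective ((relFrobenius p f n).stalkMap x).hom := by
  obtain ⟨y, rfl⟩ : ∃ y, twistFst p f n y = x := ⟨_, twistFst_relFrobenius_apply p f n x⟩
  have hinj : Function.Injective ((absFrobenius p (twistHom p f n) n).stalkMap y).hom :=
    (injective_iff_map_eq_zero _).2 fun a ha =>
      eq_zero_of_pow_eq_zero (R := (twist p f n).presheaf.stalk y)
        ((absFrobenius_stalkMap p (twistHom p f n) n y a).symm.trans ha)
  have h := Scheme.Hom.stalkMap_congr_hom _ _ (twistFst_relFrobenius p f n).symm y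
  rw [Scheme.Hom.stalkMap_comp] at h
  have hcomp := (Iso.inv_comp_eq _).2 h
  refine Function.Injective.of_comp (f := ((twistFst p f n).stalkMap y).hom) ?_
  refine cast (congrArg (fun φ => Function.Injective φ.hom) hcomp) ?_
  exact hinj.comp (Iso.commRingCatIsoToRingEquiv _).symm.injective

lemma relFrobenius_stalkMap_germ {U : X.Opens} {x : X} (hx : x ∈ U)
    (hx' : relFrobenius p f n x ∈ twistFst p f n ⁻¹ᵁ U) (s : Γ(X, U)) :
    ((relFrobenius p f n).stalkMap x).hom
        ((twist p f n).presheaf.germ _ _ hx' ((twistFst p f n).app U s)) =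
      (X.presheaf.germ U x hx s ^ p ^ n : X.presheaf.stalk x) := by
  have h := Scheme.Hom.congr_app (relFrobenius_twistFst p f n) U
  rw [Scheme.Hom.comp_app] at h
  refine (Scheme.Hom.germ_stalkMap_apply _ _ x hx' _).trans ?_
  refine (congrArg (fun φ => X.presheaf.germ (relFrobenius p f n ⁻¹ᵁ twistFst p f n ⁻¹ᵁ U) x hx'
    (φ.hom s)) h).trans ?_
  refine (X.presheaf.germ_res_apply _ x hx' _).trans ?_
  exact map_pow (X.presheaf.germ U x hx).hom s (p ^ n)

lemma relFrobenius_stalkMap_germ_mem_powAdjoin {U : X.Opens} (hU : IsAffineOpen U) {x : X}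
    (hx : x ∈ U) (hx' : relFrobenius p f n x ∈ twistFst p f n ⁻¹ᵁ U)
    (v : Γ(twist p f n, twistFst p f n ⁻¹ᵁ U)) :
    (((relFrobenius p f n).stalkMap x).hom ((twist p f n).presheaf.germ _ _ hx' v) :
      LocalRing f x) ∈ powAdjoin K (LocalRing f x) (p ^ n) := by
  let S := (powAdjoin K (LocalRing f x) (p ^ n)).toSubring.comap
    ((relFrobenius p f n).stalkMap x).hom |>.comap ((twist p f n).presheaf.germ _ _ hx').hom
  suffices hS : S = ⊤ from (hS ▸ Subring.mem_top v : v ∈ S)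
  rw [eq_top_iff, ← CommRingCat.closure_range_union_range_eq_top_of_isPushout
    (isPushout_sections f (iterateFrobenius K p n) hU), Subring.closure_le]
  rintro _ (⟨s, rfl⟩ | ⟨k, rfl⟩)
  · exact (Set.mem_of_eq_of_mem (relFrobenius_stalkMap_germ p f n hx hx' s)
      (Algebra.subset_adjoin ⟨(X.presheaf.germ U x hx s : LocalRing f x), rfl⟩ :
        _ ∈ powAdjoin K (LocalRing f x) (p ^ n)) :)
  · have h := (congrArg (fun φ => ((relFrobenius p f n).stalkMap x).hom (φ.hom k))
      (toSections_germ (twistHom p f n) hx')).trans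
      (congrArg (fun φ => φ.hom k) (toStalk_relFrobenius p f n x))
    exact (Set.mem_of_eq_of_mem h
      (Subalgebra.algebraMap_mem (powAdjoin K (LocalRing f x) (p ^ n)) k) :)

lemma relFrobenius_stalkMap_mem_powSaturation {x : X} [IsDomain (LocalRing f x)]
    (m : (twist p f n).presheaf.stalk (relFrobenius p f n x)) :
    (((relFrobenius p f n).stalkMap x).hom m : LocalRing f x) ∈
      powSaturation K (LocalRing f x) (p ^ n) := by
  obtain ⟨U, hU, hx, -⟩ := exists_isAffineOpen_mem_and_subset (x := x) (U := ⊤) trivial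
  have hx' : relFrobenius p f n x ∈ twistFst p f n ⁻¹ᵁ U := by
    change twistFst p f n _ ∈ U
    rwa [twistFst_relFrobenius_apply]
  have : IsAffineHom (twistFst p f n) :=
    MorphismProperty.of_isPullback (P := @IsAffineHom) (IsPullback.of_hasPullback f _).flip
      inferInstance
  obtain ⟨s, t, ht, h⟩ := exists_germ_mul_eq_germ (hU.preimage (twistFst p f n)) hx' m
  have hpow := relFrobenius_stalkMap_germ_mem_powAdjoin p f n hU hx hx'
  refine ⟨_, hpow t, (ht.map ((relFrobenius p f n).stalkMap x).hom).ne_zero, ?_⟩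
  exact (Set.mem_of_eq_of_mem ((map_mul ((relFrobenius p f n).stalkMap x).hom m _).symm.trans
    (congrArg ((relFrobenius p f n).stalkMap x).hom h)) (hpow s) :
      _ ∈ powAdjoin K (LocalRing f x) (p ^ n))

variable [GeometricallyIntegral f]

lemma exists_ringHom_localRing_twist {x : X} [IsDomain (LocalRing f x)] {z : twist p f n}
    (hz : z = relFrobenius p f n x) :
    ∃ j : LocalRing (twistHom p f n) z →+* LocalRing f x,
      (∀ k, algebraMap K _ k = j (algebraMap K _ k)) ∧ Function.Injective j ∧
      (∀ a : LocalRing f x, a ^ p ^ n ∈ j.range) ∧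
      ∀ m, j m ∈ powSaturation K (LocalRing f x) (p ^ n) := by
  subst hz
  exact ⟨((relFrobenius p f n).stalkMap x).hom,
    fun k => (congrArg (fun φ => φ.hom k) (toStalk_relFrobenius p f n x)).symm,
    relFrobenius_stalkMap_injective p f n x, pow_mem_range_relFrobenius_stalkMap p f n x,
    relFrobenius_stalkMap_mem_powSaturation p f n⟩

theorem nonempty_algEquiv_localRing_tower {x : X} [IsDomain (LocalRing f x)]
    [IsIntegrallyClosed (LocalRing f x)] (Q : towerCurve p f n)
    (hQ : towerToTwist p f n Q = relFrobenius p f n x) :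
    Nonempty (LocalRing (towerHom p f n) Q ≃ₐ[K] powSaturation K (LocalRing f x) (p ^ n)) := by
  obtain ⟨j, hjK, hj, hpow, hmem⟩ := exists_ringHom_localRing_twist p f n hQ
  let := j.toAlgebra
  have : IsScalarTower K (LocalRing (twistHom p f n) (towerToTwist p f n Q)) (LocalRing f x) :=
    .of_algebraMap_eq hjK
  have : FaithfulSMul (LocalRing (twistHom p f n) (towerToTwist p f n Q)) (LocalRing f x) :=
    (faithfulSMul_iff_algebraMap_injective _ _).2 hj
  let : Algebra (LocalRing (twistHom p f n) (towerToTwist p f n Q))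
    (LocalRing (towerHom p f n) Q) := ((towerToTwist p f n).stalkMap Q).hom.toAlgebra
  have : IsScalarTower K (LocalRing (twistHom p f n) (towerToTwist p f n Q))
    (LocalRing (towerHom p f n) Q) := .of_algebraMap_eq fun k =>
      (congrArg (fun φ => φ.hom k) (toStalk_stalkMap (twistHom p f n) _ Q)).symm
  have : IsLocalHom (algebraMap (LocalRing (twistHom p f n) (towerToTwist p f n Q))
    (LocalRing (towerHom p f n) Q)) :=
      inferInstanceAs (IsLocalHom ((towerToTwist p f n).stalkMap Q).hom)
  have : IsDomain (LocalRing (towerHom p f n) Q) :=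
    inferInstanceAs (IsDomain ((towerCurve p f n).presheaf.stalk Q))
  have : IsIntegrallyClosed (LocalRing (towerHom p f n) Q) :=
    isIntegrallyClosed_stalk_normalization Q
  obtain ⟨hν, hfrac, hint⟩ := normalization_stalkMap Q
  have : FaithfulSMul (LocalRing (twistHom p f n) (towerToTwist p f n Q))
    (LocalRing (towerHom p f n) Q) := hν
  exact nonempty_algEquiv_powSaturation (pow_ne_zero n (Fact.out : p.Prime).ne_zero) hpow hmem
    hfrac hint

end RelativeFrobenius

section Dimension

variable {X : Scheme.{u}}

lemma ringKrullDim_stalk_le (x : X) :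
    ringKrullDim (X.presheaf.stalk x) ≤ topologicalKrullDim X := by
  rw [← PrimeSpectrum.topologicalKrullDim_eq_ringKrullDim]
  exact (X.fromSpecStalk x).isEmbedding.isInducing.topologicalKrullDim_le

lemma ringKrullDim_sections_le {U : X.Opens} (hU : IsAffineOpen U) :
    ringKrullDim Γ(X, U) ≤ topologicalKrullDim X := by
  rw [← PrimeSpectrum.topologicalKrullDim_eq_ringKrullDim]
  exact hU.fromSpec.isOpenEmbedding.isInducing.topologicalKrullDim_le

lemma isPrincipalIdealRing_stalk [IsIntegral X] (hdim : topologicalKrullDim X ≤ 1) (x : X)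
    [IsRegularLocalRing (X.presheaf.stalk x)] : IsPrincipalIdealRing (X.presheaf.stalk x) := by
  have hrank := ((IsRegularLocalRing.iff_finrank_cotangentSpace (X.presheaf.stalk x)).1
    inferInstance).trans_le ((ringKrullDim_stalk_le x).trans hdim)
  exact ((tfae_of_isNoetherianRing_of_isLocalRing_of_isDomain (X.presheaf.stalk x)).out 5 0).1
    (by exact_mod_cast hrank)

end Dimension

section ClosedPoint

variable {K : Type u} [Field K] {X : Scheme.{u}} (f : X ⟶ Spec (CommRingCat.of K))

lemma toStalk_stalkSpecializes {x y : X} (h : x ⤳ y) :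
    toStalk f y ≫ X.presheaf.stalkSpecializes h = toStalk f x := by
  simp only [toStalk, Category.assoc]
  rw [X.presheaf.germ_stalkSpecializes (U := ⊤) trivial h]

variable [IsIntegral X]

lemma isAlgebraic_localRing_genericPoint {x : X} [Algebra.IsAlgebraic K (LocalRing f x)] :
    Algebra.IsAlgebraic K (LocalRing f (genericPoint X)) := by
  let : Algebra (LocalRing f x) (LocalRing f (genericPoint X)) :=
    inferInstanceAs (Algebra (X.presheaf.stalk x) X.functionField)
  have : IsScalarTower K (LocalRing f x) (LocalRing f (genericPoint X)) :=
    .of_algebraMap_eq fun k => (congrArg (fun φ => φ.hom k) (toStalk_stalkSpecializes f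
      ((genericPoint_spec X).specializes (Set.mem_univ x)))).symm
  have : IsFractionRing (LocalRing f x) (LocalRing f (genericPoint X)) :=
    inferInstanceAs (IsFractionRing (X.presheaf.stalk x) X.functionField)
  have : IsDomain (LocalRing f x) := inferInstanceAs (IsDomain (X.presheaf.stalk x))
  have : Algebra.IsAlgebraic (LocalRing f x) (LocalRing f (genericPoint X)) :=
    IsLocalization.isAlgebraic _ (nonZeroDivisors (LocalRing f x))
  exact .trans K (LocalRing f x) _

lemma subsingleton_of_isAlgebraic_localRing {x : X} [Algebra.IsAlgebraic K (LocalRing f x)] :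
    Subsingleton X := by
  have := isAlgebraic_localRing_genericPoint f (x := x)
  suffices hgen : ∀ y : X, y = genericPoint X from ⟨fun y z => (hgen y).trans (hgen z).symm⟩
  intro y
  obtain ⟨U, hU, hy, -⟩ := exists_isAffineOpen_mem_and_subset (x := y) (U := ⊤) trivial
  have : Nonempty U := ⟨⟨_, hy⟩⟩
  have hmem : genericPoint X ∈ U :=
    ((genericPoint_spec X).mem_open_set_iff U.isOpen).2 (by simpa using ‹Nonempty U›)
  let := (toSections f U).hom.toAlgebra
  let φ : Γ(X, U) →ₐ[K] LocalRing f (genericPoint X) :=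
    { (X.presheaf.germ U _ hmem).hom with
      commutes' := fun k => congrArg (fun g => g.hom k) (toSections_germ f hmem) }
  have : Algebra.IsAlgebraic K Γ(X, U) := .of_injective φ (X.germToFunctionField_injective U)
  let := (isField_of_isIntegral_of_isField' (R := K) (S := Γ(X, U)) (Field.toIsField K)).toField
  have : Subsingleton (Spec Γ(X, U)) := inferInstanceAs (Subsingleton (PrimeSpectrum Γ(X, U)))
  obtain ⟨y, rfl⟩ : y ∈ Set.range hU.fromSpec := hU.range_fromSpec ▸ hy
  obtain ⟨z, hz⟩ : genericPoint X ∈ Set.range hU.fromSpec := hU.range_fromSpec ▸ hmem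
  rw [← hz, Subsingleton.elim y z]

end ClosedPoint

section Residue

variable {K : Type u} [Field K]

lemma isAlgebraic_of_isField {A : Type*} [CommRing A] [IsDomain A] [Algebra K A] {q : ℕ}
    (hq : q ≠ 0) (hA : IsField A)
    (hres : ∀ a ∈ powSaturation K A q, ∃ k : K, ¬IsUnit (a - algebraMap K A k)) :
    Algebra.IsAlgebraic K A := by
  refine ⟨fun a => IsIntegral.isAlgebraic ?_⟩
  obtain ⟨k, hk⟩ := hres (a ^ q) (pow_mem_powSaturation q a)
  have haq : a ^ q - algebraMap K A k = 0 := by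
    by_contra h
    let := hA.toField
    exact hk (isUnit_iff_ne_zero.2 h)
  exact ⟨Polynomial.X ^ q - Polynomial.C k, Polynomial.monic_X_pow_sub_C k hq, by simpa using haq⟩

lemma exists_not_isUnit_sub_algebraMap {X : Scheme.{u}} {f : X ⟶ Spec (CommRingCat.of K)} {x : X}
    (hx : IsRationalPoint f x) (d : LocalRing f x) :
    ∃ k : K, ¬IsUnit (d - algebraMap K (LocalRing f x) k) := by
  obtain ⟨k, hk⟩ := hx.surjective ((X.residue x).hom d)
  exact ⟨k, fun hu => (hu.map (X.residue x).hom).ne_zero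
    ((map_sub (X.residue x).hom d _).trans (sub_eq_zero.2 hk.symm))⟩

lemma exists_not_isUnit_sub_algebraMap_of_algEquiv {A R : Type*} [CommRing A] [IsDomain A]
    [Algebra K A] [CommRing R] [Algebra K R] {q : ℕ} (e : R ≃ₐ[K] powSaturation K A q)
    (hR : ∀ d : R, ∃ k : K, ¬IsUnit (d - algebraMap K R k)) {a : A}
    (ha : a ∈ powSaturation K A q) : ∃ k : K, ¬IsUnit (a - algebraMap K A k) := by
  obtain ⟨k, hk⟩ := hR (e.symm ⟨a, ha⟩)
  refine ⟨k, fun hu => hk ?_⟩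
  have hunit : IsUnit ((⟨a, ha⟩ : powSaturation K A q) - algebraMap K _ k) :=
    (isDivisionClosed_powSaturation q).isUnit hu
  simpa using hunit.map e.symm

lemma isDiscreteValuationRing_localRing {X : Scheme.{u}} [IsIntegral X]
    (f : X ⟶ Spec (CommRingCat.of K)) (hdim : topologicalKrullDim X = 1) (x : X)
    [IsRegularLocalRing (X.presheaf.stalk x)] [IsDomain (LocalRing f x)] {q : ℕ} (hq : q ≠ 0)
    (hres : ∀ a ∈ powSaturation K (LocalRing f x) q,
      ∃ k : K, ¬IsUnit (a - algebraMap K (LocalRing f x) k)) :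
    IsDiscreteValuationRing (LocalRing f x) := by
  have : IsLocalRing (LocalRing f x) := inferInstanceAs (IsLocalRing (X.presheaf.stalk x))
  have : IsPrincipalIdealRing (LocalRing f x) := isPrincipalIdealRing_stalk hdim.le x
  refine { not_a_field' := fun hmax => ?_ }
  have := isAlgebraic_of_isField hq (IsLocalRing.isField_iff_maximalIdeal_eq.2 hmax) hres
  have := subsingleton_of_isAlgebraic_localRing f (x := x)
  have := hdim.symm.trans_le (topologicalKrullDim_zero_of_discreteTopology X)
  norm_num at this

end Residue

section Rank

variable {K L : Type*} [Field K] [Field L] [Algebra K L]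

lemma adjoin_range_algebraMap_tmul_eq_top {G A M : Type*} [CommRing G] [CommRing A] [Algebra K G]
    [Algebra K A] {φ : G →ₐ[K] A} (hA : ∀ a : A, ∃ s t : G, IsUnit (φ t) ∧ a * φ t = φ s)
    [Field M] [Algebra (L ⊗[K] A) M] [IsFractionRing (L ⊗[K] A) M] [Algebra L M]
    [IsScalarTower L (L ⊗[K] A) M] :
    IntermediateField.adjoin L
      (Set.range fun g => algebraMap (L ⊗[K] A) M (1 ⊗ₜ φ g)) = ⊤ := by
  set F := IntermediateField.adjoin L (Set.range fun g => algebraMap (L ⊗[K] A) M (1 ⊗ₜ φ g))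
  have hφ : ∀ g, algebraMap (L ⊗[K] A) M (1 ⊗ₜ φ g) ∈ F := fun g =>
    IntermediateField.subset_adjoin _ _ ⟨g, rfl⟩
  have hmap : ∀ w : L ⊗[K] G,
      algebraMap (L ⊗[K] A) M (Algebra.TensorProduct.map (AlgHom.id L L) φ w) ∈ F := by
    intro w
    induction w with
    | zero => simp
    | add x y hx hy => simpa using add_mem hx hy
    | tmul l g =>
      have hsplit : l ⊗ₜ[K] φ g = l • (1 ⊗ₜ φ g) := by simp [TensorProduct.smul_tmul']
      rw [Algebra.TensorProduct.map_tmul, AlgHom.id_apply, hsplit,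
        Algebra.algebraMap_eq_smul_one, smul_assoc, ← Algebra.algebraMap_eq_smul_one]
      exact F.smul_mem (hφ g)
  have htensor : ∀ z : L ⊗[K] A, algebraMap (L ⊗[K] A) M z ∈ F := by
    intro z
    obtain ⟨t, ht, w, hw⟩ := exists_mul_tmul_eq_map hA z
    have hunit : algebraMap (L ⊗[K] A) M (1 ⊗ₜ φ t) ≠ 0 :=
      ((ht.map (Algebra.TensorProduct.includeRight : A →ₐ[K] L ⊗[K] A)).map _).ne_zero
    rw [← mul_div_cancel_right₀ (algebraMap (L ⊗[K] A) M z) hunit, ← map_mul, hw]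
    exact div_mem (hmap w) (hφ t)
  refine eq_top_iff.2 fun m _ => ?_
  obtain ⟨a, b, -, rfl⟩ := IsFractionRing.div_surjective (A := L ⊗[K] A) m
  exact div_mem (htensor a) (htensor b)

end Rank

section Curve

variable {K : Type u} [Field K] {X : Scheme.{u}} (f : X ⟶ Spec (CommRingCat.of K))
  [LocallyOfFiniteType f]

lemma finiteType_toSections {U : X.Opens} (hU : IsAffineOpen U) :
    (toSections f U).hom.FiniteType := by
  have happ : toSections f U =
      (Scheme.ΓSpecIso (CommRingCat.of K)).inv ≫ f.appLE ⊤ U le_top := by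
    simp [toSections, Scheme.Hom.appLE]
  rw [happ]
  exact (f.finiteType_appLE (isAffineOpen_top _) hU le_top).comp (RingHom.FiniteType.of_surjective _
    (Scheme.ΓSpecIso (CommRingCat.of K)).symm.commRingCatIsoToRingEquiv.surjective)

lemma rank_frobenius_range_fractionRing_le [IsIntegral X] {L : Type*} [Field L] [Algebra K L]
    [PerfectField L] (p : ℕ) [Fact p.Prime] [CharP L p] (hdim : topologicalKrullDim X ≤ 1) (x : X)
    [IsDomain (L ⊗[K] LocalRing f x)] [CharP (FractionRing (L ⊗[K] LocalRing f x)) p] :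
    Module.rank (frobenius (FractionRing (L ⊗[K] LocalRing f x)) p).range
      (FractionRing (L ⊗[K] LocalRing f x)) ≤ p := by
  obtain ⟨U, hU, hx, -⟩ := exists_isAffineOpen_mem_and_subset (x := x) (U := ⊤) trivial
  have : Nonempty U := ⟨⟨_, hx⟩⟩
  let : Algebra K Γ(X, U) := (toSections f U).hom.toAlgebra
  have : Algebra.FiniteType K Γ(X, U) := finiteType_toSections f hU
  have : Ring.KrullDimLE 1 Γ(X, U) :=
    Ring.krullDimLE_iff.2 (by exact_mod_cast (ringKrullDim_sections_le hU).trans hdim)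
  let φ : Γ(X, U) →ₐ[K] LocalRing f x :=
    { (X.presheaf.germ U x hx).hom with
      commutes' := fun k => congrArg (fun g => g.hom k) (toSections_germ f hx) }
  let ι : Γ(X, U) →ₐ[K] FractionRing (L ⊗[K] LocalRing f x) :=
    ((IsScalarTower.toAlgHom K (L ⊗[K] LocalRing f x) _).comp
      Algebra.TensorProduct.includeRight).comp φ
  let : Algebra Γ(X, U) (FractionRing (L ⊗[K] LocalRing f x)) := ι.toRingHom.toAlgebra
  have : IsScalarTower K Γ(X, U) (FractionRing (L ⊗[K] LocalRing f x)) :=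
    .of_algebraMap_eq fun k => (ι.commutes k).symm
  exact rank_frobenius_range_le K (R := Γ(X, U)) (L := L) p
    (adjoin_range_algebraMap_tmul_eq_top (φ := φ) (exists_germ_mul_eq_germ hU hx))

end Curve

end FrobeniusTower

end

open FrobeniusTower in
theorem mainTheorem9_general {K : Type u} [Field K] (p : ℕ) [Fact p.Prime] [CharP K p]
    {C : Scheme.{u}} (f : C ⟶ Spec (CommRingCat.of K)) [GeometricallyIntegral f]
    [LocallyOfFiniteType f] (hdim : topologicalKrullDim C = 1)
    (P : C) (hreg : IsRegularLocalRing (C.presheaf.stalk P)) (Q : ∀ i : ℕ, towerCurve p f i)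
    (hQ : ∀ i : ℕ, towerToTwist p f i (Q i) = relFrobenius p f i P)
    (n : ℕ) (hrat : IsRationalPoint (towerHom p f n) (Q n)) :
    (∃ c : ℕ, ∀ l : ℕ, c ≤ l → l ∈ geomSemigroup f P) ∧
    (∀ i < n, Module.Finite (AlgebraicClosure K) (DifferentialCoker (towerHom p f i) (Q i))) ∧
    conductor f P =
      ∑ i ∈ Finset.range n, (p - 1) * (differentialDegree (towerHom p f i) (Q i) - 1) * p ^ i := by
  have := isIntegral_of_geometricallyIntegral f
  have : IsDomain (LocalRing f P) := inferInstanceAs (IsDomain (C.presheaf.stalk P))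
  have : IsPrincipalIdealRing (LocalRing f P) := isPrincipalIdealRing_stalk hdim.le P
  have e (i : ℕ) := (nonempty_algEquiv_localRing_tower p f i (Q i) (hQ i)).some
  have hres : ∀ a ∈ powSaturation K (LocalRing f P) (p ^ n),
      ∃ k : K, ¬IsUnit (a - algebraMap K (LocalRing f P) k) := fun _ =>
    exists_not_isUnit_sub_algebraMap_of_algEquiv (e n) (exists_not_isUnit_sub_algebraMap hrat)
  have : IsDiscreteValuationRing (LocalRing f P) :=
    isDiscreteValuationRing_localRing f hdim P (pow_ne_zero n (Fact.out : p.Prime).ne_zero) hres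
  let M := FractionRing (AlgebraicClosure K ⊗[K] LocalRing f P)
  have : IsDomain (AlgebraicClosure K ⊗[K] LocalRing f P) := isDomain_tensor_stalk f P
  have : CharP (LocalRing f P) p := charP_of_injective_algebraMap (algebraMap K _).injective p
  have : CharP M p := charP_of_injective_algebraMap (algebraMap (AlgebraicClosure K) M).injective p
  have hrank := rank_frobenius_range_fractionRing_le f (L := AlgebraicClosure K) p hdim.le P
  obtain ⟨hlarge, hfinite, hsum⟩ := conductor_formula (L := AlgebraicClosure K) M hrank n hres e
  refine ⟨hlarge, hfinite, hsum.trans (Finset.sum_congr rfl fun i _ => ?_)⟩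
  rw [differentialDegree, Nat.add_sub_cancel_left]

theorem mainTheorem9 {K : Type u} [Field K] [IsSepClosed K] (p : ℕ) [Fact p.Prime] [CharP K p]
    {C : Scheme.{u}} (f : C ⟶ Spec (CommRingCat.of K)) [GeometricallyIntegral f]
    [IsSeparated f] [LocallyOfFiniteType f] [QuasiCompact f]
    (hdim : topologicalKrullDim C = 1)
    (hreg : ∀ x : C, IsRegularLocalRing (C.presheaf.stalk x))
    (P : C) (Q : ∀ i : ℕ, FrobeniusTower.towerCurve p f i)
    (hQ : ∀ i : ℕ, FrobeniusTower.towerToTwist p f i (Q i) = FrobeniusTower.relFrobenius p f i P)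
    (n : ℕ) (hn : 0 < n)
    (hrat : FrobeniusTower.IsRationalPoint (FrobeniusTower.towerHom p f n) (Q n)) :
    (∃ c : ℕ, ∀ l : ℕ, c ≤ l → l ∈ FrobeniusTower.geomSemigroup f P) ∧
    (∀ i < n, Module.Finite (AlgebraicClosure K)
      (FrobeniusTower.DifferentialCoker (FrobeniusTower.towerHom p f i) (Q i))) ∧
    FrobeniusTower.conductor f P =
      ∑ i ∈ Finset.range n,
        (p - 1) * (FrobeniusTower.differentialDegree (FrobeniusTower.towerHom p f i) (Q i) - 1)
          * p ^ i :=
  mainTheorem9_general p f hdim P (hreg P) Q hQ n hrat
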